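/- **Setting.** For each $n$ let $\boldsymbol x_i=\boldsymbol\eta(\boldsymbol\alpha_i)+\boldsymbol u_i\in\mathbb R^p$, $i\in[n]$, $p=p_n$, with random latent variables $\boldsymbol\alpha_i\in\mathbb R^r$ ($r\ge1$) and random latent functions $\boldsymbol\eta=(\eta_1,\dots,\eta_p)$, which generate the $\sigma$-field $\mathscr F$. Put $H_{li}=\eta_l(\boldsymbol\alpha_i)$, $X_{li}=H_{li}+u_{il}$. The rows are split as $[p]=\mathcal R^\dagger\sqcup\mathcal R^\ddagger$ with $p^\dagger=|\mathcal R^\dagger|\asymp p^\ddagger=|\mathcal R^\ddagger|\asymp p$; $X^\dagger,H^\dagger$ are the submatrices with rows in $\mathcal R^\dagger$. Write $a_n\lesssim_{\mathbb P}b_n$ if $\lim_{\varepsilon\to\infty}\limsup_n\mathbb P[|a_n/b_n|\ge\varepsilon]=0$; $s_{\min},s_{\max}$ are the extreme singular values, $\|\cdot\|_{\max}$ is the entrywise sup-norm, and w.p.a.1 means with probability approaching one. *Regularities.* (a) The $\boldsymbol\alpha_i$ are i.i.d. on a compact convex set $\mathcal A$ with a density bounded and bounded away from zero on $\mathcal A$.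 (b) Each $\eta_l$ is $\bar m$ times continuously differentiable on $\mathcal A$, $\bar m\ge2$, with all partial derivatives of order at most $\bar m$ bounded by a universal constant. (c) Conditionally on $\mathscr F$ the $u_{il}$ are independent over $i,l$ with mean zero, and for some $\nu>0$, $\max_{i,l}\mathbb E[|u_{il}|^{2+\nu}|\mathscr F]<\infty$ a.s. *Indirect matching.* For a measurable "distance" $\rho$ between units (a function of two columns, or of the whole matching data and two unit labels), constants $\rho_0\ge0$, $\underline\varsigma,\bar\varsigma>0$ and positive $a_n=o(1)$: $\max_{i\ne j}|\rho(X^\dagger_{\cdot i},X^\dagger_{\cdot j})-\rho(H^\dagger_{\cdot i},H^\dagger_{\cdot j})-\rho_0|\lesssim_{\mathbb P}a_n$, $\ \max_{\boldsymbol\alpha_i\ne\boldsymbol\alpha_j}\rho(H^\dagger_{\cdot i},H^\dagger_{\cdot j})/\|\boldsymbol\alpha_i-\boldsymbol\alpha_j\|^{\bar\varsigma}\lesssim_{\mathbb P}1$, and $\min_{\boldsymbol\alpha_i\ne\boldsymbol\alpha_j}\rho(H^\dagger_{\cdot i},H^\dagger_{\cdot j})/\|\boldsymbol\alpha_i-\boldsymbol\alpha_j\|^{\underline\varsigma}$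 is positive and bounded away from zero in probability ($\gtrsim_{\mathbb P}1$). *Local quantities.* Let $j_1(i),\dots,j_K(i)$ be $K=K_n$ nearest neighbours of unit $i$ (including $i$) for the distance $\rho$ on $X^\dagger$, ties being broken in any measurable way. Let $h_n=(K/n)^{\bar\varsigma/(\underline\varsigma r)}$ and $\delta_n=(K\wedge p)^{1/2}/\sqrt{\log(n\vee p)}$. Let $1\le m\le\bar m$ be fixed and $\mathsf d=\binom{m-1+r}{r}$. Let $H_{\langle i\rangle}=(\eta_l(\boldsymbol\alpha_{j_k(i)}))_{l\in\mathcal R^\ddagger,k\le K}$, and let $\Lambda_{\langle i\rangle}\in\mathbb R^{K\times\mathsf d}$ have $k$th row $\big((\boldsymbol\alpha_{j_k(i)}-\boldsymbol\alpha_i)^{\boldsymbol q}\big)_{|\boldsymbol q|\le m-1}$, the multi-indices $\boldsymbol q$ being listed in any order of nondecreasing degree. Let $\Upsilon=\mathrm{diag}(\upsilon_1,\dots,\upsilon_{\mathsf d})=\mathrm{diag}(h_n^{|\boldsymbol q|})=\mathrm{diag}(1,h_nI_{\ell_1},\dots,h_n^{m-1}I_{\ell_{m-1}})$ with $\ell_j=\binom{r+j-1}{j}$.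 Put $F_{\langle i\rangle}=\mathbb E^\ddagger[H_{\langle i\rangle}\Lambda_{\langle i\rangle}]\,\mathbb E^\ddagger[\Lambda_{\langle i\rangle}'\Lambda_{\langle i\rangle}]^{-1}$ and $\Xi_{\langle i\rangle}=H_{\langle i\rangle}-F_{\langle i\rangle}\Lambda_{\langle i\rangle}'$, where $\mathbb E^\ddagger$ is the expectation conditional on $\mathscr F$ and $X^\dagger$. **Theorem.** Assume the regularity and indirect matching conditions. Let $\mathscr D\eta_l$ be the vector of all partial derivatives $\partial^{\boldsymbol q}\eta_l$, $|\boldsymbol q|\le m-1$, and suppose that for some constant $c>0$, w.p.a.1, for all $i\in[n]$, $$s_{\min}\Big(\tfrac1{p^\ddagger}\sum_{l\in\mathcal R^\ddagger}\mathscr D\eta_l(\boldsymbol\alpha_i)\,\mathscr D\eta_l(\boldsymbol\alpha_i)'\Big)\ge c .$$ If $K/n\to0$, $\delta_n^{-1}/h_n^{m-1}=o(1)$, $a_n^{1/\underline\varsigma}=o(h_n)$ and $\bar\varsigma=\underline\varsigma$, then the local approximation condition holds with $\mathsf d_i=\mathsf d$ for all $i$. That is, $\mathbb E^\ddagger[\Lambda_{\langle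 i\rangle}'\Lambda_{\langle i\rangle}]$ is invertible for all $i$ w.p.a.1, the conditional expectations above being those of integrable variables, and: (a) $\max_i\|\Lambda_{\langle i\rangle}\Upsilon^{-1}\|_{\max}\lesssim_{\mathbb P}1$ and $1\lesssim_{\mathbb P}\min_i s_{\min}\big(\tfrac1K\Upsilon^{-1}\Lambda_{\langle i\rangle}'\Lambda_{\langle i\rangle}\Upsilon^{-1}\big)\le\max_i s_{\max}\big(\tfrac1K\Upsilon^{-1}\Lambda_{\langle i\rangle}'\Lambda_{\langle i\rangle}\Upsilon^{-1}\big)\lesssim_{\mathbb P}1$; moreover $\upsilon_1\ge\dots\ge\upsilon_{\mathsf d}>0$, and for each $j<\mathsf d$ either $\upsilon_j/\upsilon_{j+1}\lesssim1$ or $\upsilon_j/\upsilon_{j+1}\to\infty$; (b) $\max_i\|\Xi_{\langle i\rangle}\|_{\max}\lesssim_{\mathbb P}h_n^m$, $h_n^m=o(\upsilon_{\mathsf d})$ and $\delta_n^{-1}/\upsilon_{\mathsf d}=o(1)$; (c) $1\lesssim_{\mathbb P}\min_i s_{\min}\big(\tfrac1{p^\ddagger}F_{\langle i\rangle}'F_{\langle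 i\rangle}\big)\le\max_i s_{\max}\big(\tfrac1{p^\ddagger}F_{\langle i\rangle}'F_{\langle i\rangle}\big)\lesssim_{\mathbb P}1$. -/

import Mathlib

open MeasureTheory ProbabilityTheory Filter Topology
open scoped ENNReal BigOperators Matrix

noncomputable section

/-! ### Stochastic orders along a triangular array of probability spaces -/

/-- `a_n ≲_P b_n`: `lim_{ε → ∞} limsup_n P_n[ |a_n| ≥ ε b_n ] = 0`.  For `b_n > 0` the event is
`|a_n / b_n| ≥ ε`.  The scale `b_n` is understood to be positive: outcomes with `b_n ≤ 0` always
count against the relation, so that `1 ≲_P b_n` says that `b_n` is positive and bounded away from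
zero with probability close to one. -/
def StochLE {Ω : ℕ → Type*} [∀ n, MeasurableSpace (Ω n)] (μ : ∀ n, Measure (Ω n))
    (a b : ∀ n, Ω n → ℝ) : Prop :=
  Tendsto (fun ε : ℝ => limsup (fun n => μ n {ω | ε * b n ω ≤ |a n ω|}) atTop) atTop (𝓝 0)

/-- The events `S_n` hold with probability approaching one: the (outer) probability of their
failure tends to zero. -/
def WPA1 {Ω : ℕ → Type*} [∀ n, MeasurableSpace (Ω n)] (μ : ∀ n, Measure (Ω n))
    (S : ∀ n, Set (Ω n)) : Prop :=
  Tendsto (fun n => μ n (S n)ᶜ) atTop (𝓝 0)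

/-! ### Matrices -/

/-- Entrywise sup-norm. -/
def matMaxNorm {ι κ : Type*} (A : Matrix ι κ ℝ) : ℝ := ⨆ ab : ι × κ, |A ab.1 ab.2|

/-- Largest singular value (Mathlib lists singular values in decreasing order from index `0`). -/
def sMax {a b : ℕ} (A : Matrix (Fin a) (Fin b) ℝ) : ℝ :=
  (Matrix.toEuclideanLin A).singularValues 0

/-- Smallest singular value: the last one of the `min a b` singular values of an `a × b` matrix. -/
def sMin {a b : ℕ} (A : Matrix (Fin a) (Fin b) ℝ) : ℝ :=
  (Matrix.toEuclideanLin A).singularValues (min a b - 1)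

/-- Entrywise conditional expectation of a random matrix. -/
def condExpMat {Ω : Type*} {mΩ : MeasurableSpace Ω} (μ : Measure Ω) (𝒢 : MeasurableSpace Ω)
    {ι κ : Type*} (A : Ω → Matrix ι κ ℝ) (ω : Ω) : Matrix ι κ ℝ :=
  Matrix.of fun a b => (μ[fun ω' => A ω' a b | 𝒢]) ω

/-! ### Multi-indices, partial derivatives, monomials -/

/-- The partial derivative `∂^q f (x)`, where derivatives are taken within `A` (on the boundary of
a convex body, derivatives are limits from inside).  The list contains the coordinate `t` exactly
`q t` times. -/
def partialDeriv {r : ℕ} (A : Set (EuclideanSpace ℝ (Fin r))) (q : Fin r → ℕ)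
    (f : EuclideanSpace ℝ (Fin r) → ℝ) (x : EuclideanSpace ℝ (Fin r)) : ℝ :=
  iteratedFDerivWithin ℝ ((List.finRange r).flatMap fun t => List.replicate (q t) t).length f A x
    fun k => EuclideanSpace.single
      (((List.finRange r).flatMap fun t => List.replicate (q t) t).get k) (1 : ℝ)

/-- An enumeration of all `r`-variate multi-indices of degree at most `M`, by nondecreasing
degree; there are `(M + r).choose r` of them. -/
structure GradedEnum (r M : ℕ) where
  toEquiv : Fin ((M + r).choose r) ≃ {q : Fin r → ℕ // ∑ t, q t ≤ M}
  mono : Monotone fun a => ∑ t, (toEquiv a : Fin r → ℕ) t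

/-- The degree `|q|` of the `a`-th multi-index. -/
def GradedEnum.deg {r M : ℕ} (e : GradedEnum r M) (a : Fin ((M + r).choose r)) : ℕ :=
  ∑ t, (e.toEquiv a : Fin r → ℕ) t

/-- Graded enumerations exist. -/
theorem GradedEnum.exists_gradedEnum (r M : ℕ) : Nonempty (GradedEnum r M) := by
  classical
  have e1 : {q : Fin r → ℕ // ∑ t, q t ≤ M} ≃ {P : Fin (r + 1) → ℕ // ∑ i, P i = M} :=
    { toFun := fun q => ⟨Fin.cons (M - ∑ t, q.1 t) q.1, by
        rw [Fin.sum_univ_succ]; simp only [Fin.cons_zero, Fin.cons_succ]; have := q.2; omega⟩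
      invFun := fun P => ⟨fun t => P.1 t.succ, by
        have := P.2; rw [Fin.sum_univ_succ] at this; change ∑ t, P.1 (Fin.succ t) ≤ M; omega⟩
      left_inv := fun q => by ext t; simp
      right_inv := fun P => by
        have h := P.2
        rw [Fin.sum_univ_succ] at h
        apply Subtype.ext
        funext i
        refine Fin.cases ?_ (fun t => ?_) i
        · simp only [Fin.cons_zero]; omega
        · simp }
  have e2 := e1.trans (Sym.equivNatSumOfFintype (Fin (r + 1)) M).symm
  have hc : Fintype.card (Sym (Fin (r + 1)) M) = (M + r).choose r := by
    rw [Sym.card_sym_eq_choose, Fintype.card_fin]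
    have : r + 1 + M - 1 = M + r := by omega
    rw [this, ← Nat.choose_symm_of_eq_add (rfl : M + r = M + r)]
  let g : Fin ((M + r).choose r) ≃ {q : Fin r → ℕ // ∑ t, q t ≤ M} :=
    ((Fintype.equivFinOfCardEq hc).symm).trans e2.symm
  exact ⟨⟨(Tuple.sort fun a => ∑ t, (g a : Fin r → ℕ) t).trans g,
    Tuple.monotone_sort fun a => ∑ t, (g a : Fin r → ℕ) t⟩⟩

/-! ### The nonlinear factor model -/

/-- The bandwidth `h_n = (K / n)^{ς̄ / (ς r)}`. -/
def bandwidth (K : ℕ → ℕ) (ςlo ςup : ℝ) (r n : ℕ) : ℝ :=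
  ((K n : ℝ) / (n : ℝ)) ^ (ςup / (ςlo * (r : ℝ)))

/-- A triangular array of nonlinear factor models: for every sample size `n`, on the space `Ω n`,
latent variables `α_i` (`i ∈ [n]`), random latent functions `η_l` (`l ∈ [p n]`), errors `u_{il}`,
and the subset `Rdag n` of the rows `[p n]` that is used for matching; local PCA uses the
complementary rows. -/
structure FactorArray (Ω : ℕ → Type*) [∀ n, MeasurableSpace (Ω n)] (r : ℕ) where
  p : ℕ → ℕ
  α : ∀ n, Fin n → Ω n → EuclideanSpace ℝ (Fin r)
  η : ∀ n, Fin (p n) → Ω n → EuclideanSpace ℝ (Fin r) → ℝ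
  u : ∀ n, Fin n → Fin (p n) → Ω n → ℝ
  Rdag : ∀ n, Finset (Fin (p n))
  measurable_α : ∀ n i, Measurable (α n i)
  measurable_η : ∀ n l,
    Measurable fun z : Ω n × EuclideanSpace ℝ (Fin r) => η n l z.1 z.2
  measurable_u : ∀ n i l, Measurable (u n i l)

namespace FactorArray

variable {Ω : ℕ → Type*} [∀ n, MeasurableSpace (Ω n)] {r : ℕ} (M : FactorArray Ω r)

/-- The rows used for local PCA. -/
abbrev Rddag (n : ℕ) : Finset (Fin (M.p n)) := (M.Rdag n)ᶜ

/-- Matching data: one vector, indexed by the matching rows, for every unit. -/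
abbrev MatchData (n : ℕ) : Type := Fin n → {l // l ∈ M.Rdag n} → ℝ

/-- `H_{li} = η_l(α_i)`. -/
def H (n : ℕ) (i : Fin n) (l : Fin (M.p n)) (ω : Ω n) : ℝ := M.η n l ω (M.α n i ω)

/-- `X = H + U`. -/
def X (n : ℕ) (i : Fin n) (l : Fin (M.p n)) (ω : Ω n) : ℝ := M.H n i l ω + M.u n i l ω

/-- Noise-free matching data. -/
def Hdag (n : ℕ) (ω : Ω n) : M.MatchData n := fun i l => M.H n i l ω

/-- Observed matching data. -/
def Xdag (n : ℕ) (ω : Ω n) : M.MatchData n := fun i l => M.X n i l ω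

/-- The σ-field generated by the latent variables and the latent functions (on `A`). -/
@[reducible] def sigmaLatent (A : Set (EuclideanSpace ℝ (Fin r))) (n : ℕ) : MeasurableSpace (Ω n) :=
  (⨆ i : Fin n, MeasurableSpace.comap (M.α n i) inferInstance) ⊔
    ⨆ (l : Fin (M.p n)) (x : A),
      MeasurableSpace.comap (fun ω => M.η n l ω (x : EuclideanSpace ℝ (Fin r))) inferInstance

/-- The conditioning σ-field of the local approximation: everything is conditional on the latent
variables and functions, and on the matching data. -/
@[reducible] def sigmaMatch (A : Set (EuclideanSpace ℝ (Fin r))) (n : ℕ) : MeasurableSpace (Ω n) :=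
  M.sigmaLatent A n ⊔ MeasurableSpace.comap (M.Xdag n) inferInstance

/-- The regularity conditions on latent variables, latent functions and errors. -/
structure Regularities (μ : ∀ n, Measure (Ω n)) (A : Set (EuclideanSpace ℝ (Fin r)))
    (mbar : ℕ) : Prop where
  compact : IsCompact A
  convex : Convex ℝ A
  indep : ∀ n, iIndepFun (M.α n) (μ n)
  /-- the `α_i` have a common density on `A`, bounded and bounded away from zero there -/
  density : ∃ (f : EuclideanSpace ℝ (Fin r) → ℝ) (c C : ℝ), Measurable f ∧ 0 < c ∧
    (∀ x ∈ A, c ≤ f x ∧ f x ≤ C) ∧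
    ∀ n i, (μ n).map (M.α n i) = (volume.restrict A).withDensity fun x => ENNReal.ofReal (f x)
  two_le : 2 ≤ mbar
  smooth : ∀ n l, ∀ᵐ ω ∂μ n, ContDiffOn ℝ mbar (M.η n l ω) A
  bounded : ∃ B : ℝ, ∀ n l, ∀ᵐ ω ∂μ n, ∀ x ∈ A, ∀ q : Fin r → ℕ, ∑ t, q t ≤ mbar →
    |partialDeriv A q (M.η n l ω) x| ≤ B
  u_integrable : ∀ n i l, Integrable (M.u n i l) (μ n)
  u_mean : ∀ n i l, (μ n)[M.u n i l | M.sigmaLatent A n] =ᵐ[μ n] 0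
  /-- all the `u_{il}` are independent conditionally on the latent σ-field -/
  u_condIndep : ∀ n, ∀ S : Fin n → Fin (M.p n) → Set ℝ, (∀ i l, MeasurableSet (S i l)) →
    (μ n)⟦⋂ (i) (l), M.u n i l ⁻¹' S i l | M.sigmaLatent A n⟧ =ᵐ[μ n]
      fun ω => ∏ i, ∏ l, ((μ n)⟦M.u n i l ⁻¹' S i l | M.sigmaLatent A n⟧) ω
  u_moment : ∃ ν : ℝ, 0 < ν ∧ ∀ n i l, ∀ᵐ ω ∂μ n,
    condLExp (M.sigmaLatent A n) (μ n) (fun ω' => ENNReal.ofReal (|M.u n i l ω'| ^ (2 + ν))) ω < ⊤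

/-- The two groups of rows are both of the order of `p`. -/
def BalancedSplit : Prop :=
  ∃ c : ℝ, 0 < c ∧ ∀ᶠ n in atTop,
    c * (M.p n : ℝ) ≤ ((M.Rdag n).card : ℝ) ∧ c * (M.p n : ℝ) ≤ ((M.Rddag n).card : ℝ)

/-- The indirect-matching condition.  The "distance" `ρ` between the units `i` and `j` may use the
whole data set (as the pseudo-max distance does). -/
structure IndirectMatching (μ : ∀ n, Measure (Ω n))
    (ρ : ∀ n, M.MatchData n → Fin n → Fin n → ℝ) (ρ₀ ςlo ςup : ℝ) (a : ℕ → ℝ) : Prop where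
  rho_nonneg : 0 ≤ ρ₀
  lo_pos : 0 < ςlo
  up_pos : 0 < ςup
  a_pos : ∀ᶠ n in atTop, 0 < a n
  a_tendsto : Tendsto a atTop (𝓝 0)
  denoise : StochLE μ
    (fun n ω => ⨆ ij : {ij : Fin n × Fin n // ij.1 ≠ ij.2},
      |ρ n (M.Xdag n ω) ij.1.1 ij.1.2 - ρ n (M.Hdag n ω) ij.1.1 ij.1.2 - ρ₀|)
    (fun n _ => a n)
  upper : StochLE μ
    (fun n ω => ⨆ ij : {ij : Fin n × Fin n // M.α n ij.1 ω ≠ M.α n ij.2 ω},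
      ρ n (M.Hdag n ω) ij.1.1 ij.1.2 / ‖M.α n ij.1.1 ω - M.α n ij.1.2 ω‖ ^ ςup)
    (fun _ _ => 1)
  lower : StochLE μ
    (fun _ _ => 1)
    (fun n ω => ⨅ ij : {ij : Fin n × Fin n // M.α n ij.1 ω ≠ M.α n ij.2 ω},
      ρ n (M.Hdag n ω) ij.1.1 ij.1.2 / ‖M.α n ij.1.1 ω - M.α n ij.1.2 ω‖ ^ ςlo)

/-- `nn n V i` lists, without repetition, `K n` nearest neighbours of the unit `i` (including `i`
itself) for the distance `ρ` and the matching data `V`: no other unit is closer to `i` than one of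
the listed ones.  Ties are broken in an arbitrary measurable way. -/
structure IsNearestNeighbors (K : ℕ → ℕ) (ρ : ∀ n, M.MatchData n → Fin n → Fin n → ℝ)
    (nn : ∀ n, M.MatchData n → Fin n → Fin (K n) → Fin n) : Prop where
  measurable : ∀ n i k, Measurable fun V => nn n V i k
  injective : ∀ n V i, Function.Injective (nn n V i)
  self_mem : ∀ n V i, i ∈ Set.range (nn n V i)
  nearest : ∀ n V i k j, nn n V i k ≠ i → j ∉ Set.range (nn n V i) →
    ρ n V i (nn n V i k) ≤ ρ n V i j

/-- `δ_n = (K ∧ p)^{1/2} / √(log (n ∨ p))`. -/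
def delta (K : ℕ → ℕ) (n : ℕ) : ℝ :=
  √(min (K n) (M.p n) : ℕ) / √(Real.log (max n (M.p n) : ℕ))

/-- The index `j_k(i)` of the `k`-th neighbour of the unit `i` found from `X†`. -/
def nbr {K : ℕ → ℕ} (nn : ∀ n, M.MatchData n → Fin n → Fin (K n) → Fin n)
    (n : ℕ) (i : Fin n) (k : Fin (K n)) (ω : Ω n) : Fin n := nn n (M.Xdag n ω) i k

/-- The local signal matrix `H_{⟨i⟩}`. -/
def Hloc {K : ℕ → ℕ} (nn : ∀ n, M.MatchData n → Fin n → Fin (K n) → Fin n)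
    (n : ℕ) (i : Fin n) (ω : Ω n) : Matrix {l // l ∈ M.Rddag n} (Fin (K n)) ℝ :=
  Matrix.of fun l k => M.H n (M.nbr nn n i k ω) l ω

/-- The `L²`-projection coefficients `F_{⟨i⟩} = E‡[H_{⟨i⟩} Λ_{⟨i⟩}] E‡[Λ_{⟨i⟩}' Λ_{⟨i⟩}]⁻¹`. -/
def Floc (μ : ∀ n, Measure (Ω n)) (A : Set (EuclideanSpace ℝ (Fin r))) {K : ℕ → ℕ}
    (nn : ∀ n, M.MatchData n → Fin n → Fin (K n) → Fin n) {d : ∀ n, Fin n → ℕ}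
    (Λ : ∀ n (i : Fin n), Ω n → Matrix (Fin (K n)) (Fin (d n i)) ℝ)
    (n : ℕ) (i : Fin n) (ω : Ω n) : Matrix {l // l ∈ M.Rddag n} (Fin (d n i)) ℝ :=
  condExpMat (μ n) (M.sigmaMatch A n) (fun ω' => M.Hloc nn n i ω' * Λ n i ω') ω *
    (condExpMat (μ n) (M.sigmaMatch A n) (fun ω' => (Λ n i ω')ᵀ * Λ n i ω') ω)⁻¹

/-- The projection errors `Ξ_{⟨i⟩} = H_{⟨i⟩} - F_{⟨i⟩} Λ_{⟨i⟩}'`. -/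
def Xiloc (μ : ∀ n, Measure (Ω n)) (A : Set (EuclideanSpace ℝ (Fin r))) {K : ℕ → ℕ}
    (nn : ∀ n, M.MatchData n → Fin n → Fin (K n) → Fin n) {d : ∀ n, Fin n → ℕ}
    (Λ : ∀ n (i : Fin n), Ω n → Matrix (Fin (K n)) (Fin (d n i)) ℝ)
    (n : ℕ) (i : Fin n) (ω : Ω n) : Matrix {l // l ∈ M.Rddag n} (Fin (K n)) ℝ :=
  M.Hloc nn n i ω - M.Floc μ A nn Λ n i ω * (Λ n i ω)ᵀ

/-- The scaled Gram matrix `K⁻¹ Υ⁻¹ Λ' Λ Υ⁻¹`. -/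
def scaledGram {K d : ℕ} (υ : Fin d → ℝ) (L : Matrix (Fin K) (Fin d) ℝ) :
    Matrix (Fin d) (Fin d) ℝ :=
  (K : ℝ)⁻¹ • ((Matrix.diagonal υ)⁻¹ * Lᵀ * L * (Matrix.diagonal υ)⁻¹)

/-- The local-approximation condition, of order `m`, with `d n i` local factors for the unit `i`,
loadings `Λ_{⟨i⟩}` and scalings `Υ_{⟨i⟩} = diag(υ n i)`, for a bandwidth sequence `h`. -/
structure LocalApproximation (μ : ∀ n, Measure (Ω n)) (A : Set (EuclideanSpace ℝ (Fin r)))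
    {K : ℕ → ℕ} (nn : ∀ n, M.MatchData n → Fin n → Fin (K n) → Fin n) (h : ℕ → ℝ) (m : ℕ)
    (d : ∀ n, Fin n → ℕ) (Λ : ∀ n (i : Fin n), Ω n → Matrix (Fin (K n)) (Fin (d n i)) ℝ)
    (υ : ∀ n (i : Fin n), Fin (d n i) → ℝ) : Prop where
  /-- the conditional expectations that define `F_{⟨i⟩}` are those of integrable variables, -/
  integrable_HΛ : ∀ n i l b, Integrable (fun ω => (M.Hloc nn n i ω * Λ n i ω) l b) (μ n)
  integrable_ΛΛ : ∀ n i a b, Integrable (fun ω => ((Λ n i ω)ᵀ * Λ n i ω) a b) (μ n)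
  /-- and the inverse exists for all units with probability approaching one -/
  invertible : WPA1 μ fun n => {ω | ∀ i, IsUnit
    (condExpMat (μ n) (M.sigmaMatch A n) (fun ω' => (Λ n i ω')ᵀ * Λ n i ω') ω).det}
  d_pos : ∀ n i, 0 < d n i
  scale_pos : ∀ n i j, 0 < υ n i j
  scale_anti : ∀ n i, Antitone (υ n i)
  loadings_max : StochLE μ
    (fun n ω => ⨆ i : Fin n, matMaxNorm (Λ n i ω * (Matrix.diagonal (υ n i))⁻¹)) (fun _ _ => 1)
  loadings_min : StochLE μ (fun _ _ => 1)
    (fun n ω => ⨅ i : Fin n, sMin (scaledGram (υ n i) (Λ n i ω)))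
  loadings_sup : StochLE μ
    (fun n ω => ⨆ i : Fin n, sMax (scaledGram (υ n i) (Λ n i ω))) (fun _ _ => 1)
  /-- consecutive scales are either of the same order or of different orders (`S` is the set of
  units, labelled by natural numbers, for which the first alternative holds) -/
  scale_ratio : ∀ j : ℕ, ∃ S : Set ℕ,
    (∃ C : ℝ, ∀ᶠ n in atTop, ∀ (i : Fin n) (hj : j + 1 < d n i), (i : ℕ) ∈ S →
      υ n i ⟨j, Nat.lt_of_succ_lt hj⟩ / υ n i ⟨j + 1, hj⟩ ≤ C) ∧
    (∀ C : ℝ, ∀ᶠ n in atTop, ∀ (i : Fin n) (hj : j + 1 < d n i), (i : ℕ) ∉ S →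
      C ≤ υ n i ⟨j, Nat.lt_of_succ_lt hj⟩ / υ n i ⟨j + 1, hj⟩)
  bias : StochLE μ (fun n ω => ⨆ i : Fin n, matMaxNorm (M.Xiloc μ A nn Λ n i ω))
    (fun n _ => h n ^ m)
  /-- `h_n^m = o(υ_{d_i})`, uniformly over the units -/
  bias_small : ∀ ε : ℝ, 0 < ε → ∀ᶠ n in atTop, ∀ (i : Fin n) (j : Fin (d n i)),
    (j : ℕ) + 1 = d n i → h n ^ m ≤ ε * υ n i j
  /-- `δ_n⁻¹ / υ_{d_i} = o(1)`, uniformly over the units -/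
  noise_small : ∀ ε : ℝ, 0 < ε → ∀ᶠ n in atTop, ∀ (i : Fin n) (j : Fin (d n i)),
    (j : ℕ) + 1 = d n i → (M.delta K n)⁻¹ / υ n i j ≤ ε
  factors_min : StochLE μ (fun _ _ => 1)
    (fun n ω => ⨅ i : Fin n, sMin (((M.Rddag n).card : ℝ)⁻¹ •
      ((M.Floc μ A nn Λ n i ω)ᵀ * M.Floc μ A nn Λ n i ω)))
  factors_sup : StochLE μ
    (fun n ω => ⨆ i : Fin n, sMax (((M.Rddag n).card : ℝ)⁻¹ •
      ((M.Floc μ A nn Λ n i ω)ᵀ * M.Floc μ A nn Λ n i ω)))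
    (fun _ _ => 1)

/-- The monomial loadings of degree at most `m - 1` centred at `α_i`: the `(k, a)` entry of
`Λ_{⟨i⟩}` is `(α_{j_k(i)} - α_i)^q` for the `a`-th multi-index `q`. -/
def monomialLoadings {K : ℕ → ℕ} (nn : ∀ n, M.MatchData n → Fin n → Fin (K n) → Fin n) {m : ℕ}
    (e : GradedEnum r (m - 1)) (n : ℕ) (i : Fin n) (ω : Ω n) :
    Matrix (Fin (K n)) (Fin ((m - 1 + r).choose r)) ℝ :=
  Matrix.of fun k a => ∏ t,
    (M.α n (M.nbr nn n i k ω) ω t - M.α n i ω t) ^ (e.toEquiv a : Fin r → ℕ) t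

/-- The Gram matrix `(p‡)⁻¹ ∑_{l ∈ R‡} (𝒟η_l(α_i)) (𝒟η_l(α_i))'`, where `𝒟η_l` collects the
partial derivatives of `η_l` of all orders `0, …, m - 1`. -/
def derivGram (A : Set (EuclideanSpace ℝ (Fin r))) {m : ℕ} (e : GradedEnum r (m - 1))
    (n : ℕ) (i : Fin n) (ω : Ω n) :
    Matrix (Fin ((m - 1 + r).choose r)) (Fin ((m - 1 + r).choose r)) ℝ :=
  ((M.Rddag n).card : ℝ)⁻¹ • ∑ l ∈ M.Rddag n,
    Matrix.vecMulVec (fun a => partialDeriv A (e.toEquiv a) (M.η n l ω) (M.α n i ω))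
      (fun a => partialDeriv A (e.toEquiv a) (M.η n l ω) (M.α n i ω))

end FactorArray

end

/-!
With a density comparable to Lebesgue measure on the compact convex set `A`, a ball of radius `D h`
centred in `A` has probability of order `(D h) ^ r`, and `h ^ r = K / n` because the two exponents
agree. A net of `A` with `O(n)` points and a binomial tail bound then put more than `K` latent
variables into every such ball. Since `ρ` is comparable to the `ς`-th power of the latent distance
up to an error `o(h ^ ς)`, all nearest neighbours of `α_i` lie within `C h` of `α_i`.

The smallest eigenvalue of the rescaled Gram matrix is bounded below by anti-concentration. A
nonzero polynomial has a null zero set, so by compactness of the unit sphere the sets where a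
normalized polynomial of degree at most `m - 1` is at most `ε` have uniformly small measure, and
with high probability fewer than half of the `K` neighbours fall into any of them.

By Taylor's formula `H_{⟨i⟩}` is `Λ_{⟨i⟩}'` multiplied by the derivatives of `η` at `α_i`, up to
`O(h ^ m)`. All variables involved are determined by the latent variables and the matching data, so
the conditional expectations are trivial and `F_{⟨i⟩}` is the least squares coefficient of
`H_{⟨i⟩}` on `Λ_{⟨i⟩}`. Least squares moves the residual and the fit by the order of the Taylor
remainder only, so `F_{⟨i⟩}` inherits the conditioning of the matrix of derivatives.
-/

/-! ### Events of probability close to one -/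

section StochasticOrders

variable {Ω : ℕ → Type*} [∀ n, MeasurableSpace (Ω n)] {μ : ∀ n, Measure (Ω n)}
  {S T : ∀ n, Set (Ω n)} {a b : ∀ n, Ω n → ℝ} {P Q : ℝ → ∀ n, Ω n → Prop}

/-- The events `P E n` depend on a constant `E`, and with a suitable choice of it their
probability is, for large `n`, as close to one as desired. This is the common form of the bounds
`a_n ≲_P b_n` (with `P E n` the event `|a_n| < E b_n`) and of conjunctions of such bounds; `E` is
chosen once for each tolerance, so that `P E n` need not be monotone in `E`. -/
def TightEvents (μ : ∀ n, Measure (Ω n)) (P : ℝ → ∀ n, Ω n → Prop) : Prop :=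
  ∀ δ : ℝ≥0∞, 0 < δ → ∃ E > (0 : ℝ), ∀ᶠ n in atTop, μ n {ω | ¬ P E n ω} ≤ δ

lemma WPA1.eventually_le (h : WPA1 μ S) {δ : ℝ≥0∞} (hδ : 0 < δ) :
    ∀ᶠ n in atTop, μ n (S n)ᶜ ≤ δ :=
  (h.eventually (gt_mem_nhds hδ)).mono fun _ hn => hn.le

lemma WPA1.mono (h : WPA1 μ S) (hST : ∀ᶠ n in atTop, ∀ᵐ ω ∂μ n, ω ∈ S n → ω ∈ T n) :
    WPA1 μ T := by
  refine tendsto_of_tendsto_of_tendsto_of_le_of_le' tendsto_const_nhds h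
    (.of_forall fun _ => zero_le) ?_
  filter_upwards [hST] with n hn
  exact measure_mono_ae (hn.mono fun ω hω => mt hω)

lemma WPA1.of_eventually_ae (h : ∀ᶠ n in atTop, ∀ᵐ ω ∂μ n, ω ∈ S n) : WPA1 μ S :=
  tendsto_nhds_of_eventually_eq (h.mono fun _ hn => mem_ae_iff.1 hn)

lemma WPA1.inter (hS : WPA1 μ S) (hT : WPA1 μ T) : WPA1 μ fun n => S n ∩ T n := by
  have hsum : Tendsto (fun n => μ n (S n)ᶜ + μ n (T n)ᶜ) atTop (𝓝 0) := by
    simpa only [add_zero] using hS.add hT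
  refine tendsto_of_tendsto_of_tendsto_of_le_of_le tendsto_const_nhds hsum (fun _ => zero_le)
    fun n => ?_
  simpa only [Set.compl_inter] using measure_union_le (μ := μ n) (S n)ᶜ (T n)ᶜ

lemma WPA1.eventually_nonempty [∀ n, IsProbabilityMeasure (μ n)] (h : WPA1 μ S) :
    ∀ᶠ n in atTop, (S n).Nonempty := by
  filter_upwards [h.eventually (gt_mem_nhds one_pos)] with n hn
  by_contra! hempty
  rw [hempty, Set.compl_empty, measure_univ] at hn
  exact hn.false

lemma WPA1.of_compl_subset_biUnion [∀ n, IsProbabilityMeasure (μ n)] {ι : Type*} {c : ℝ}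
    {b : ℕ → ℝ} (hb : ∀ n, 0 ≤ b n) (hlim : Tendsto (fun n : ℕ => n * b n) atTop (𝓝 0))
    (h : ∀ᶠ n in atTop, ∃ (J : Finset ι) (B : ι → Set (Ω n)), (J.card : ℝ) ≤ c * n ∧
      (∀ j ∈ J, (μ n).real (B j) ≤ b n) ∧ (S n)ᶜ ⊆ ⋃ j ∈ J, B j) : WPA1 μ S := by
  have hbound : Tendsto (fun n : ℕ => ENNReal.ofReal (c * (n * b n))) atTop (𝓝 0) := by
    simpa only [mul_zero, ENNReal.ofReal_zero] using ENNReal.tendsto_ofReal (hlim.const_mul c)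
  refine tendsto_of_tendsto_of_tendsto_of_le_of_le' tendsto_const_nhds hbound
    (.of_forall fun _ => zero_le) ?_
  filter_upwards [h] with n ⟨J, B, hJ, hB, hsub⟩
  rw [← ofReal_measureReal]
  refine ENNReal.ofReal_le_ofReal ?_
  calc (μ n).real (S n)ᶜ ≤ (μ n).real (⋃ j ∈ J, B j) := measureReal_mono hsub (measure_ne_top _ _)
    _ ≤ ∑ j ∈ J, (μ n).real (B j) := measureReal_biUnion_finset_le J B
    _ ≤ J.card * b n := by simpa only [nsmul_eq_mul] using Finset.sum_le_card_nsmul J _ _ hB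
    _ ≤ c * n * b n := mul_le_mul_of_nonneg_right hJ (hb n)
    _ = c * (n * b n) := mul_assoc _ _ _

namespace TightEvents

lemma wpa1 (hP : TightEvents μ P) (hPS : ∀ E > 0, ∀ n ω, P E n ω → ω ∈ S n) : WPA1 μ S := by
  refine ENNReal.tendsto_nhds_zero.2 fun δ hδ => ?_
  obtain ⟨E, hE, hPE⟩ := hP δ hδ
  filter_upwards [hPE] with n hn
  exact (measure_mono fun ω (hω : ω ∉ S n) hPω => hω (hPS E hE n ω hPω)).trans hn

lemma of_wpa1_imp (hP : TightEvents μ P)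
    (hPQ : ∀ E > 0, ∃ E' > 0, WPA1 μ fun n => {ω | P E n ω → Q E' n ω}) : TightEvents μ Q := by
  intro δ hδ
  obtain ⟨E, hE, hPE⟩ := hP (δ / 2) (ENNReal.half_pos hδ.ne')
  obtain ⟨E', hE', hQ⟩ := hPQ E hE
  refine ⟨E', hE', ?_⟩
  filter_upwards [hPE, hQ.eventually_le (ENNReal.half_pos hδ.ne')] with n hn hn'
  calc μ n {ω | ¬ Q E' n ω}
      ≤ μ n ({ω | ¬ P E n ω} ∪ {ω | P E n ω → Q E' n ω}ᶜ) := by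
        refine measure_mono fun ω (hω : ¬ Q E' n ω) => ?_
        by_cases hPω : P E n ω
        · exact .inr fun h => hω (h hPω)
        · exact .inl hPω
    _ ≤ δ / 2 + δ / 2 := (measure_union_le _ _).trans (add_le_add hn hn')
    _ = δ := ENNReal.add_halves δ

lemma mono (hP : TightEvents μ P) (hPQ : ∀ E > 0, ∀ n ω, P E n ω → Q E n ω) :
    TightEvents μ Q := fun δ hδ => by
  obtain ⟨E, hE, hPE⟩ := hP δ hδ
  exact ⟨E, hE, hPE.mono fun n hn =>
    (measure_mono fun ω (hω : ¬ Q E n ω) hPω => hω (hPQ E hE n ω hPω)).trans hn⟩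

lemma and (hP : TightEvents μ P) (hQ : TightEvents μ Q)
    (hPmono : ∀ n ω, MonotoneOn (fun E => P E n ω) (Set.Ioi 0))
    (hQmono : ∀ n ω, MonotoneOn (fun E => Q E n ω) (Set.Ioi 0)) :
    TightEvents μ fun E n ω => P E n ω ∧ Q E n ω := by
  intro δ hδ
  obtain ⟨E₁, hE₁, hPE⟩ := hP (δ / 2) (ENNReal.half_pos hδ.ne')
  obtain ⟨E₂, hE₂, hQE⟩ := hQ (δ / 2) (ENNReal.half_pos hδ.ne')
  have hE : 0 < max E₁ E₂ := lt_max_of_lt_left hE₁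
  refine ⟨max E₁ E₂, hE, ?_⟩
  filter_upwards [hPE, hQE] with n hn hn'
  calc μ n {ω | ¬ (P (max E₁ E₂) n ω ∧ Q (max E₁ E₂) n ω)}
      ≤ μ n ({ω | ¬ P E₁ n ω} ∪ {ω | ¬ Q E₂ n ω}) := by
        refine measure_mono fun ω hω => ?_
        refine (not_and_or.1 hω).imp (mt ?_) (mt ?_)
        · exact hPmono n ω hE₁ hE (le_max_left _ _)
        · exact hQmono n ω hE₂ hE (le_max_right _ _)
    _ ≤ δ / 2 + δ / 2 := (measure_union_le _ _).trans (add_le_add hn hn')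
    _ = δ := ENNReal.add_halves δ

end TightEvents

lemma StochLE.tightEvents (h : StochLE μ a b) :
    TightEvents μ fun E n ω => |a n ω| < E * b n ω := by
  intro δ hδ
  obtain ⟨E, hlim, hE⟩ := ((h.eventually (gt_mem_nhds hδ)).and (eventually_gt_atTop 0)).exists
  exact ⟨E, hE, (eventually_lt_of_limsup_lt hlim).mono fun n hn => by
    simpa only [not_lt] using hn.le⟩

lemma TightEvents.stochLE (hb : ∀ᶠ n in atTop, ∀ ω, 0 ≤ b n ω)
    (h : TightEvents μ fun E n ω => |a n ω| < E * b n ω) : StochLE μ a b := by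
  refine ENNReal.tendsto_nhds_zero.2 fun δ hδ => ?_
  obtain ⟨E, -, hE⟩ := h δ hδ
  filter_upwards [eventually_ge_atTop E] with ε hε
  refine limsup_le_of_le (by isBoundedDefault) ?_
  filter_upwards [hE, hb] with n hn hbn
  refine (measure_mono fun ω (hω : ε * b n ω ≤ |a n ω|) => ?_).trans hn
  exact not_lt.2 ((mul_le_mul_of_nonneg_right hε (hbn ω)).trans hω)

variable {ι : ℕ → Type*} {f : ∀ n, Ω n → ι n → ℝ}

lemma TightEvents.stochLE_iSup {s : ℕ → ℝ} (hs : ∀ᶠ n in atTop, 0 < s n)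
    (hf : ∀ n ω i, 0 ≤ f n ω i) (h : TightEvents μ fun E n ω => ∀ i, f n ω i ≤ E * s n) :
    StochLE μ (fun n ω => ⨆ i, f n ω i) (fun n _ => s n) := by
  refine TightEvents.stochLE (hs.mono fun n hn _ => hn.le) (h.of_wpa1_imp fun E hE => ?_)
  refine ⟨2 * E, by positivity, .of_eventually_ae <| hs.mono fun n hn => .of_forall
    fun ω (hω : ∀ i, f n ω i ≤ E * s n) => ?_⟩
  have hsup : ⨆ i, f n ω i ≤ E * s n := Real.iSup_le hω (by positivity)
  rw [abs_of_nonneg (Real.iSup_nonneg (hf n ω))]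
  linarith [mul_pos hE hn]

lemma TightEvents.one_stochLE_iInf (hι : ∀ᶠ n in atTop, Nonempty (ι n))
    (hf : ∀ n ω i, 0 ≤ f n ω i) (h : TightEvents μ fun E n ω => ∀ i, E⁻¹ ≤ f n ω i) :
    StochLE μ (fun _ _ => 1) (fun n ω => ⨅ i, f n ω i) := by
  refine TightEvents.stochLE (.of_forall fun n ω => Real.iInf_nonneg (hf n ω))
    (h.of_wpa1_imp fun E hE => ?_)
  refine ⟨2 * E, by positivity, .of_eventually_ae <| hι.mono fun n hn => .of_forall
    fun ω (hω : ∀ i, E⁻¹ ≤ f n ω i) => ?_⟩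
  have hinf : E⁻¹ ≤ ⨅ i, f n ω i := le_ciInf hω
  calc |(1 : ℝ)| < 2 * E * E⁻¹ := by rw [mul_assoc, mul_inv_cancel₀ hE.ne']; norm_num
    _ ≤ 2 * E * ⨅ i, f n ω i := by gcongr

end StochasticOrders

/-! ### Extreme singular values of Gram matrices -/

section SingularValues

open Module (finrank)
open scoped InnerProductSpace

variable {𝕜 E F : Type*} [RCLike 𝕜] [NormedAddCommGroup E] [InnerProductSpace 𝕜 E]
  [FiniteDimensional 𝕜 E] [NormedAddCommGroup F] [InnerProductSpace 𝕜 F] [FiniteDimensional 𝕜 F]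

lemma exists_norm_eq_one_norm_apply_eq_singularValues (T : E →ₗ[𝕜] F) {k : ℕ}
    (hk : k < finrank 𝕜 E) : ∃ x, ‖x‖ = 1 ∧ ‖T x‖ = T.singularValues k := by
  have hsymm := T.isSymmetric_adjoint_comp_self
  set x := hsymm.eigenvectorBasis rfl ⟨k, hk⟩
  have hx : ‖x‖ = 1 := (hsymm.eigenvectorBasis rfl).orthonormal.1 _
  refine ⟨x, hx, ?_⟩
  have hTT : LinearMap.adjoint T (T x) = ((T.singularValues k ^ 2 : ℝ) : 𝕜) • x := by
    rw [T.sq_singularValues_of_lt rfl hk]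
    exact hsymm.apply_eigenvectorBasis rfl ⟨k, hk⟩
  rw [← sq_eq_sq₀ (norm_nonneg _) (T.singularValues_nonneg k), ← inner_self_eq_norm_sq (𝕜 := 𝕜),
    ← LinearMap.adjoint_inner_left, hTT, inner_smul_left, RCLike.conj_ofReal,
    RCLike.re_ofReal_mul, inner_self_eq_norm_sq, hx, one_pow, mul_one]

lemma re_inner_apply_self_eq_sum_eigenvalues {S : E →ₗ[𝕜] E} (hS : S.IsSymmetric) (x : E) :
    RCLike.re ⟪S x, x⟫_𝕜 =
      ∑ j, hS.eigenvalues rfl j * ‖⟪hS.eigenvectorBasis rfl j, x⟫_𝕜‖ ^ 2 := by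
  set b := hS.eigenvectorBasis rfl
  rw [← b.sum_inner_mul_inner, map_sum]
  refine Finset.sum_congr rfl fun j _ => ?_
  rw [hS, hS.apply_eigenvectorBasis, inner_smul_right, mul_assoc, RCLike.re_ofReal_mul,
    inner_mul_symm_re_eq_norm, norm_mul, norm_inner_symm x, ← sq]

lemma singularValues_mul_norm_le_norm_apply (T : E →ₗ[𝕜] F) {k : ℕ} (hk : finrank 𝕜 E ≤ k + 1)
    (x : E) : T.singularValues k * ‖x‖ ≤ ‖T x‖ := by
  have hsymm := T.isSymmetric_adjoint_comp_self
  refine le_of_sq_le_sq ?_ (norm_nonneg _)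
  calc (T.singularValues k * ‖x‖) ^ 2
      = ∑ j, T.singularValues k ^ 2 * ‖⟪hsymm.eigenvectorBasis rfl j, x⟫_𝕜‖ ^ 2 := by
        rw [mul_pow, ← Finset.mul_sum, (hsymm.eigenvectorBasis rfl).sum_sq_norm_inner_right]
    _ ≤ ∑ j, hsymm.eigenvalues rfl j * ‖⟪hsymm.eigenvectorBasis rfl j, x⟫_𝕜‖ ^ 2 := by
        refine Finset.sum_le_sum fun j _ => ?_
        rw [← T.sq_singularValues_fin rfl]
        have hkj : T.singularValues k ≤ T.singularValues j := T.singularValues_antitone (by omega)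
        have hk0 := T.singularValues_nonneg k
        gcongr
    _ = ‖T x‖ ^ 2 := by
        rw [← re_inner_apply_self_eq_sum_eigenvalues, LinearMap.comp_apply,
          LinearMap.adjoint_inner_left, inner_self_eq_norm_sq]

lemma singularValues_mul_sq_norm_le_re_inner {S : E →ₗ[𝕜] E} (hS : S.IsPositive) {k : ℕ}
    (hk : finrank 𝕜 E ≤ k + 1) (x : E) :
    S.singularValues k * ‖x‖ ^ 2 ≤ RCLike.re ⟪S x, x⟫_𝕜 := by
  have hsymm := hS.isSymmetric
  rw [re_inner_apply_self_eq_sum_eigenvalues hsymm,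
    ← (hsymm.eigenvectorBasis rfl).sum_sq_norm_inner_right x, Finset.mul_sum]
  refine Finset.sum_le_sum fun j _ => mul_le_mul_of_nonneg_right ?_ (sq_nonneg _)
  have hj := singularValues_mul_norm_le_norm_apply S hk (hsymm.eigenvectorBasis rfl j)
  rwa [hsymm.apply_eigenvectorBasis, norm_smul, (hsymm.eigenvectorBasis rfl).norm_eq_one,
    mul_one, mul_one, RCLike.norm_ofReal, abs_of_nonneg (hS.nonneg_eigenvalues rfl j)] at hj

lemma le_singularValues_of_le_re_inner {S : E →ₗ[𝕜] E} {c : ℝ}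
    (hc : ∀ x, c * ‖x‖ ^ 2 ≤ RCLike.re ⟪S x, x⟫_𝕜) {k : ℕ} (hk : k < finrank 𝕜 E) :
    c ≤ S.singularValues k := by
  obtain ⟨x, hx, hSx⟩ := exists_norm_eq_one_norm_apply_eq_singularValues S hk
  calc c = c * ‖x‖ ^ 2 := by rw [hx, one_pow, mul_one]
    _ ≤ RCLike.re ⟪S x, x⟫_𝕜 := hc x
    _ ≤ ‖S x‖ * ‖x‖ := re_inner_le_norm _ _
    _ = S.singularValues k := by rw [hx, mul_one, hSx]

lemma singularValues_le_of_re_inner_le {S : E →ₗ[𝕜] E} (hS : S.IsPositive) {C : ℝ}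
    (hC : ∀ x, RCLike.re ⟪S x, x⟫_𝕜 ≤ C * ‖x‖ ^ 2) {k : ℕ} (hk : k < finrank 𝕜 E) :
    S.singularValues k ≤ C := by
  have hsymm := hS.isSymmetric
  set b := hsymm.eigenvectorBasis rfl
  have heig : ∀ j, hsymm.eigenvalues rfl j ≤ C := fun j => by
    have hj := hC (b j)
    rwa [hsymm.apply_eigenvectorBasis, inner_smul_left, RCLike.conj_ofReal, RCLike.re_ofReal_mul,
      inner_self_eq_norm_sq, b.norm_eq_one, one_pow, mul_one, mul_one] at hj
  obtain ⟨x, hx, hSx⟩ := exists_norm_eq_one_norm_apply_eq_singularValues S hk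
  refine le_of_sq_le_sq ?_ ((hS.nonneg_eigenvalues rfl ⟨k, hk⟩).trans (heig _))
  calc S.singularValues k ^ 2
      = ∑ j, hsymm.eigenvalues rfl j ^ 2 * ‖⟪b j, x⟫_𝕜‖ ^ 2 := by
        rw [← hSx, ← b.sum_sq_norm_inner_right]
        refine Finset.sum_congr rfl fun j _ => ?_
        rw [← hsymm, hsymm.apply_eigenvectorBasis, inner_smul_left, RCLike.conj_ofReal, norm_mul,
          mul_pow, RCLike.norm_ofReal, sq_abs]
    _ ≤ ∑ j, C ^ 2 * ‖⟪b j, x⟫_𝕜‖ ^ 2 := by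
        have hnonneg := hS.nonneg_eigenvalues rfl
        gcongr with j
        · exact hnonneg j
        · exact heig j
    _ = C ^ 2 := by rw [← Finset.mul_sum, b.sum_sq_norm_inner_right, hx, one_pow, mul_one]

end SingularValues

lemma sMin_nonneg {a b : ℕ} (A : Matrix (Fin a) (Fin b) ℝ) : 0 ≤ sMin A :=
  LinearMap.singularValues_nonneg _ _

lemma sMax_nonneg {a b : ℕ} (A : Matrix (Fin a) (Fin b) ℝ) : 0 ≤ sMax A :=
  LinearMap.singularValues_nonneg _ _

section Gram

variable {ι : Type*} [Fintype ι] {d : ℕ} {B : Matrix ι (Fin d) ℝ} {s c C : ℝ}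

lemma sum_mulVec_mul_mulVec (B : Matrix ι (Fin d) ℝ) (v w : Fin d → ℝ) :
    ∑ l, (B *ᵥ v) l * (B *ᵥ w) l = v ⬝ᵥ ((Bᵀ * B) *ᵥ w) := by
  rw [← Matrix.mulVec_mulVec, Matrix.dotProduct_mulVec, Matrix.vecMul_transpose]
  rfl

lemma inner_toEuclideanLin_smul_gram (s : ℝ) (B : Matrix ι (Fin d) ℝ)
    (x y : EuclideanSpace ℝ (Fin d)) :
    inner ℝ (Matrix.toEuclideanLin (s • (Bᵀ * B)) x) y =
      s * ∑ l, (B *ᵥ x.ofLp) l * (B *ᵥ y.ofLp) l := by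
  rw [EuclideanSpace.inner_eq_star_dotProduct, Matrix.toLpLin_apply, star_trivial,
    Matrix.smul_mulVec, dotProduct_smul, ← sum_mulVec_mul_mulVec, smul_eq_mul]
  simp only [mul_comm]

lemma isPositive_toEuclideanLin_smul_gram (hs : 0 ≤ s) (B : Matrix ι (Fin d) ℝ) :
    (Matrix.toEuclideanLin (s • (Bᵀ * B))).IsPositive := by
  refine ⟨fun x y => ?_, fun x => ?_⟩
  · rw [← real_inner_comm x, inner_toEuclideanLin_smul_gram, inner_toEuclideanLin_smul_gram]
    simp only [mul_comm]
  · rw [inner_toEuclideanLin_smul_gram, RCLike.re_to_real]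
    exact mul_nonneg hs (Finset.sum_nonneg fun l _ => mul_self_nonneg _)

lemma le_sMin_smul_gram (hd : 0 < d)
    (h : ∀ v : Fin d → ℝ, c * ∑ a, v a ^ 2 ≤ s * ∑ l, (B *ᵥ v) l ^ 2) :
    c ≤ sMin (s • (Bᵀ * B)) := by
  refine le_singularValues_of_le_re_inner (fun x => ?_) ?_
  · rw [inner_toEuclideanLin_smul_gram, EuclideanSpace.real_norm_sq_eq, RCLike.re_to_real]
    simpa only [← sq] using h x.ofLp
  · rw [finrank_euclideanSpace_fin]
    omega

lemma sMin_smul_gram_mul_le (hs : 0 ≤ s) (v : Fin d → ℝ) :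
    sMin (s • (Bᵀ * B)) * ∑ a, v a ^ 2 ≤ s * ∑ l, (B *ᵥ v) l ^ 2 := by
  have h := singularValues_mul_sq_norm_le_re_inner (isPositive_toEuclideanLin_smul_gram hs B)
    (k := min d d - 1) (by rw [finrank_euclideanSpace_fin]; omega) (WithLp.toLp 2 v)
  rw [inner_toEuclideanLin_smul_gram, EuclideanSpace.real_norm_sq_eq, RCLike.re_to_real] at h
  simpa only [← sq, sMin] using h

lemma sMax_smul_gram_le (hd : 0 < d) (hs : 0 ≤ s)
    (h : ∀ v : Fin d → ℝ, s * ∑ l, (B *ᵥ v) l ^ 2 ≤ C * ∑ a, v a ^ 2) :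
    sMax (s • (Bᵀ * B)) ≤ C := by
  refine singularValues_le_of_re_inner_le (isPositive_toEuclideanLin_smul_gram hs B) (fun x => ?_)
    (by rwa [finrank_euclideanSpace_fin])
  rw [inner_toEuclideanLin_smul_gram, EuclideanSpace.real_norm_sq_eq, RCLike.re_to_real]
  simpa only [← sq] using h x.ofLp

end Gram

/-! ### Sublevel sets of polynomials -/

section SublevelSets

variable {V Y : Type*} [TopologicalSpace V] [MetricSpace Y] [MeasurableSpace Y]
  [OpensMeasurableSpace Y] {ν : Measure Y} [IsFiniteMeasureOnCompacts ν] {Q : Set Y} {η : ℝ≥0∞}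

lemma exists_measure_abs_le_lt {f : Y → ℝ} (hf : Continuous f) (hQ : IsCompact Q)
    (hf0 : ν {y | f y = 0} = 0) (hη : 0 < η) : ∃ ε > (0 : ℝ), ν (Q ∩ {y | |f y| ≤ ε}) < η := by
  set S : ℕ → Set Y := fun k => Q ∩ {y | |f y| ≤ 1 / ((k : ℝ) + 1)}
  have hSmeas (k : ℕ) : NullMeasurableSet (S k) ν :=
    (hQ.isClosed.inter (isClosed_le hf.abs continuous_const)).nullMeasurableSet
  have hSanti : Antitone S := fun j k hjk => Set.inter_subset_inter_right Q fun y hy =>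
    le_trans (α := ℝ) hy (Nat.one_div_le_one_div hjk)
  have hSfin : ν (S 0) ≠ ⊤ :=
    ne_top_of_le_ne_top hQ.measure_lt_top.ne (measure_mono Set.inter_subset_left)
  have hlim := tendsto_measure_iInter_atTop hSmeas hSanti ⟨0, hSfin⟩
  have hInter : ν (⋂ k, S k) = 0 := by
    refine measure_mono_null (fun y hy => abs_eq_zero.1 (le_antisymm ?_ (abs_nonneg _))) hf0
    exact ge_of_tendsto' tendsto_one_div_add_atTop_nhds_zero_nat fun k => (Set.mem_iInter.1 hy k).2
  obtain ⟨k, hk⟩ := (hlim.eventually_lt_const (hInter ▸ hη)).exists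
  exact ⟨1 / ((k : ℝ) + 1), by positivity, hk⟩

variable [ProperSpace Y] {F : V → Y → ℝ} {T : Set V}

lemma exists_forall_nhds_closedBall_subset (hF : Continuous (Function.uncurry F))
    (hQ : IsCompact Q) {v : V} (hv : ν {y | F v y = 0} = 0) (hη : 0 < η) :
    ∃ ε > (0 : ℝ), ∃ τ > (0 : ℝ), ∃ B : Set Y, MeasurableSet B ∧ ν B ≤ η ∧
      ∀ᶠ w in 𝓝 v, ∀ y ∈ Q, |F w y| ≤ ε → Metric.closedBall y τ ⊆ B := by
  have hFv : Continuous (F v) := hF.comp (Continuous.prodMk_right v)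
  obtain ⟨ε, hε, hlt⟩ := exists_measure_abs_le_lt hFv hQ hv hη
  have hcomp : IsCompact (Q ∩ {y | |F v y| ≤ ε}) :=
    hQ.inter_right (isClosed_le hFv.abs continuous_const)
  have hthick := (tendsto_measure_cthickening_of_isCompact (μ := ν) hcomp).mono_left
    (nhdsWithin_le_nhds (s := Set.Ioi (0 : ℝ)))
  obtain ⟨τ, hτ, hτpos⟩ := ((hthick.eventually_lt_const hlt).and self_mem_nhdsWithin).exists
  have hnear : ∀ᶠ w in 𝓝 v, ∀ y ∈ Q, |F w y - F v y| < ε / 2 := by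
    refine hQ.eventually_forall_of_forall_eventually fun y _ => ?_
    have hdiff : Continuous fun z : V × Y => |F z.1 z.2 - F v z.2| :=
      (hF.sub (hFv.comp continuous_snd)).abs
    refine hdiff.continuousAt.eventually_lt_const ?_
    simpa only [sub_self, abs_zero] using half_pos hε
  refine ⟨ε / 2, half_pos hε, τ, hτpos, _, Metric.isClosed_cthickening.measurableSet, hτ.le, ?_⟩
  filter_upwards [hnear] with w hw y hy hwy
  have hvy : |F v y| ≤ ε := by
    have := abs_sub_abs_le_abs_sub (F v y) (F w y)
    rw [abs_sub_comm] at this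
    linarith [hw y hy]
  have hmem : y ∈ Q ∩ {y | |F v y| ≤ ε} := ⟨hy, hvy⟩
  exact Metric.closedBall_subset_cthickening hmem τ

lemma exists_finset_forall_closedBall_subset (hF : Continuous (Function.uncurry F))
    (hT : IsCompact T) (hT0 : ∀ v ∈ T, ν {y | F v y = 0} = 0) (hQ : IsCompact Q) (hη : 0 < η) :
    ∃ ε > (0 : ℝ), ∃ τ > (0 : ℝ), ∃ Z : Finset (Set Y), (∀ B ∈ Z, MeasurableSet B ∧ ν B ≤ η) ∧
      ∀ v ∈ T, ∃ B ∈ Z, ∀ y ∈ Q, |F v y| ≤ ε → Metric.closedBall y τ ⊆ B := by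
  classical
  refine hT.induction_on (p := fun S => ∃ ε > (0 : ℝ), ∃ τ > (0 : ℝ), ∃ Z : Finset (Set Y),
    (∀ B ∈ Z, MeasurableSet B ∧ ν B ≤ η) ∧
      ∀ v ∈ S, ∃ B ∈ Z, ∀ y ∈ Q, |F v y| ≤ ε → Metric.closedBall y τ ⊆ B) ?_ ?_ ?_ fun v hv => ?_
  · exact ⟨1, one_pos, 1, one_pos, ∅, by simp, by simp⟩
  · rintro S S' hSS' ⟨ε, hε, τ, hτ, Z, hZ, hcover⟩
    exact ⟨ε, hε, τ, hτ, Z, hZ, fun v hv => hcover v (hSS' hv)⟩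
  · rintro S S' ⟨ε, hε, τ, hτ, Z, hZ, hcover⟩ ⟨ε', hε', τ', hτ', Z', hZ', hcover'⟩
    refine ⟨min ε ε', lt_min hε hε', min τ τ', lt_min hτ hτ', Z ∪ Z',
      fun B hB => (Finset.mem_union.1 hB).elim (hZ B) (hZ' B), ?_⟩
    rintro v (hv | hv)
    · obtain ⟨B, hB, h⟩ := hcover v hv
      exact ⟨B, Finset.mem_union_left _ hB, fun y hy hvy =>
        (Metric.closedBall_subset_closedBall (min_le_left _ _)).trans
          (h y hy (hvy.trans (min_le_left _ _)))⟩
    · obtain ⟨B, hB, h⟩ := hcover' v hv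
      exact ⟨B, Finset.mem_union_right _ hB, fun y hy hvy =>
        (Metric.closedBall_subset_closedBall (min_le_right _ _)).trans
          (h y hy (hvy.trans (min_le_right _ _)))⟩
  · obtain ⟨ε, hε, τ, hτ, B, hBmeas, hBη, hB⟩ :=
      exists_forall_nhds_closedBall_subset hF hQ (hT0 v hv) hη
    exact ⟨_, mem_nhdsWithin_of_mem_nhds hB, ε, hε, τ, hτ, {B},
      by simpa only [Finset.mem_singleton, forall_eq] using ⟨hBmeas, hBη⟩,
      fun w hw => ⟨B, Finset.mem_singleton_self B, hw⟩⟩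

end SublevelSets

lemma ae_eval_mvPolynomial_ne_zero {n : ℕ} {p : MvPolynomial (Fin n) ℝ} (hp : p ≠ 0) :
    ∀ᵐ x : Fin n → ℝ, MvPolynomial.eval x p ≠ 0 := by
  induction n with
  | zero =>
    obtain ⟨c, rfl⟩ := MvPolynomial.C_surjective (Fin 0) p
    have hc : c ≠ 0 := fun hc => hp (by rw [hc, map_zero])
    exact .of_forall fun x => by rwa [MvPolynomial.eval_C]
  | succ n ih =>
    set q := MvPolynomial.finSuccEquiv ℝ n p
    have hq : q ≠ 0 := by simpa only [q, ne_eq, EmbeddingLike.map_eq_zero_iff] using hp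
    have hmeas : MeasurableSet {x : Fin (n + 1) → ℝ | MvPolynomial.eval x p ≠ 0} :=
      (MvPolynomial.continuous_eval p).measurable (measurableSet_singleton 0).compl
    have hcons : MeasurePreserving
        fun z : (Fin n → ℝ) × ℝ => (Fin.cons z.2 z.1 : Fin (n + 1) → ℝ) := by
      have hswap : MeasurePreserving (Prod.swap : (Fin n → ℝ) × ℝ → ℝ × (Fin n → ℝ)) :=
        Measure.measurePreserving_swap
      convert (volume_preserving_piFinSuccAbove (fun _ : Fin (n + 1) => ℝ) 0).symm.comp hswap
        using 2 with z
      exact (Fin.insertNth_zero' z.2 z.1).symm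
    rw [← hcons.map_eq, ae_map_iff hcons.measurable.aemeasurable hmeas]
    refine (Measure.ae_prod_iff_ae_ae (hcons.measurable hmeas)).2 ?_
    filter_upwards [ih (Polynomial.leadingCoeff_ne_zero.2 hq)] with s hs
    have hqs : q.map (MvPolynomial.eval s) ≠ 0 := fun h0 => hs <| by
      simpa only [Polynomial.coeff_map, Polynomial.coeff_natDegree, Polynomial.coeff_zero]
        using congrArg (fun f => f.coeff q.natDegree) h0
    refine measure_mono_null (fun y hy => ?_)
      ((q.map (MvPolynomial.eval s)).roots.toFinset.finite_toSet.measure_zero volume)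
    have hroot : MvPolynomial.eval (Fin.cons y s : Fin (n + 1) → ℝ) p = 0 := not_not.1 hy
    rw [MvPolynomial.eval_eq_eval_mv_eval'] at hroot
    exact Multiset.mem_toFinset.2 ((Polynomial.mem_roots hqs).2 hroot)

section Monomials

variable {r N : ℕ} (e : GradedEnum r N)

/-- The vector of the monomials of degree at most `N` at the point `y`, in the order of the graded
enumeration `e`; the polynomial with coefficient vector `v` takes the value
`monomialVec e y ⬝ᵥ v` at `y`. -/
def monomialVec (y : EuclideanSpace ℝ (Fin r)) : Fin ((N + r).choose r) → ℝ :=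
  fun a => ∏ t, y t ^ (e.toEquiv a : Fin r → ℕ) t

lemma continuous_monomialVec_dotProduct :
    Continuous (Function.uncurry fun (v : Fin ((N + r).choose r) → ℝ)
      (y : EuclideanSpace ℝ (Fin r)) => monomialVec e y ⬝ᵥ v) := by
  unfold monomialVec dotProduct Function.uncurry
  fun_prop

lemma volume_monomialVec_dotProduct_eq_zero {v : Fin ((N + r).choose r) → ℝ} (hv : v ≠ 0) :
    volume {y : EuclideanSpace ℝ (Fin r) | monomialVec e y ⬝ᵥ v = 0} = 0 := by
  let exponent (a : Fin ((N + r).choose r)) : Fin r →₀ ℕ :=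
    Finsupp.equivFunOnFinite.symm (e.toEquiv a : Fin r → ℕ)
  have hexp : Function.Injective exponent :=
    Finsupp.equivFunOnFinite.symm.injective.comp
      (Subtype.val_injective.comp e.toEquiv.injective)
  let p : MvPolynomial (Fin r) ℝ := ∑ a, MvPolynomial.monomial (exponent a) (v a)
  have hp : p ≠ 0 := by
    obtain ⟨a, ha⟩ := Function.ne_iff.1 hv
    refine fun h0 => ha ?_
    simpa [p, MvPolynomial.coeff_sum, MvPolynomial.coeff_monomial, hexp.eq_iff]
      using congrArg (MvPolynomial.coeff (exponent a)) h0
  have heval (y : EuclideanSpace ℝ (Fin r)) :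
      MvPolynomial.eval y.ofLp p = monomialVec e y ⬝ᵥ v := by
    simp [p, exponent, monomialVec, dotProduct, MvPolynomial.eval_monomial, Finsupp.prod_fintype,
      mul_comm]
  have hae := (PiLp.volume_preserving_ofLp (Fin r)).quasiMeasurePreserving.ae
    (ae_eval_mvPolynomial_ne_zero hp)
  simpa only [heval, ae_iff, not_not] using hae

lemma isCompact_sum_sq_eq_one {d : Type*} [Fintype d] :
    IsCompact {v : d → ℝ | ∑ a, v a ^ 2 = 1} := by
  refine Metric.isCompact_of_isClosed_isBounded (isClosed_eq (by fun_prop) continuous_const) ?_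
  refine (Metric.isBounded_closedBall (x := 0) (r := 1)).subset
    fun v (hv : ∑ a, v a ^ 2 = 1) => ?_
  rw [mem_closedBall_zero_iff, pi_norm_le_iff_of_nonneg zero_le_one]
  intro a
  rw [Real.norm_eq_abs, ← sq_le_one_iff_abs_le_one, ← hv]
  exact Finset.single_le_sum (f := fun a => v a ^ 2) (fun _ _ => sq_nonneg _) (Finset.mem_univ a)

lemma exists_finset_cover_monomialVec_sublevel (C : ℝ) {η : ℝ≥0∞} (hη : 0 < η) :
    ∃ ε > (0 : ℝ), ∃ τ > (0 : ℝ), ∃ Z : Finset (Set (EuclideanSpace ℝ (Fin r))),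
      (∀ B ∈ Z, MeasurableSet B ∧ volume B ≤ η) ∧
      ∀ v : Fin ((N + r).choose r) → ℝ, ∑ a, v a ^ 2 = 1 → ∃ B ∈ Z, ∀ y, ‖y‖ ≤ C →
        |monomialVec e y ⬝ᵥ v| ≤ ε → Metric.closedBall y τ ⊆ B := by
  have hnull (v : Fin ((N + r).choose r) → ℝ) (hv : ∑ a, v a ^ 2 = 1) :
      volume {y : EuclideanSpace ℝ (Fin r) | monomialVec e y ⬝ᵥ v = 0} = 0 :=
    volume_monomialVec_dotProduct_eq_zero e fun h0 => by simp [h0] at hv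
  have hcover := exists_finset_forall_closedBall_subset (continuous_monomialVec_dotProduct e)
    isCompact_sum_sq_eq_one hnull (isCompact_closedBall (0 : EuclideanSpace ℝ (Fin r)) C) hη
  simpa only [mem_closedBall_zero_iff, Set.mem_ofPred_eq] using hcover

end Monomials

/-! ### Local counts of an independent sample -/

section Nets

variable {X : Type*} [PseudoMetricSpace X] [MeasurableSpace X] [OpensMeasurableSpace X]
  {ν : Measure X} [IsProbabilityMeasure ν] {A : Set X} {κ ε : ℝ}

lemma packingNumber_le_of_le_measureReal_closedBall (hκ : 0 < κ) (hε : 0 ≤ ε)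
    (hν : ∀ x ∈ A, κ ≤ ν.real (Metric.closedBall x (ε / 2))) :
    Metric.packingNumber ε.toNNReal A ≤ ⌊1 / κ⌋₊ := by
  refine iSup₂_le fun C hCA => iSup_le fun hC => ?_
  by_contra! hcard
  obtain ⟨T, hTC, hTcard⟩ := Set.exists_subset_encard_eq (Order.add_one_le_of_lt hcard)
  have hTfin : T.Finite := Set.finite_of_encard_eq_coe (k := ⌊1 / κ⌋₊ + 1) (by simpa using hTcard)
  lift T to Finset X using hTfin
  have hdisj : (T : Set X).PairwiseDisjoint fun x => Metric.closedBall x (ε / 2) := by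
    intro x hx y hy hxy
    have hlt : ENNReal.ofReal ε < edist x y := hC (hTC hx) (hTC hy) hxy
    rw [edist_dist, ENNReal.ofReal_lt_ofReal_iff_of_nonneg hε] at hlt
    exact Metric.closedBall_disjoint_closedBall (by rwa [add_halves])
  have hsum : T.card * κ ≤ 1 := by
    calc T.card * κ = ∑ _x ∈ T, κ := by rw [Finset.sum_const, nsmul_eq_mul]
      _ ≤ ∑ x ∈ T, ν.real (Metric.closedBall x (ε / 2)) :=
        Finset.sum_le_sum fun x hx => hν x (hCA (hTC hx))
      _ = ν.real (⋃ x ∈ T, Metric.closedBall x (ε / 2)) :=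
        (measureReal_biUnion_finset hdisj fun _ _ => Metric.isClosed_closedBall.measurableSet).symm
      _ ≤ 1 := measureReal_le_one
  have hle : T.card ≤ ⌊1 / κ⌋₊ := Nat.le_floor ((le_div_iff₀ hκ).2 hsum)
  rw [Set.encard_coe_eq_coe_finsetCard] at hTcard
  have hT : T.card = ⌊1 / κ⌋₊ + 1 := by exact_mod_cast hTcard
  omega

lemma exists_finset_dist_le (hκ : 0 < κ) (hε : 0 ≤ ε)
    (hν : ∀ x ∈ A, κ ≤ ν.real (Metric.closedBall x (ε / 2))) :
    ∃ T : Finset X, (T : Set X) ⊆ A ∧ (T.card : ℝ) ≤ 1 / κ ∧ ∀ x ∈ A, ∃ y ∈ T, dist x y ≤ ε := by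
  have hpack := packingNumber_le_of_le_measureReal_closedBall hκ hε hν
  have hpack_top : Metric.packingNumber ε.toNNReal A ≠ ⊤ :=
    ne_top_of_le_ne_top (ENat.natCast_ne_top _) hpack
  obtain ⟨T, hT⟩ := (Set.encard_lt_top_iff.1
    (Metric.encard_maximalSeparatedSet hpack_top ▸ hpack_top.lt_top)).exists_finset_coe
  refine ⟨T, hT ▸ Metric.maximalSeparatedSet_subset, ?_, fun x hx => ?_⟩
  · rw [← Metric.encard_maximalSeparatedSet hpack_top, ← hT,
      Set.encard_coe_eq_coe_finsetCard] at hpack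
    exact (Nat.cast_le.2 (by exact_mod_cast hpack)).trans (Nat.floor_le (by positivity))
  · obtain ⟨y, hy, hxy⟩ := Metric.isCover_maximalSeparatedSet hpack_top hx
    refine ⟨y, by rwa [← hT] at hy, ?_⟩
    have hle : edist x y ≤ ENNReal.ofReal ε := hxy
    rwa [edist_dist, ENNReal.ofReal_le_ofReal_iff hε] at hle

end Nets

section ConvexBody

variable {E : Type*} [NormedAddCommGroup E] [NormedSpace ℝ E] [FiniteDimensional ℝ E]
  [MeasurableSpace E] [BorelSpace E] {ν : Measure E} [ν.IsAddHaarMeasure] {A : Set E}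

lemma pow_mul_measure_le_measure_closedBall_inter (hA : Convex ℝ A) {R : ℝ} {x : E} (hx : x ∈ A)
    (hR : ∀ y ∈ A, dist y x ≤ R) {t : ℝ} (ht0 : 0 ≤ t) (ht1 : t ≤ 1) :
    ENNReal.ofReal (t ^ Module.finrank ℝ E) * ν A ≤ ν (Metric.closedBall x (t * R) ∩ A) := by
  have himage := Measure.addHaar_image_homothety ν x t A
  rw [abs_of_nonneg (pow_nonneg ht0 _)] at himage
  rw [← himage]
  refine measure_mono ?_
  rintro _ ⟨y, hy, rfl⟩
  constructor
  · rw [Metric.mem_closedBall, dist_homothety_center, Real.norm_of_nonneg ht0, dist_comm]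
    exact mul_le_mul_of_nonneg_left (hR y hy) ht0
  · rw [AffineMap.homothety_eq_lineMap]
    exact hA.lineMap_mem hx hy ⟨ht0, ht1⟩

lemma exists_pow_le_measureReal_closedBall (hcpt : IsCompact A) (hconv : Convex ℝ A)
    (hA : ν A ≠ 0) {c : ℝ} (hc : 0 < c) {P : Measure E} [IsFiniteMeasure P]
    (hP : ENNReal.ofReal c • ν.restrict A ≤ P) :
    ∃ κ > (0 : ℝ), ∃ s₀ > (0 : ℝ), ∀ x ∈ A, ∀ s, 0 ≤ s → s ≤ s₀ →
      κ * s ^ Module.finrank ℝ E ≤ P.real (Metric.closedBall x s) := by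
  have hpos : 0 < ν.real A := ENNReal.toReal_pos hA hcpt.measure_lt_top.ne
  obtain ⟨R, hR, hdist⟩ : ∃ R > 0, ∀ x ∈ A, ∀ y ∈ A, dist y x ≤ R :=
    ⟨Metric.diam A + 1, by linarith [Metric.diam_nonneg (s := A)], fun x hx y hy => by
      linarith [Metric.dist_le_diam_of_mem hcpt.isBounded hy hx]⟩
  refine ⟨c * ν.real A / R ^ Module.finrank ℝ E, by positivity, R, hR, fun x hx s hs0 hs => ?_⟩
  have hball := pow_mul_measure_le_measure_closedBall_inter (ν := ν) hconv hx (hdist x hx)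
    (t := s / R) (by positivity) ((div_le_one hR).2 hs)
  rw [div_mul_cancel₀ _ hR.ne'] at hball
  have hle : ENNReal.ofReal c * (ENNReal.ofReal ((s / R) ^ Module.finrank ℝ E) * ν A)
      ≤ P (Metric.closedBall x s) := by
    calc _ ≤ ENNReal.ofReal c * ν (Metric.closedBall x s ∩ A) := by gcongr
      _ = (ENNReal.ofReal c • ν.restrict A) (Metric.closedBall x s) := by
        rw [Measure.smul_apply, Measure.restrict_apply Metric.isClosed_closedBall.measurableSet,
          smul_eq_mul]
      _ ≤ P (Metric.closedBall x s) := hP _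
  have hreal := ENNReal.toReal_mono (measure_ne_top _ _) hle
  rw [ENNReal.toReal_mul, ENNReal.toReal_mul, ENNReal.toReal_ofReal hc.le,
    ENNReal.toReal_ofReal (by positivity)] at hreal
  calc c * ν.real A / R ^ Module.finrank ℝ E * s ^ Module.finrank ℝ E
      = c * ((s / R) ^ Module.finrank ℝ E * ν.real A) := by rw [div_pow]; ring
    _ ≤ P.real (Metric.closedBall x s) := hreal

end ConvexBody

section Density

variable {X : Type*} [MeasurableSpace X] {ν : Measure X} {A : Set X} {f : X → ℝ} {c : ℝ}

lemma withDensity_restrict_le_smul (hA : MeasurableSet A) (hf : ∀ x ∈ A, f x ≤ c) :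
    (ν.restrict A).withDensity (fun x => ENNReal.ofReal (f x)) ≤ ENNReal.ofReal c • ν := by
  calc (ν.restrict A).withDensity (fun x => ENNReal.ofReal (f x))
      ≤ (ν.restrict A).withDensity (fun _ => ENNReal.ofReal c) :=
        withDensity_mono ((ae_restrict_iff' hA).2 (.of_forall fun x hx =>
          ENNReal.ofReal_le_ofReal (hf x hx)))
    _ = ENNReal.ofReal c • ν.restrict A := withDensity_const _
    _ ≤ ENNReal.ofReal c • ν := by gcongr; exact Measure.restrict_le_self

lemma smul_restrict_le_withDensity_restrict (hA : MeasurableSet A) (hf : ∀ x ∈ A, c ≤ f x) :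
    ENNReal.ofReal c • ν.restrict A
      ≤ (ν.restrict A).withDensity fun x => ENNReal.ofReal (f x) := by
  rw [← withDensity_const]
  exact withDensity_mono ((ae_restrict_iff' hA).2 (.of_forall fun x hx =>
    ENNReal.ofReal_le_ofReal (hf x hx)))

end Density

section Counts

variable {Ω E ι : Type*} {X : ι → Ω → E} {S T : Set E} {ω : Ω}

/-- The number of sample points `X j ω` that lie in `S`. -/
noncomputable def countIn (X : ι → Ω → E) (S : Set E) (ω : Ω) : ℕ := {j | X j ω ∈ S}.ncard

lemma countIn_mono [Finite ι] (h : S ⊆ T) : countIn X S ω ≤ countIn X T ω :=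
  Set.ncard_le_ncard fun _ hj => h hj

lemma ncard_comp_mem_le_countIn [Finite ι] {κ : Type*} {σ : κ → ι} (hσ : Function.Injective σ) :
    {k | X (σ k) ω ∈ S}.ncard ≤ countIn X S ω :=
  Set.ncard_le_ncard_of_injOn σ (fun _ hk => hk) hσ.injOn

lemma exists_notMem_of_ncard_lt_countIn [Finite ι] {J : Set ι} (h : J.ncard < countIn X S ω) :
    ∃ j ∉ J, X j ω ∈ S := by
  obtain ⟨j, hjS, hjJ⟩ := Set.exists_mem_notMem_of_ncard_lt_ncard h
  exact ⟨j, hjJ, hjS⟩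

lemma countIn_eq_sum_indicator [Fintype ι] :
    (countIn X S ω : ℝ) = ∑ j, (X j ⁻¹' S).indicator (fun _ => (1 : ℝ)) ω := by
  classical
  simp [countIn, Set.ncard_eq_toFinset_card', Set.indicator_apply]

section Concentration

variable [MeasurableSpace Ω] [MeasurableSpace E] {μ : Measure Ω} [IsProbabilityMeasure μ]
  {ν : Measure E}

lemma mgf_indicator_one_le {B : Set Ω} (hB : MeasurableSet B) (t : ℝ) :
    mgf (B.indicator fun _ => 1) μ t ≤ Real.exp (μ.real B * (Real.exp t - 1)) := by
  have hexp (ω : Ω) : Real.exp (t * B.indicator (fun _ => 1) ω)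
      = B.indicator (fun _ => Real.exp t - 1) ω + 1 := by
    by_cases h : ω ∈ B <;> simp [h]
  simp only [mgf, hexp]
  rw [integral_add ((integrable_const _).indicator hB) (integrable_const _),
    integral_indicator_const _ hB, integral_const, probReal_univ, one_smul, smul_eq_mul]
  exact Real.add_one_le_exp _

lemma mgf_countIn_le [Fintype ι] (hX : ∀ j, Measurable (X j)) (hind : iIndepFun X μ)
    (hν : ∀ j, μ.map (X j) = ν) (hS : MeasurableSet S) (t : ℝ) :
    mgf (fun ω => (countIn X S ω : ℝ)) μ t
      ≤ Real.exp (Fintype.card ι * ν.real S * (Real.exp t - 1)) := by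
  have hg : Measurable (S.indicator fun _ => (1 : ℝ)) := measurable_const.indicator hS
  have hsum : (fun ω => (countIn X S ω : ℝ)) = ∑ j, (S.indicator fun _ => (1 : ℝ)) ∘ X j := by
    ext ω
    rw [countIn_eq_sum_indicator, Finset.sum_apply]
    rfl
  rw [hsum, (hind.comp _ fun _ => hg).mgf_sum fun j => hg.comp (hX j)]
  calc ∏ j, mgf ((S.indicator fun _ => (1 : ℝ)) ∘ X j) μ t
      ≤ ∏ _j : ι, Real.exp (ν.real S * (Real.exp t - 1)) := by
        refine Finset.prod_le_prod (fun j _ => mgf_nonneg) fun j _ => ?_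
        rw [← hν j, map_measureReal_apply (hX j) hS]
        exact mgf_indicator_one_le (hX j hS) t
    _ = Real.exp (Fintype.card ι * ν.real S * (Real.exp t - 1)) := by
        rw [Finset.prod_const, Finset.card_univ, ← Real.exp_nat_mul, mul_assoc]

lemma integrable_exp_mul_countIn [Finite ι] (hX : ∀ j, Measurable (X j)) (hS : MeasurableSet S)
    (t : ℝ) :
    Integrable (fun ω => Real.exp (t * countIn X S ω)) μ := by
  have hmeas : Measurable fun ω => (countIn X S ω : ℝ) := by
    cases nonempty_fintype ι
    simp only [countIn_eq_sum_indicator]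
    exact Finset.measurable_sum _ fun j _ => measurable_const.indicator (hX j hS)
  refine integrable_exp_mul_of_mem_Icc (a := 0) (b := Nat.card ι) hmeas.aemeasurable
    (.of_forall fun ω => ⟨Nat.cast_nonneg _, Nat.cast_le.2 ?_⟩)
  exact Set.ncard_le_card _

lemma measureReal_le_countIn_le [Fintype ι] (hX : ∀ j, Measurable (X j)) (hind : iIndepFun X μ)
    (hν : ∀ j, μ.map (X j) = ν) (hS : MeasurableSet S) {k : ℝ}
    (hk : 4 * (Fintype.card ι * ν.real S) ≤ k) :
    μ.real {ω | k ≤ countIn X S ω} ≤ Real.exp (-(k / 2)) := by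
  refine (measure_ge_le_exp_mul_mgf k zero_le_one (integrable_exp_mul_countIn hX hS 1)).trans ?_
  refine (mul_le_mul_of_nonneg_left (mgf_countIn_le hX hind hν hS 1) (Real.exp_pos _).le).trans ?_
  rw [← Real.exp_add, Real.exp_le_exp]
  have hexp : Real.exp 1 - 1 ≤ 2 := by linarith [Real.exp_one_lt_d9]
  have hmean : 0 ≤ Fintype.card ι * ν.real S := by positivity
  linarith [mul_le_mul_of_nonneg_left hexp hmean]

lemma measureReal_countIn_le_le [Fintype ι] (hX : ∀ j, Measurable (X j)) (hind : iIndepFun X μ)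
    (hν : ∀ j, μ.map (X j) = ν) (hS : MeasurableSet S) {k : ℝ}
    (hk : 4 * k ≤ Fintype.card ι * ν.real S) :
    μ.real {ω | (countIn X S ω : ℝ) ≤ k} ≤ Real.exp (-k) := by
  refine (measure_le_le_exp_mul_mgf k (by norm_num : (-1 : ℝ) ≤ 0)
    (integrable_exp_mul_countIn hX hS (-1))).trans ?_
  refine (mul_le_mul_of_nonneg_left (mgf_countIn_le hX hind hν hS (-1))
    (Real.exp_pos _).le).trans ?_
  rw [← Real.exp_add, Real.exp_le_exp]
  have hexp : Real.exp (-1) - 1 ≤ -(1 / 2) := by linarith [Real.exp_neg_one_lt_half]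
  have hmean : 0 ≤ Fintype.card ι * ν.real S := by positivity
  linarith [mul_le_mul_of_nonneg_left hexp hmean]

end Concentration

end Counts

/-! ### Local sampling -/

lemma volume_preimage_smul_sub {r : ℕ} {h : ℝ} (hh : 0 < h) (y : EuclideanSpace ℝ (Fin r))
    {B : Set (EuclideanSpace ℝ (Fin r))} (hB : MeasurableSet B) :
    volume ((fun z => h⁻¹ • (z - y)) ⁻¹' B) = ENNReal.ofReal (h ^ r) * volume B := by
  calc volume ((fun z => h⁻¹ • (z - y)) ⁻¹' B)
      = volume ((fun z => h⁻¹ • z) ⁻¹' B) :=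
        (measurePreserving_sub_right volume y).measure_preimage
          (measurable_const_smul _ hB).nullMeasurableSet
    _ = ENNReal.ofReal (h ^ r) * volume B := by
        rw [Measure.addHaar_preimage_smul _ (inv_ne_zero hh.ne'), finrank_euclideanSpace_fin,
          inv_pow, inv_inv, abs_of_pos (pow_pos hh r)]

lemma measureReal_preimage_smul_sub_le {r : ℕ} {ν : Measure (EuclideanSpace ℝ (Fin r))}
    {C h η : ℝ} (hν : ν ≤ ENNReal.ofReal C • volume) (hC : 0 ≤ C) (hh : 0 < h)
    (y : EuclideanSpace ℝ (Fin r)) {B : Set (EuclideanSpace ℝ (Fin r))} (hB : MeasurableSet B)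
    (hη : 0 ≤ η) (hvol : volume B ≤ ENNReal.ofReal η) :
    ν.real ((fun z => h⁻¹ • (z - y)) ⁻¹' B) ≤ C * (h ^ r * η) := by
  refine ENNReal.toReal_le_of_le_ofReal (by positivity) ((hν _).trans ?_)
  rw [Measure.smul_apply, smul_eq_mul, volume_preimage_smul_sub hh y hB,
    ENNReal.ofReal_mul hC, ENNReal.ofReal_mul (by positivity)]
  gcongr

/-- A triangular array of independent samples from a law `ν` that is comparable with Lebesgue
measure on `A`, observed on balls of radius `h n`, where `n * h n ^ r = K n` grows faster than
`log n`. -/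
structure LocalSampling {Ω : ℕ → Type*} [∀ n, MeasurableSpace (Ω n)] {r : ℕ}
    (μ : ∀ n, Measure (Ω n)) (α : ∀ n, Fin n → Ω n → EuclideanSpace ℝ (Fin r))
    (A : Set (EuclideanSpace ℝ (Fin r))) (ν : Measure (EuclideanSpace ℝ (Fin r)))
    (K : ℕ → ℕ) (h : ℕ → ℝ) : Prop where
  measurable : ∀ n i, Measurable (α n i)
  indep : ∀ n, iIndepFun (α n) (μ n)
  law : ∀ n i, (μ n).map (α n i) = ν
  le_volume : ∃ C > (0 : ℝ), ν ≤ ENNReal.ofReal C • volume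
  closedBall_ge : ∃ κ > (0 : ℝ), ∃ s₀ > (0 : ℝ), ∀ x ∈ A, ∀ s, 0 ≤ s → s ≤ s₀ →
    κ * s ^ r ≤ ν.real (Metric.closedBall x s)
  one_le : ∀ n, 0 < n → 1 ≤ K n
  pos : ∀ n, 0 < n → 0 < h n
  pow_eq : ∀ n, 0 < n → h n ^ r = (K n : ℝ) / n
  tendsto_h : Tendsto h atTop (𝓝 0)
  tendsto_exp : Tendsto (fun n : ℕ => (n : ℝ) * Real.exp (-((K n : ℝ) / 4))) atTop (𝓝 0)

namespace LocalSampling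

variable {Ω : ℕ → Type*} [∀ n, MeasurableSpace (Ω n)] {r : ℕ}
  {μ : ∀ n, Measure (Ω n)} {α : ∀ n, Fin n → Ω n → EuclideanSpace ℝ (Fin r)}
  {A : Set (EuclideanSpace ℝ (Fin r))} {ν : Measure (EuclideanSpace ℝ (Fin r))}
  {K : ℕ → ℕ} {h : ℕ → ℝ}

lemma measureReal_le_countIn_preimage_smul_sub_le [∀ n, IsProbabilityMeasure (μ n)]
    (L : LocalSampling μ α A ν K h) {c : ℝ} (hc : 0 < c)
    (hvol : ν ≤ ENNReal.ofReal c • volume) {n : ℕ} (hn : 0 < n)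
    (y : EuclideanSpace ℝ (Fin r)) {B : Set (EuclideanSpace ℝ (Fin r))} (hB : MeasurableSet B)
    (hBvol : volume B ≤ ENNReal.ofReal (1 / (8 * c))) :
    (μ n).real {ω | (K n : ℝ) / 2 ≤ countIn (α n) ((fun z => (h n)⁻¹ • (z - y)) ⁻¹' B) ω} ≤
      Real.exp (-((K n : ℝ) / 4)) := by
  have : (0 : ℝ) < n := Nat.cast_pos.2 hn
  have hmeas : MeasurableSet ((fun z => (h n)⁻¹ • (z - y)) ⁻¹' B) :=
    (by fun_prop : Measurable fun z => (h n)⁻¹ • (z - y)) hB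
  have hmass := measureReal_preimage_smul_sub_le hvol hc.le (L.pos n hn) y hB (by positivity) hBvol
  rw [L.pow_eq n hn] at hmass
  refine (measureReal_le_countIn_le (L.measurable n) (L.indep n) (L.law n) hmeas ?_).trans_eq
    (by rw [div_div]; norm_num)
  calc 4 * (Fintype.card (Fin n) * ν.real ((fun z => (h n)⁻¹ • (z - y)) ⁻¹' B))
      ≤ 4 * (n * (c * (K n / n * (1 / (8 * c))))) := by rw [Fintype.card_fin]; gcongr
    _ = K n / 2 := by field_simp; ring

variable [IsProbabilityMeasure ν]

lemma eventually_exists_net (L : LocalSampling μ α A ν K h) {τ : ℝ} (hτ : 0 < τ) :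
    ∃ c : ℝ, ∀ᶠ n : ℕ in atTop, ∃ T : Finset (EuclideanSpace ℝ (Fin r)),
      (T : Set (EuclideanSpace ℝ (Fin r))) ⊆ A ∧ (T.card : ℝ) ≤ c * n ∧
        ∀ x ∈ A, ∃ y ∈ T, dist x y ≤ τ * h n := by
  obtain ⟨κ, hκ, s₀, hs₀, hball⟩ := L.closedBall_ge
  refine ⟨1 / (κ * (τ / 2) ^ r), ?_⟩
  have hlim : Tendsto (fun n => τ * h n / 2) atTop (𝓝 0) := by
    simpa only [mul_zero, zero_div] using (L.tendsto_h.const_mul τ).div_const 2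
  filter_upwards [eventually_gt_atTop 0, hlim.eventually (gt_mem_nhds hs₀)] with n hn hsmall
  have hh := L.pos n hn
  have hK : (1 : ℝ) ≤ K n := Nat.one_le_cast.2 (L.one_le n hn)
  obtain ⟨T, hTA, hTcard, hTcover⟩ := exists_finset_dist_le (κ := κ * (τ * h n / 2) ^ r)
    (by positivity) (by positivity) fun x hx => hball x hx _ (by positivity) hsmall.le
  refine ⟨T, hTA, hTcard.trans ?_, hTcover⟩
  have hmass : κ * (τ * h n / 2) ^ r = κ * (τ / 2) ^ r * (K n / n) := by
    rw [← L.pow_eq n hn, mul_assoc, ← mul_pow]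
    congr 2
    ring
  rw [hmass, div_le_iff₀ (by positivity)]
  calc 1 ≤ (K n : ℝ) := hK
    _ = 1 / (κ * (τ / 2) ^ r) * n * (κ * (τ / 2) ^ r * (K n / n)) := by field_simp

variable [∀ n, IsProbabilityMeasure (μ n)]

lemma wpa1_lt_countIn (hr : 1 ≤ r) (L : LocalSampling μ α A ν K h) :
    ∃ D > 0, WPA1 μ fun n =>
      {ω | ∀ x ∈ A, K n < countIn (α n) (Metric.closedBall x (D * h n)) ω} := by
  obtain ⟨κ, hκ, s₀, hs₀, hball⟩ := L.closedBall_ge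
  obtain ⟨R, hR1, hκR⟩ : ∃ R : ℝ, 1 ≤ R ∧ 4 / κ ≤ R := ⟨_, le_max_left _ _, le_max_right _ _⟩
  have hmass : 4 ≤ κ * R ^ r := by
    rw [div_le_iff₀' hκ] at hκR
    exact hκR.trans (mul_le_mul_of_nonneg_left (le_self_pow₀ hR1 (by omega)) hκ.le)
  obtain ⟨c, hnet⟩ := L.eventually_exists_net (zero_lt_one.trans_le hR1)
  have hlim : Tendsto (fun n => R * h n) atTop (𝓝 0) := by
    simpa only [mul_zero] using L.tendsto_h.const_mul R
  refine ⟨2 * R, by positivity, .of_compl_subset_biUnion (ι := EuclideanSpace ℝ (Fin r)) (c := c)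
    (fun _ => Real.exp_nonneg _) L.tendsto_exp ?_⟩
  filter_upwards [eventually_gt_atTop 0, hlim.eventually (gt_mem_nhds hs₀), hnet]
    with n hn hsmall ⟨T, hTA, hTcard, hT⟩
  have hh := L.pos n hn
  have : (0 : ℝ) < n := Nat.cast_pos.2 hn
  refine ⟨T, fun y => {ω | (countIn (α n) (Metric.closedBall y (R * h n)) ω : ℝ) ≤ K n}, hTcard,
    fun y hy => ?_, fun ω hω => ?_⟩
  · refine (measureReal_countIn_le_le (L.measurable n) (L.indep n) (L.law n)
      measurableSet_closedBall ?_).trans (Real.exp_le_exp.2 ?_)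
    · have hy := hball y (hTA hy) (R * h n) (by positivity) hsmall.le
      rw [mul_pow, L.pow_eq n hn] at hy
      calc 4 * (K n : ℝ) ≤ κ * R ^ r * K n := by gcongr
        _ = n * (κ * (R ^ r * (K n / n))) := by field_simp
        _ ≤ _ := by rw [Fintype.card_fin]; gcongr
    · linarith [Nat.cast_nonneg (α := ℝ) (K n)]
  · have hfew : ¬ ∀ x ∈ A, K n < countIn (α n) (Metric.closedBall x (2 * R * h n)) ω := hω
    push Not at hfew
    obtain ⟨x, hx, hle⟩ := hfew
    obtain ⟨y, hy, hxy⟩ := hT x hx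
    have hball : Metric.closedBall y (R * h n) ⊆ Metric.closedBall x (2 * R * h n) :=
      Metric.closedBall_subset_closedBall' (by rw [dist_comm]; linarith)
    exact Set.mem_biUnion hy
      (show (countIn (α n) _ ω : ℝ) ≤ K n from Nat.cast_le.2 ((countIn_mono hball).trans hle))

lemma wpa1_countIn_sublevel_lt (L : LocalSampling μ α A ν K h) {N : ℕ} (e : GradedEnum r N)
    (C : ℝ) :
    ∃ ε > 0, WPA1 μ fun n => {ω | ∀ x ∈ A, ∀ v : Fin ((N + r).choose r) → ℝ, ∑ a, v a ^ 2 = 1 →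
      2 * countIn (α n) {y | ‖(h n)⁻¹ • (y - x)‖ ≤ C ∧
        |monomialVec e ((h n)⁻¹ • (y - x)) ⬝ᵥ v| ≤ ε} ω < K n} := by
  obtain ⟨Cν, hCν, hvol⟩ := L.le_volume
  obtain ⟨ε, hε, τ, hτ, Z, hZ, hcov⟩ := exists_finset_cover_monomialVec_sublevel e C
    (η := ENNReal.ofReal (1 / (8 * Cν))) (ENNReal.ofReal_pos.2 (by positivity))
  obtain ⟨c, hnet⟩ := L.eventually_exists_net hτ
  refine ⟨ε, hε, .of_compl_subset_biUnion
    (ι := EuclideanSpace ℝ (Fin r) × Set (EuclideanSpace ℝ (Fin r))) (c := c * Z.card)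
    (fun _ => Real.exp_nonneg _) L.tendsto_exp ?_⟩
  filter_upwards [eventually_gt_atTop 0, hnet] with n hn ⟨T, _, hTcard, hT⟩
  have hh := L.pos n hn
  refine ⟨T ×ˢ Z, fun yB => {ω | (K n : ℝ) / 2 ≤
    countIn (α n) ((fun z => (h n)⁻¹ • (z - yB.1)) ⁻¹' yB.2) ω}, ?_, fun ⟨y, B⟩ hyB => ?_,
    fun ω hω => ?_⟩
  · rw [Finset.card_product, Nat.cast_mul, mul_right_comm]
    gcongr
  · obtain ⟨hBmeas, hBvol⟩ := hZ B (Finset.mem_product.1 hyB).2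
    exact L.measureReal_le_countIn_preimage_smul_sub_le hCν hvol hn y hBmeas hBvol
  · have hmany : ¬ ∀ x ∈ A, ∀ v : Fin ((N + r).choose r) → ℝ, ∑ a, v a ^ 2 = 1 →
      2 * countIn (α n) {y | ‖(h n)⁻¹ • (y - x)‖ ≤ C ∧
        |monomialVec e ((h n)⁻¹ • (y - x)) ⬝ᵥ v| ≤ ε} ω < K n := hω
    push Not at hmany
    obtain ⟨x, hx, v, hv, hle⟩ := hmany
    obtain ⟨y, hy, hxy⟩ := hT x hx
    obtain ⟨B, hB, hsub⟩ := hcov v hv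
    have hcount := countIn_mono (X := α n) (ω := ω) fun z (hz : ‖(h n)⁻¹ • (z - x)‖ ≤ C ∧
        |monomialVec e ((h n)⁻¹ • (z - x)) ⬝ᵥ v| ≤ ε) =>
      show (h n)⁻¹ • (z - y) ∈ B from hsub _ hz.1 hz.2 (by
        rw [Metric.mem_closedBall, dist_eq_norm, ← smul_sub, sub_sub_sub_cancel_left, norm_smul,
          norm_inv, Real.norm_of_nonneg hh.le, ← dist_eq_norm, inv_mul_le_iff₀ hh, mul_comm]
        exact hxy)
    have hcount' : (K n : ℝ) ≤ 2 * countIn (α n) ((fun z => (h n)⁻¹ • (z - y)) ⁻¹' B) ω := by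
      exact_mod_cast hle.trans (Nat.mul_le_mul_left 2 hcount)
    exact Set.mem_biUnion (Finset.mem_product.2 ⟨hy, hB⟩ : (y, B) ∈ T ×ˢ Z)
      (show (K n : ℝ) / 2 ≤ _ by linarith)

end LocalSampling

/-! ### Taylor's formula in partial derivatives -/

section ListDerivatives

variable {E F : Type*} [NormedAddCommGroup E] [NormedSpace ℝ E] [NormedAddCommGroup F]
  [NormedSpace ℝ F] {A : Set E} {f : E → F} {N : ℕ}

/-- Iterated directional derivatives of `f` within `A` along a list of vectors, the head of the
list being the outermost derivative. In this form, symmetry under permutations of the directions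
reduces to the symmetry of second derivatives. -/
noncomputable def listFDerivWithin (A : Set E) (f : E → F) : List E → E → F
  | [] => f
  | v :: l => fun x => fderivWithin ℝ (listFDerivWithin A f l) A x v

lemma contDiffOn_listFDerivWithin (hA : UniqueDiffOn ℝ A) (hf : ContDiffOn ℝ N f A) :
    ∀ (l : List E) (k : ℕ), l.length + k ≤ N → ContDiffOn ℝ k (listFDerivWithin A f l) A
  | [], k, hk => hf.of_le (by rw [List.length_nil, zero_add] at hk; exact_mod_cast hk)
  | v :: l, k, hk => by
    have hl : ContDiffOn ℝ (k + 1 : ℕ) (listFDerivWithin A f l) A :=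
      contDiffOn_listFDerivWithin hA hf l (k + 1) (by rw [List.length_cons] at hk; omega)
    exact (hl.fderivWithin hA (by norm_cast)).clm_apply contDiffOn_const

lemma iteratedFDerivWithin_apply_eq_listFDerivWithin (hA : UniqueDiffOn ℝ A)
    (hf : ContDiffOn ℝ N f A) : ∀ {k : ℕ}, k ≤ N → ∀ (v : Fin k → E), ∀ x ∈ A,
      iteratedFDerivWithin ℝ k f A x v = listFDerivWithin A f (List.ofFn v) x
  | 0, _, v, x, _ => by simp [listFDerivWithin]
  | k + 1, hk, v, x, hx => by
    have ih := iteratedFDerivWithin_apply_eq_listFDerivWithin hA hf (Nat.le_of_succ_le hk)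
      (Fin.tail v)
    rw [iteratedFDerivWithin_succ_apply_left, List.ofFn_succ, listFDerivWithin,
      ← fderivWithin_continuousMultilinear_apply_const_apply (hA x hx)
        (hf.differentiableOn_iteratedFDerivWithin (by exact_mod_cast hk) hA x hx)]
    congr 1
    exact fderivWithin_congr ih (ih x hx)

lemma listFDerivWithin_perm (hA : UniqueDiffOn ℝ A) (hcl : A ⊆ closure (interior A))
    (hf : ContDiffOn ℝ N f A) {l l' : List E} (h : l.Perm l') (hl : l.length ≤ N) :
    Set.EqOn (listFDerivWithin A f l) (listFDerivWithin A f l') A := by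
  induction h with
  | nil => exact fun _ _ => rfl
  | cons v _ ih =>
    intro x hx
    have htail := ih (Nat.le_of_succ_le hl)
    simp only [listFDerivWithin]
    rw [fderivWithin_congr htail (htail hx)]
  | swap v w l =>
    intro x hx
    have hC2 : ContDiffOn ℝ (2 : ℕ) (listFDerivWithin A f l) A :=
      contDiffOn_listFDerivWithin hA hf l 2 hl
    have hdiff : DifferentiableWithinAt ℝ (fderivWithin ℝ (listFDerivWithin A f l) A) A x :=
      (hC2.fderivWithin (m := 1) hA (by norm_num)).differentiableOn (by norm_num) x hx
    have hsymm := (hC2 x hx).isSymmSndFDerivWithinAt (by simp) hA (hcl hx) hx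
    simp only [listFDerivWithin]
    rw [fderivWithin_clm_apply (hA x hx) hdiff (differentiableWithinAt_const _),
      fderivWithin_clm_apply (hA x hx) hdiff (differentiableWithinAt_const _)]
    simpa using hsymm _ _
  | trans h₁ _ ih₁ ih₂ => exact (ih₁ hl).trans (ih₂ (h₁.length_eq ▸ hl))

end ListDerivatives

section SegmentTaylor

variable {E F : Type*} [NormedAddCommGroup E] [NormedSpace ℝ E] [NormedAddCommGroup F]
  [NormedSpace ℝ F] {A : Set E} {f : E → F} {N : ℕ} {x y : E}

lemma hasFTaylorSeriesUpToOn_comp_lineMap (hconv : Convex ℝ A) (hA : UniqueDiffOn ℝ A)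
    (hf : ContDiffOn ℝ N f A) (hx : x ∈ A) (hy : y ∈ A) :
    HasFTaylorSeriesUpToOn N (f ∘ AffineMap.lineMap x y)
      (fun t k => (ftaylorSeriesWithin ℝ f A (AffineMap.lineMap x y t) k).compContinuousLinearMap
        fun _ => (ContinuousAffineMap.lineMap (R := ℝ) x y).contLinear) (Set.Icc (0 : ℝ) 1) :=
  ((hf.ftaylorSeriesWithin hA).comp_continuousAffineMap (ContinuousAffineMap.lineMap x y)).mono
    fun _ ht => hconv.lineMap_mem hx hy ht

lemma iteratedDerivWithin_comp_lineMap (hconv : Convex ℝ A) (hA : UniqueDiffOn ℝ A)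
    (hf : ContDiffOn ℝ N f A) (hx : x ∈ A) (hy : y ∈ A) {k : ℕ} (hk : k ≤ N) {t : ℝ}
    (ht : t ∈ Set.Icc (0 : ℝ) 1) :
    iteratedDerivWithin k (f ∘ AffineMap.lineMap x y) (Set.Icc 0 1) t
      = iteratedFDerivWithin ℝ k f A (AffineMap.lineMap x y t) fun _ => y - x := by
  have hseries := hasFTaylorSeriesUpToOn_comp_lineMap hconv hA hf hx hy
  rw [iteratedDerivWithin_eq_iteratedFDerivWithin,
    ← hseries.eq_iteratedFDerivWithin_of_uniqueDiffOn (by exact_mod_cast hk)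
      (uniqueDiffOn_Icc zero_lt_one) ht]
  simp [ftaylorSeriesWithin]

lemma norm_sub_sum_iteratedFDerivWithin_le (hconv : Convex ℝ A) (hA : UniqueDiffOn ℝ A) {m : ℕ}
    (hf : ContDiffOn ℝ (m + 1 : ℕ) f A) (hx : x ∈ A) (hy : y ∈ A) {C : ℝ}
    (hC : ∀ z ∈ A, ‖iteratedFDerivWithin ℝ (m + 1) f A z fun _ => y - x‖ ≤ C) :
    ‖f y - ∑ k ∈ Finset.range (m + 1), (k.factorial : ℝ)⁻¹ •
      iteratedFDerivWithin ℝ k f A x (fun _ => y - x)‖ ≤ C / m.factorial := by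
  have hderiv {k : ℕ} (hk : k ≤ m + 1) {t : ℝ} (ht : t ∈ Set.Icc (0 : ℝ) 1) :=
    iteratedDerivWithin_comp_lineMap hconv hA hf hx hy hk ht
  have hbound := taylor_mean_remainder_bound (n := m) zero_le_one
    (hasFTaylorSeriesUpToOn_comp_lineMap hconv hA hf hx hy).contDiffOn
    (Set.right_mem_Icc.2 zero_le_one) (C := C)
    fun t ht => by rw [hderiv le_rfl ht]; exact hC _ (hconv.lineMap_mem hx hy ht)
  rw [taylor_within_apply] at hbound
  convert hbound using 2
  · rw [Function.comp_apply, AffineMap.lineMap_apply_one]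
    congr 1
    refine Finset.sum_congr rfl fun k hk => ?_
    rw [hderiv (Finset.mem_range.1 hk).le (Set.left_mem_Icc.2 zero_le_one),
      AffineMap.lineMap_apply_zero, sub_zero, one_pow, mul_one]
  · rw [sub_zero, one_pow, mul_one]

end SegmentTaylor

section MultiIndices

variable {r : ℕ}

/-- The multi-index of a tuple of coordinates: how often each coordinate occurs in it. -/
def multiIndex {k : ℕ} (τ : Fin k → Fin r) (t : Fin r) : ℕ := (List.ofFn τ).count t

/-- The sorted list of coordinates with a given multi-index, which is the order of differentiation
in `partialDeriv`. -/
def multiIndexList (q : Fin r → ℕ) : List (Fin r) :=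
  (List.finRange r).flatMap fun t => List.replicate (q t) t

lemma count_multiIndexList (q : Fin r → ℕ) (t : Fin r) : (multiIndexList q).count t = q t := by
  simp [multiIndexList, List.count_flatMap, Function.comp_def, List.count_replicate,
    ← List.ofFn_eq_map, List.sum_ofFn]

lemma length_multiIndexList (q : Fin r → ℕ) : (multiIndexList q).length = ∑ t, q t := by
  simp [multiIndexList, List.length_flatMap, ← List.ofFn_eq_map, List.sum_ofFn]

lemma perm_multiIndexList {k : ℕ} (τ : Fin k → Fin r) :
    (List.ofFn τ).Perm (multiIndexList (multiIndex τ)) :=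
  List.perm_iff_count.2 fun t => (count_multiIndexList (multiIndex τ) t).symm

lemma sum_multiIndex {k : ℕ} (τ : Fin k → Fin r) : ∑ t, multiIndex τ t = k := by
  rw [← length_multiIndexList, ← (perm_multiIndexList τ).length_eq, List.length_ofFn]

lemma multiIndex_get_multiIndexList (q : Fin r → ℕ) : multiIndex (multiIndexList q).get = q := by
  ext t
  rw [multiIndex, List.ofFn_get, count_multiIndexList]

lemma prod_comp_eq_prod_pow_multiIndex {k : ℕ} (τ : Fin k → Fin r) (w : Fin r → ℝ) :
    ∏ j, w (τ j) = ∏ t, w t ^ multiIndex τ t := by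
  have hmap : ∏ j, w (τ j) = ((List.ofFn τ).map w).prod := by
    rw [List.map_ofFn, List.prod_ofFn]; rfl
  rw [hmap, Finset.prod_list_map_count]
  refine Finset.prod_subset (Finset.subset_univ _) fun t _ ht => ?_
  rw [List.mem_toFinset] at ht
  rw [List.count_eq_zero_of_not_mem ht, pow_zero]

lemma abs_prod_pow_le_norm_pow (q : Fin r → ℕ) (w : EuclideanSpace ℝ (Fin r)) :
    |∏ t, w t ^ q t| ≤ ‖w‖ ^ ∑ t, q t := by
  rw [Finset.abs_prod, ← Finset.prod_pow_eq_pow_sum]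
  refine Finset.prod_le_prod (fun _ _ => abs_nonneg _) fun t _ => ?_
  rw [abs_pow]
  gcongr
  exact PiLp.norm_apply_le w t

end MultiIndices

section PartialDerivatives

variable {r : ℕ} {A : Set (EuclideanSpace ℝ (Fin r))} {f : EuclideanSpace ℝ (Fin r) → ℝ} {N : ℕ}
  {x : EuclideanSpace ℝ (Fin r)}

lemma iteratedFDerivWithin_single_eq_partialDeriv (hA : UniqueDiffOn ℝ A)
    (hcl : A ⊆ closure (interior A)) (hf : ContDiffOn ℝ N f A) {k : ℕ} (hk : k ≤ N)
    (τ : Fin k → Fin r) (hx : x ∈ A) :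
    iteratedFDerivWithin ℝ k f A x (fun j => EuclideanSpace.single (τ j) 1)
      = partialDeriv A (multiIndex τ) f x := by
  set single : Fin r → EuclideanSpace ℝ (Fin r) := fun i => EuclideanSpace.single i 1
  have hlen : (multiIndexList (multiIndex τ)).length ≤ N := by
    rwa [length_multiIndexList, sum_multiIndex]
  have hsorted : partialDeriv A (multiIndex τ) f x
      = listFDerivWithin A f ((multiIndexList (multiIndex τ)).map single) x := by
    rw [← List.ofFn_get (l := multiIndexList (multiIndex τ)), List.map_ofFn]
    exact iteratedFDerivWithin_apply_eq_listFDerivWithin hA hf hlen _ x hx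
  have hperm : (List.ofFn fun j => single (τ j)).Perm
      ((multiIndexList (multiIndex τ)).map single) := by
    have h := (perm_multiIndexList τ).map single
    rwa [List.map_ofFn] at h
  rw [hsorted, iteratedFDerivWithin_apply_eq_listFDerivWithin hA hf hk _ x hx]
  exact listFDerivWithin_perm hA hcl hf hperm (by rwa [List.length_ofFn]) hx

lemma iteratedFDerivWithin_diag_eq_sum (hA : UniqueDiffOn ℝ A)
    (hcl : A ⊆ closure (interior A)) (hf : ContDiffOn ℝ N f A) {k : ℕ} (hk : k ≤ N)
    (hx : x ∈ A) (w : EuclideanSpace ℝ (Fin r)) :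
    iteratedFDerivWithin ℝ k f A x (fun _ => w)
      = ∑ τ : Fin k → Fin r, (∏ t, w t ^ multiIndex τ t) * partialDeriv A (multiIndex τ) f x := by
  have hw : w = ∑ i, w i • EuclideanSpace.single i (1 : ℝ) := by
    ext t
    simp [Finset.sum_apply, Pi.single_apply]
  conv_lhs => rw [hw]
  rw [ContinuousMultilinearMap.map_sum]
  refine Finset.sum_congr rfl fun τ _ => ?_
  rw [ContinuousMultilinearMap.map_smul_univ,
    iteratedFDerivWithin_single_eq_partialDeriv hA hcl hf hk τ hx,
    prod_comp_eq_prod_pow_multiIndex τ (fun i => w i), smul_eq_mul]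

lemma abs_iteratedFDerivWithin_diag_le (hA : UniqueDiffOn ℝ A)
    (hcl : A ⊆ closure (interior A)) (hf : ContDiffOn ℝ N f A) {B : ℝ}
    (hB : ∀ q : Fin r → ℕ, ∑ t, q t ≤ N → |partialDeriv A q f x| ≤ B) {k : ℕ} (hk : k ≤ N)
    (hx : x ∈ A) (w : EuclideanSpace ℝ (Fin r)) :
    |iteratedFDerivWithin ℝ k f A x (fun _ => w)| ≤ (r : ℝ) ^ k * (B * ‖w‖ ^ k) := by
  have hterm (τ : Fin k → Fin r) :
      |(∏ t, w t ^ multiIndex τ t) * partialDeriv A (multiIndex τ) f x| ≤ B * ‖w‖ ^ k := by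
    have hmonomial : |∏ t, w t ^ multiIndex τ t| ≤ ‖w‖ ^ k := by
      simpa only [sum_multiIndex] using abs_prod_pow_le_norm_pow (multiIndex τ) w
    rw [abs_mul, mul_comm B]
    exact mul_le_mul hmonomial (hB _ ((sum_multiIndex τ).trans_le hk)) (abs_nonneg _)
      (by positivity)
  rw [iteratedFDerivWithin_diag_eq_sum hA hcl hf hk hx]
  calc _ ≤ ∑ _τ : Fin k → Fin r, B * ‖w‖ ^ k :=
        (Finset.abs_sum_le_sum_abs _ _).trans (Finset.sum_le_sum fun τ _ => hterm τ)
    _ = (r : ℝ) ^ k * (B * ‖w‖ ^ k) := by simp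

/-- The weight of `∂^q f (x) (y - x)^q` in Taylor's formula, where `q` is the `a`-th multi-index.
It equals `1 / q!`, written as the number of orderings of `q` divided by `|q|!`; only its
positivity matters. -/
noncomputable def taylorWeight {m : ℕ} (e : GradedEnum r m) (a : Fin ((m + r).choose r)) : ℝ :=
  ∑ k ∈ Finset.range (m + 1), (k.factorial : ℝ)⁻¹ *
    (Finset.univ.filter fun τ : Fin k → Fin r => multiIndex τ = e.toEquiv a).card

lemma taylorWeight_pos {m : ℕ} (e : GradedEnum r m) (a : Fin ((m + r).choose r)) :
    0 < taylorWeight e a := by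
  set q : Fin r → ℕ := (e.toEquiv a).1
  have hcard : 0 < (Finset.univ.filter fun τ : Fin (multiIndexList q).length → Fin r =>
      multiIndex τ = q).card :=
    Finset.card_pos.2 ⟨(multiIndexList q).get, by simpa using multiIndex_get_multiIndexList q⟩
  refine Finset.sum_pos' (fun k _ => by positivity) ⟨(multiIndexList q).length, ?_, by positivity⟩
  rw [Finset.mem_range, length_multiIndexList]
  exact Nat.lt_succ_of_le (e.toEquiv a).2

lemma sum_multiIndex_eq_sum_card_mul {m k : ℕ} (e : GradedEnum r m) (hk : k ≤ m)
    (G : (Fin r → ℕ) → ℝ) :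
    ∑ τ : Fin k → Fin r, G (multiIndex τ)
      = ∑ a, ((Finset.univ.filter fun τ : Fin k → Fin r => multiIndex τ = e.toEquiv a).card : ℝ) *
        G (e.toEquiv a) := by
  let φ : (Fin k → Fin r) → Fin ((m + r).choose r) := fun τ =>
    e.toEquiv.symm ⟨multiIndex τ, (sum_multiIndex τ).trans_le hk⟩
  have hφ (τ a) : φ τ = a ↔ multiIndex τ = e.toEquiv a := by
    simp only [φ, Equiv.symm_apply_eq, Subtype.ext_iff]
  rw [← Finset.sum_fiberwise Finset.univ φ]
  refine Finset.sum_congr rfl fun a _ => ?_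
  simp only [hφ]
  rw [Finset.sum_congr rfl fun τ hτ => by rw [(Finset.mem_filter.1 hτ).2], Finset.sum_const,
    nsmul_eq_mul]

lemma sum_inv_factorial_mul_eq_sum_taylorWeight {m : ℕ} (e : GradedEnum r m)
    (G : (Fin r → ℕ) → ℝ) :
    ∑ k ∈ Finset.range (m + 1), (k.factorial : ℝ)⁻¹ * ∑ τ : Fin k → Fin r, G (multiIndex τ)
      = ∑ a, taylorWeight e a * G (e.toEquiv a) := by
  simp only [taylorWeight, Finset.sum_mul]
  rw [Finset.sum_comm]
  refine Finset.sum_congr rfl fun k hk => ?_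
  rw [sum_multiIndex_eq_sum_card_mul e (Nat.lt_succ_iff.1 (Finset.mem_range.1 hk)) G,
    Finset.mul_sum]
  exact Finset.sum_congr rfl fun a _ => (mul_assoc _ _ _).symm

lemma sum_iteratedFDerivWithin_eq_sum_taylorWeight (hA : UniqueDiffOn ℝ A)
    (hcl : A ⊆ closure (interior A)) {m : ℕ} (hf : ContDiffOn ℝ m f A) (e : GradedEnum r m)
    (hx : x ∈ A) (w : EuclideanSpace ℝ (Fin r)) :
    ∑ k ∈ Finset.range (m + 1), (k.factorial : ℝ)⁻¹ • iteratedFDerivWithin ℝ k f A x (fun _ => w)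
      = ∑ a, taylorWeight e a * partialDeriv A (e.toEquiv a) f x * monomialVec e w a := by
  have hsum := sum_inv_factorial_mul_eq_sum_taylorWeight e
    fun q => (∏ t, w t ^ q t) * partialDeriv A q f x
  calc _ = ∑ k ∈ Finset.range (m + 1), (k.factorial : ℝ)⁻¹ * ∑ τ : Fin k → Fin r,
        (∏ t, w t ^ multiIndex τ t) * partialDeriv A (multiIndex τ) f x :=
        Finset.sum_congr rfl fun k hk => by
          rw [iteratedFDerivWithin_diag_eq_sum hA hcl hf
            (Nat.lt_succ_iff.1 (Finset.mem_range.1 hk)) hx w, smul_eq_mul]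
    _ = _ := hsum.trans (Finset.sum_congr rfl fun a _ => by rw [monomialVec]; ring)

lemma abs_sub_sum_taylorWeight_le (hconv : Convex ℝ A) (hA : UniqueDiffOn ℝ A)
    (hcl : A ⊆ closure (interior A)) {m : ℕ} (hf : ContDiffOn ℝ (m + 1 : ℕ) f A) {B : ℝ}
    (hB : ∀ x ∈ A, ∀ q : Fin r → ℕ, ∑ t, q t ≤ m + 1 → |partialDeriv A q f x| ≤ B)
    (e : GradedEnum r m) {y : EuclideanSpace ℝ (Fin r)} (hx : x ∈ A) (hy : y ∈ A) :
    |f y - ∑ a, taylorWeight e a * partialDeriv A (e.toEquiv a) f x * monomialVec e (y - x) a|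
      ≤ (r : ℝ) ^ (m + 1) * B * ‖y - x‖ ^ (m + 1) := by
  have hB0 : 0 ≤ B := (abs_nonneg _).trans (hB x hx 0 (by simp))
  rw [← sum_iteratedFDerivWithin_eq_sum_taylorWeight hA hcl
    (hf.of_le (by exact_mod_cast m.le_succ)) e hx (y - x), mul_assoc]
  refine (norm_sub_sum_iteratedFDerivWithin_le hconv hA hf hx hy fun z hz =>
    abs_iteratedFDerivWithin_diag_le hA hcl hf (hB z hz) le_rfl hz _).trans
      (div_le_self (by positivity) ?_)
  exact_mod_cast m.factorial_pos

end PartialDerivatives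

/-! ### Measurability and conditional expectations of random matrices -/

section RandomEvaluation

variable {Ω : Type*}

lemma measurable_eval_randomIndex {ι : Type*} [MeasurableSpace Ω] [Countable ι] [MeasurableSpace ι]
    [MeasurableSingletonClass ι] {g : ι → Ω → ℝ} (hg : ∀ j, Measurable (g j)) {k : Ω → ι}
    (hk : Measurable k) : Measurable fun ω => g (k ω) ω :=
  (measurable_from_prod_countable_right (f := fun z : ι × Ω => g z.1 z.2) hg).comp
    (hk.prodMk measurable_id)

/-- Only the values of the random function at deterministic points are measurable, so its value at
a random point `a` is recovered as a limit along simple functions approximating `a`. -/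
lemma exists_measurable_eval_randomPoint {E : Type*} [MeasurableSpace Ω] [PseudoEMetricSpace E]
    [MeasurableSpace E] [OpensMeasurableSpace E] {A : Set E} [TopologicalSpace.SeparableSpace A]
    (hA : A.Nonempty) {f : Ω → E → ℝ} (hf : ∀ x ∈ A, Measurable fun ω => f ω x) {a : Ω → E}
    (ha : Measurable a) :
    ∃ g : Ω → ℝ, Measurable g ∧ ∀ ω, a ω ∈ A → ContinuousOn (f ω) A → g ω = f ω (a ω) := by
  classical
  obtain ⟨y₀, hy₀⟩ := hA
  let s := SimpleFunc.approxOn a ha A y₀ hy₀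
  have hsA (k ω) : s k ω ∈ A := SimpleFunc.approxOn_mem ha hy₀ k ω
  have hmeas (k) : Measurable fun ω => f ω (s k ω) := by
    have hbind := SimpleFunc.measurable_bind (s k) (fun x ω => if x ∈ A then f ω x else 0)
      fun x => by by_cases hx : x ∈ A <;> simp [hx, hf]
    simpa [hsA] using hbind
  refine ⟨fun ω => limsup (fun k => f ω (s k ω)) atTop, Measurable.limsup hmeas,
    fun ω hω hcont => ?_⟩
  have hlim : Tendsto (fun k => s k ω) atTop (𝓝[A] (a ω)) :=
    tendsto_nhdsWithin_iff.2 ⟨SimpleFunc.tendsto_approxOn ha hy₀ (subset_closure hω),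
      Eventually.of_forall fun k => hsA k ω⟩
  exact ((hcont (a ω) hω).tendsto.comp hlim).limsup_eq

variable {m m₀ : MeasurableSpace Ω} {μ : Measure[m₀] Ω}

lemma aestronglyMeasurable_eval_randomIndex {ι : Type*} [Countable ι] [MeasurableSpace ι]
    [MeasurableSingletonClass ι] {g : ι → Ω → ℝ} (hg : ∀ j, AEStronglyMeasurable[m] (g j) μ)
    {k : Ω → ι} (hk : Measurable[m] k) : AEStronglyMeasurable[m] (fun ω => g (k ω) ω) μ := by
  have hmeas := @measurable_eval_randomIndex Ω ι m _ _ _ (fun j => (hg j).mk (g j))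
    (fun j => (hg j).stronglyMeasurable_mk.measurable) k hk
  refine ⟨_, hmeas.stronglyMeasurable, ?_⟩
  filter_upwards [ae_all_iff.2 fun j => (hg j).ae_eq_mk] with ω hω using hω (k ω)

lemma aestronglyMeasurable_eval_randomPoint {E : Type*} [PseudoEMetricSpace E]
    [MeasurableSpace E] [OpensMeasurableSpace E] {A : Set E} [TopologicalSpace.SeparableSpace A]
    (hA : A.Nonempty) {f : Ω → E → ℝ} (hf : ∀ x ∈ A, Measurable[m] fun ω => f ω x) {a : Ω → E}
    (ha : Measurable[m] a) (haA : ∀ᵐ ω ∂μ, a ω ∈ A) (hcont : ∀ᵐ ω ∂μ, ContinuousOn (f ω) A) :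
    AEStronglyMeasurable[m] (fun ω => f ω (a ω)) μ := by
  obtain ⟨g, hg, hgf⟩ := @exists_measurable_eval_randomPoint Ω E m _ _ _ A _ hA f hf a ha
  refine ⟨g, hg.stronglyMeasurable, ?_⟩
  filter_upwards [haA, hcont] with ω hω hω' using (hgf ω hω hω').symm

end RandomEvaluation

section RandomMatrices

variable {Ω ι κ τ : Type*} [Fintype κ] {m m₀ : MeasurableSpace Ω} {μ : Measure[m₀] Ω}
  {S : Ω → Matrix ι κ ℝ} {T : Ω → Matrix κ τ ℝ} {C D : ℝ}

lemma aestronglyMeasurable_matrix_mul_apply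
    (hS : ∀ a k, AEStronglyMeasurable[m] (fun ω => S ω a k) μ)
    (hT : ∀ k b, AEStronglyMeasurable[m] (fun ω => T ω k b) μ) (a : ι) (b : τ) :
    AEStronglyMeasurable[m] (fun ω => (S ω * T ω) a b) μ := by
  have hsum : (fun ω => (S ω * T ω) a b) = ∑ k, fun ω => S ω a k * T ω k b := by
    ext ω; simp only [Matrix.mul_apply, Finset.sum_apply]
  rw [hsum]
  exact Finset.sum_induction _ (fun g : Ω → ℝ => AEStronglyMeasurable[m] g μ)
    (fun _ _ => AEStronglyMeasurable.add) stronglyMeasurable_zero.aestronglyMeasurable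
    fun k _ => (hS a k).mul (hT k b)

lemma integrable_matrix_mul_apply [IsFiniteMeasure μ]
    (hS : ∀ a k, AEStronglyMeasurable (fun ω => S ω a k) μ)
    (hT : ∀ k b, AEStronglyMeasurable (fun ω => T ω k b) μ)
    (hSC : ∀ᵐ ω ∂μ, ∀ a k, |S ω a k| ≤ C) (hTD : ∀ᵐ ω ∂μ, ∀ k b, |T ω k b| ≤ D)
    (a : ι) (b : τ) : Integrable (fun ω => (S ω * T ω) a b) μ := by
  refine Integrable.of_bound (aestronglyMeasurable_matrix_mul_apply hS hT a b)
    (∑ _k : κ, C * D) ?_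
  filter_upwards [hSC, hTD] with ω hSω hTω
  rw [Matrix.mul_apply]
  refine (norm_sum_le _ _).trans (Finset.sum_le_sum fun k _ => ?_)
  rw [Real.norm_eq_abs, abs_mul]
  exact mul_le_mul (hSω a k) (hTω k b) (abs_nonneg _) ((abs_nonneg _).trans (hSω a k))

lemma condExpMat_mul_ae_eq [Countable ι] [Countable τ] [IsFiniteMeasure μ] (hm : m ≤ m₀)
    (hS : ∀ a k, AEStronglyMeasurable[m] (fun ω => S ω a k) μ)
    (hT : ∀ k b, AEStronglyMeasurable[m] (fun ω => T ω k b) μ)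
    (hSC : ∀ᵐ ω ∂μ, ∀ a k, |S ω a k| ≤ C) (hTD : ∀ᵐ ω ∂μ, ∀ k b, |T ω k b| ≤ D) :
    condExpMat μ m (fun ω => S ω * T ω) =ᵐ[μ] fun ω => S ω * T ω := by
  have hentry (a b) : μ[fun ω => (S ω * T ω) a b | m] =ᵐ[μ] fun ω => (S ω * T ω) a b :=
    condExp_of_aestronglyMeasurable' hm (aestronglyMeasurable_matrix_mul_apply hS hT a b)
      (integrable_matrix_mul_apply (fun a k => (hS a k).mono hm) (fun k b => (hT k b).mono hm)
        hSC hTD a b)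
  filter_upwards [ae_all_iff.2 fun a => ae_all_iff.2 (hentry a)] with ω hω
  exact Matrix.ext hω

end RandomMatrices

lemma ae_ne_of_indepFun {Ω E : Type*} {mΩ : MeasurableSpace Ω} [MeasurableSpace E]
    [MeasurableEq E] {μ : Measure Ω} [IsFiniteMeasure μ] {X Y : Ω → E} (hX : Measurable X)
    (hY : Measurable Y) (hXY : IndepFun X Y μ) [NullSingletonClass (μ.map Y)] :
    ∀ᵐ ω ∂μ, X ω ≠ Y ω := by
  have hdiag : MeasurableSet (Set.diagonal E) := measurableSet_diagonal
  have hprod := (indepFun_iff_map_prod_eq_prod_map_map hX.aemeasurable hY.aemeasurable).1 hXY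
  have hnull : (μ.map fun ω => (X ω, Y ω)) (Set.diagonal E) = 0 := by
    rw [hprod, Measure.measure_prod_null hdiag]
    refine ae_of_all _ fun x => ?_
    have hslice : Prod.mk x ⁻¹' Set.diagonal E = {x} := by ext y; simp [eq_comm]
    simp only [hslice, measure_singleton, Pi.zero_apply]
  rw [Measure.map_apply (hX.prodMk hY) hdiag] at hnull
  rw [ae_iff]
  simpa [Set.preimage, Set.diagonal] using hnull

/-! ### The latent factors -/

namespace FactorArray

variable {Ω : ℕ → Type*} [∀ n, MeasurableSpace (Ω n)] {r : ℕ} {M : FactorArray Ω r}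
  {μ : ∀ n, Measure (Ω n)} {A : Set (EuclideanSpace ℝ (Fin r))} {m : ℕ} {K : ℕ → ℕ}
  {nn : ∀ n, M.MatchData n → Fin n → Fin (K n) → Fin n}

/-- The regularity conditions on the latent variables and on the latent functions up to the order
`m` of the local approximation; the errors are not restricted. -/
structure LatentRegularity (M : FactorArray Ω r) (μ : ∀ n, Measure (Ω n))
    (A : Set (EuclideanSpace ℝ (Fin r))) (m : ℕ) : Prop where
  compact : IsCompact A
  convex : Convex ℝ A
  indep : ∀ n, iIndepFun (M.α n) (μ n)
  density : ∃ (f : EuclideanSpace ℝ (Fin r) → ℝ) (c C : ℝ), Measurable f ∧ 0 < c ∧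
    (∀ x ∈ A, c ≤ f x ∧ f x ≤ C) ∧
    ∀ n i, (μ n).map (M.α n i) = (volume.restrict A).withDensity fun x => ENNReal.ofReal (f x)
  smooth : ∀ n l, ∀ᵐ ω ∂μ n, ContDiffOn ℝ m (M.η n l ω) A
  bounded : ∃ B : ℝ, ∀ n l, ∀ᵐ ω ∂μ n, ∀ x ∈ A, ∀ q : Fin r → ℕ, ∑ t, q t ≤ m →
    |partialDeriv A q (M.η n l ω) x| ≤ B

lemma Regularities.latentRegularity {mbar : ℕ} (hreg : M.Regularities μ A mbar)
    (hm : m ≤ mbar) : M.LatentRegularity μ A m where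
  compact := hreg.compact
  convex := hreg.convex
  indep := hreg.indep
  density := hreg.density
  smooth n l := (hreg.smooth n l).mono fun _ hω => hω.of_le (by exact_mod_cast hm)
  bounded := hreg.bounded.imp fun _ hB n l =>
    (hB n l).mono fun _ hω x hx q hq => hω x hx q (hq.trans hm)

section Measurability

lemma measurable_η_apply (n : ℕ) (l : Fin (M.p n)) (x : EuclideanSpace ℝ (Fin r)) :
    Measurable fun ω => M.η n l ω x :=
  (M.measurable_η n l).comp (measurable_id.prodMk measurable_const)

lemma measurable_Xdag (n : ℕ) : Measurable (M.Xdag n) :=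
  measurable_pi_lambda _ fun i => measurable_pi_lambda _ fun l =>
    ((M.measurable_η n l).comp (measurable_id.prodMk (M.measurable_α n i))).add
      (M.measurable_u n i l)

lemma sigmaMatch_le (n : ℕ) : M.sigmaMatch A n ≤ (inferInstance : MeasurableSpace (Ω n)) :=
  sup_le (sup_le (iSup_le fun i => (M.measurable_α n i).comap_le)
    (iSup_le fun l => iSup_le fun _ => (measurable_η_apply n l _).comap_le))
    (measurable_Xdag n).comap_le

lemma measurable_α_sigmaMatch (n : ℕ) (i : Fin n) : Measurable[M.sigmaMatch A n] (M.α n i) :=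
  measurable_iff_comap_le.2 (le_sup_of_le_left (le_sup_of_le_left (le_iSup_of_le i le_rfl)))

lemma measurable_η_sigmaMatch (n : ℕ) (l : Fin (M.p n)) {x : EuclideanSpace ℝ (Fin r)}
    (hx : x ∈ A) : Measurable[M.sigmaMatch A n] fun ω => M.η n l ω x :=
  measurable_iff_comap_le.2 (le_sup_of_le_left (le_sup_of_le_right
    (le_iSup_of_le l (le_iSup_of_le (⟨x, hx⟩ : A) le_rfl))))

lemma measurable_nbr_sigmaMatch (hnn : ∀ n i k, Measurable fun V => nn n V i k) (n : ℕ) (i : Fin n)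
    (k : Fin (K n)) : Measurable[M.sigmaMatch A n] (M.nbr nn n i k) :=
  (hnn n i k).comp (measurable_iff_comap_le.2 le_sup_right)

lemma aestronglyMeasurable_monomialLoadings (hnn : ∀ n i k, Measurable fun V => nn n V i k)
    (e : GradedEnum r (m - 1)) (n : ℕ) (i : Fin n) (k : Fin (K n))
    (b : Fin ((m - 1 + r).choose r)) :
    AEStronglyMeasurable[M.sigmaMatch A n] (fun ω => M.monomialLoadings nn e n i ω k b) (μ n) := by
  have hcoord (i : Fin n) (t : Fin r) : Measurable[M.sigmaMatch A n] fun ω => M.α n i ω t :=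
    (show Measurable fun x : EuclideanSpace ℝ (Fin r) => x t by fun_prop).comp
      (measurable_α_sigmaMatch n i)
  refine aestronglyMeasurable_eval_randomIndex (g := fun j ω => ∏ t,
    (M.α n j ω t - M.α n i ω t) ^ (e.toEquiv b : Fin r → ℕ) t) (fun j => ?_)
    (measurable_nbr_sigmaMatch hnn n i k)
  exact (Finset.measurable_prod _ fun t _ =>
    ((hcoord j t).sub (hcoord i t)).pow_const _).stronglyMeasurable.aestronglyMeasurable

end Measurability

namespace LatentRegularity

lemma ae_mem (hreg : M.LatentRegularity μ A m) (n : ℕ) : ∀ᵐ ω ∂μ n, ∀ i, M.α n i ω ∈ A := by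
  obtain ⟨f, c, C, -, -, -, hlaw⟩ := hreg.density
  have hA := hreg.compact.isClosed.measurableSet
  refine ae_all_iff.2 fun i => ae_of_ae_map (M.measurable_α n i).aemeasurable ?_
  rw [hlaw n i]
  exact (withDensity_absolutelyContinuous _ _).ae_le (ae_restrict_mem hA)

section Probability

variable [∀ n, IsProbabilityMeasure (μ n)]

lemma nonempty (hreg : M.LatentRegularity μ A m) : A.Nonempty :=
  have ⟨_, hω⟩ := (hreg.ae_mem 1).exists
  ⟨_, hω 0⟩

lemma ae_ne (hreg : M.LatentRegularity μ A m) (hr : 1 ≤ r) (n : ℕ) :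
    ∀ᵐ ω ∂μ n, ∀ i j, i ≠ j → M.α n i ω ≠ M.α n j ω := by
  obtain ⟨f, c, C, -, -, -, hlaw⟩ := hreg.density
  have : Nonempty (Fin r) := ⟨⟨0, hr⟩⟩
  simp only [ae_all_iff]
  intro i j hij
  have : NullSingletonClass ((μ n).map (M.α n j)) := by rw [hlaw n j]; infer_instance
  exact ae_ne_of_indepFun (M.measurable_α n i) (M.measurable_α n j) ((hreg.indep n).indepFun hij)

lemma interior_nonempty (hreg : M.LatentRegularity μ A m) : (interior A).Nonempty := by
  obtain ⟨f, c, C, -, -, -, hlaw⟩ := hreg.density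
  by_contra! hempty
  have hvol : volume A = 0 := by
    rw [← hreg.convex.addHaar_frontier (volume : Measure (EuclideanSpace ℝ (Fin r))), frontier,
      hempty, Set.sdiff_empty, hreg.compact.isClosed.closure_eq]
  have hzero : (μ 1).map (M.α 1 0) = 0 := by
    rw [hlaw, Measure.restrict_eq_zero.2 hvol, withDensity_zero_left]
  have := Measure.isProbabilityMeasure_map (μ := μ 1) (M.measurable_α 1 0).aemeasurable
  exact IsProbabilityMeasure.ne_zero _ hzero

lemma aestronglyMeasurable_Hloc (hreg : M.LatentRegularity μ A m)
    (hnn : ∀ n i k, Measurable fun V => nn n V i k) (n : ℕ) (i : Fin n)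
    (l : {l // l ∈ M.Rddag n}) (k : Fin (K n)) :
    AEStronglyMeasurable[M.sigmaMatch A n] (fun ω => M.Hloc nn n i ω l k) (μ n) :=
  aestronglyMeasurable_eval_randomIndex (g := fun j => M.H n j l)
    (fun j => aestronglyMeasurable_eval_randomPoint hreg.nonempty
      (fun _ hx => measurable_η_sigmaMatch (M := M) n l hx) (measurable_α_sigmaMatch n j)
      ((hreg.ae_mem n).mono fun _ hω => hω j)
      ((hreg.smooth n l).mono fun _ hω => hω.continuousOn))
    (measurable_nbr_sigmaMatch hnn n i k)

end Probability

lemma exists_ae_abs_H_le (hreg : M.LatentRegularity μ A m) :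
    ∃ B : ℝ, ∀ n, ∀ᵐ ω ∂μ n, ∀ i l, |M.H n i l ω| ≤ B := by
  obtain ⟨B, hB⟩ := hreg.bounded
  refine ⟨B, fun n => ?_⟩
  filter_upwards [hreg.ae_mem n, ae_all_iff.2 (hB n)] with ω hα hη i l
  have hzero : partialDeriv A 0 (M.η n l ω) (M.α n i ω) = M.H n i l ω := by
    have hlist : ((List.finRange r).flatMap fun t => List.replicate ((0 : Fin r → ℕ) t) t) = [] :=
      by simp
    rw [partialDeriv, hlist]
    simp [H]
  exact hzero ▸ hη l _ (hα i) 0 (by simp)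

end LatentRegularity

lemma monomialLoadings_apply (e : GradedEnum r (m - 1)) (n : ℕ) (i : Fin n) (ω : Ω n)
    (k : Fin (K n)) : M.monomialLoadings nn e n i ω k
      = monomialVec e (M.α n (M.nbr nn n i k ω) ω - M.α n i ω) := by
  ext b
  simp [monomialLoadings, monomialVec]

end FactorArray

lemma abs_monomialVec_le {r N : ℕ} (e : GradedEnum r N) (y : EuclideanSpace ℝ (Fin r))
    (b : Fin ((N + r).choose r)) : |monomialVec e y b| ≤ ‖y‖ ^ e.deg b :=
  abs_prod_pow_le_norm_pow _ y

namespace FactorArray.LatentRegularity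

variable {Ω : ℕ → Type*} [∀ n, MeasurableSpace (Ω n)] {r : ℕ} {M : FactorArray Ω r}
  {μ : ∀ n, Measure (Ω n)} {A : Set (EuclideanSpace ℝ (Fin r))} {m : ℕ} {K : ℕ → ℕ}
  {nn : ∀ n, M.MatchData n → Fin n → Fin (K n) → Fin n}

lemma exists_ae_abs_monomialLoadings_le (hreg : M.LatentRegularity μ A m)
    (nn : ∀ n, M.MatchData n → Fin n → Fin (K n) → Fin n) (e : GradedEnum r (m - 1)) :
    ∃ B : ℝ, ∀ n, ∀ᵐ ω ∂μ n, ∀ i k b, |M.monomialLoadings nn e n i ω k b| ≤ B := by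
  refine ⟨∑ b, Metric.diam A ^ e.deg b, fun n => ?_⟩
  filter_upwards [hreg.ae_mem n] with ω hα i k b
  have hdiam : ‖M.α n (M.nbr nn n i k ω) ω - M.α n i ω‖ ≤ Metric.diam A := by
    rw [← dist_eq_norm]
    exact Metric.dist_le_diam_of_mem hreg.compact.isBounded (hα _) (hα _)
  calc |M.monomialLoadings nn e n i ω k b|
      ≤ ‖M.α n (M.nbr nn n i k ω) ω - M.α n i ω‖ ^ e.deg b := by
        rw [monomialLoadings_apply]; exact abs_monomialVec_le e _ b
    _ ≤ Metric.diam A ^ e.deg b := by gcongr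
    _ ≤ ∑ b, Metric.diam A ^ e.deg b := Finset.single_le_sum
      (f := fun b => Metric.diam A ^ e.deg b) (fun b _ => pow_nonneg Metric.diam_nonneg _)
      (Finset.mem_univ b)

section CondExp

variable [∀ n, IsProbabilityMeasure (μ n)] (hreg : M.LatentRegularity μ A m)
  (hnn : ∀ n i k, Measurable fun V => nn n V i k) (e : GradedEnum r (m - 1)) (n : ℕ)

include hreg hnn

lemma integrable_Hloc_mul (i : Fin n) (l : {l // l ∈ M.Rddag n})
    (b : Fin ((m - 1 + r).choose r)) :
    Integrable (fun ω => (M.Hloc nn n i ω * M.monomialLoadings nn e n i ω) l b) (μ n) := by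
  obtain ⟨B, hB⟩ := hreg.exists_ae_abs_H_le
  obtain ⟨C, hC⟩ := hreg.exists_ae_abs_monomialLoadings_le nn e
  exact integrable_matrix_mul_apply
    (fun l k => (hreg.aestronglyMeasurable_Hloc hnn n i l k).mono (sigmaMatch_le n))
    (fun k b => (aestronglyMeasurable_monomialLoadings hnn e n i k b).mono
      (sigmaMatch_le (A := A) n))
    ((hB n).mono fun _ hω l k => hω _ l) ((hC n).mono fun _ hω => hω i) l b

lemma integrable_loadings_gram (i : Fin n) (a b : Fin ((m - 1 + r).choose r)) :
    Integrable (fun ω => ((M.monomialLoadings nn e n i ω)ᵀ * M.monomialLoadings nn e n i ω) a b)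
      (μ n) := by
  obtain ⟨C, hC⟩ := hreg.exists_ae_abs_monomialLoadings_le nn e
  have hmeas (k b) := (aestronglyMeasurable_monomialLoadings (μ := μ) hnn e n i k b).mono
    (sigmaMatch_le (A := A) n)
  exact integrable_matrix_mul_apply (fun a k => hmeas k a) hmeas
    ((hC n).mono fun _ hω a k => hω i k a) ((hC n).mono fun _ hω => hω i) a b

lemma ae_condExpMat_loadings_gram :
    ∀ᵐ ω ∂μ n, ∀ i, condExpMat (μ n) (M.sigmaMatch A n)
      (fun ω' => (M.monomialLoadings nn e n i ω')ᵀ * M.monomialLoadings nn e n i ω') ω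
      = (M.monomialLoadings nn e n i ω)ᵀ * M.monomialLoadings nn e n i ω := by
  obtain ⟨C, hC⟩ := hreg.exists_ae_abs_monomialLoadings_le nn e
  exact ae_all_iff.2 fun i => condExpMat_mul_ae_eq (sigmaMatch_le n)
    (fun a k => aestronglyMeasurable_monomialLoadings hnn e n i k a)
    (fun k b => aestronglyMeasurable_monomialLoadings hnn e n i k b)
    ((hC n).mono fun _ hω a k => hω i k a) ((hC n).mono fun _ hω => hω i)

lemma ae_condExpMat_Hloc_mul :
    ∀ᵐ ω ∂μ n, ∀ i, condExpMat (μ n) (M.sigmaMatch A n)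
      (fun ω' => M.Hloc nn n i ω' * M.monomialLoadings nn e n i ω') ω
      = M.Hloc nn n i ω * M.monomialLoadings nn e n i ω := by
  obtain ⟨B, hB⟩ := hreg.exists_ae_abs_H_le
  obtain ⟨C, hC⟩ := hreg.exists_ae_abs_monomialLoadings_le nn e
  exact ae_all_iff.2 fun i => condExpMat_mul_ae_eq (sigmaMatch_le n)
    (fun l k => hreg.aestronglyMeasurable_Hloc hnn n i l k)
    (fun k b => aestronglyMeasurable_monomialLoadings hnn e n i k b)
    ((hB n).mono fun _ hω l k => hω _ l) ((hC n).mono fun _ hω => hω i)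

end CondExp

end FactorArray.LatentRegularity

/-! ### Least squares -/

section LeastSquares

variable {ι κ δ : Type*} [Fintype κ] [Fintype δ] {ε b B c : ℝ}

lemma sum_sq_le_card_mul_sq {f : κ → ℝ} (hf : ∀ k, |f k| ≤ b) :
    ∑ k, f k ^ 2 ≤ Fintype.card κ * b ^ 2 :=
  calc ∑ k, f k ^ 2 ≤ ∑ _k : κ, b ^ 2 := by
        gcongr ∑ _, ?_ with k
        exact sq_le_sq' (abs_le.1 (hf k)).1 (abs_le.1 (hf k)).2
    _ = Fintype.card κ * b ^ 2 := by simp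

lemma sq_div_two_le_mean_sq [Nonempty κ] {f : κ → ℝ} (hε : 0 ≤ ε)
    (hf : 2 * {k | |f k| ≤ ε}.ncard ≤ Fintype.card κ) :
    ε ^ 2 / 2 ≤ (Fintype.card κ : ℝ)⁻¹ * ∑ k, f k ^ 2 := by
  classical
  have : (0 : ℝ) < Fintype.card κ := by exact_mod_cast Fintype.card_pos
  set small := Finset.univ.filter fun k => |f k| ≤ ε
  have hcard : (2 * small.card : ℝ) ≤ Fintype.card κ := by
    rw [Set.ncard_eq_toFinset_card'] at hf
    exact_mod_cast (by simpa [small] using hf)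
  have hcompl : (small.card + smallᶜ.card : ℝ) = Fintype.card κ := by
    exact_mod_cast Finset.card_add_card_compl small
  rw [le_inv_mul_iff₀ this]
  calc Fintype.card κ * (ε ^ 2 / 2) ≤ smallᶜ.card * ε ^ 2 := by nlinarith [sq_nonneg ε]
    _ = ∑ _k ∈ smallᶜ, ε ^ 2 := by simp
    _ ≤ ∑ k ∈ smallᶜ, f k ^ 2 := by
        refine Finset.sum_le_sum fun k hk => ?_
        rw [← sq_abs (f k)]
        have hk' : ε < |f k| := by simpa [small] using hk
        gcongr
    _ ≤ ∑ k, f k ^ 2 :=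
        Finset.sum_le_univ_sum_of_nonneg fun k => sq_nonneg _

lemma mean_sq_mulVec_le [Nonempty κ] {Z : Matrix κ δ ℝ} (hZ : ∀ k, ∑ a, Z k a ^ 2 ≤ B)
    (v : δ → ℝ) : (Fintype.card κ : ℝ)⁻¹ * ∑ k, (Z *ᵥ v) k ^ 2 ≤ B * ∑ a, v a ^ 2 := by
  have : (0 : ℝ) < Fintype.card κ := by exact_mod_cast Fintype.card_pos
  rw [inv_mul_le_iff₀ this]
  calc ∑ k, (Z *ᵥ v) k ^ 2 ≤ ∑ _k : κ, B * ∑ a, v a ^ 2 := by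
        refine Finset.sum_le_sum fun k _ => (Finset.sum_mul_sq_le_sq_mul_sq _ _ _).trans ?_
        gcongr
        exact hZ k
    _ = Fintype.card κ * (B * ∑ a, v a ^ 2) := by simp

lemma mul_sum_sq_le_mean_sq_mulVec [Nonempty κ] {Z : Matrix κ δ ℝ} (hε : 0 ≤ ε)
    (hZ : ∀ v : δ → ℝ, ∑ a, v a ^ 2 = 1 → 2 * {k | |(Z *ᵥ v) k| ≤ ε}.ncard ≤ Fintype.card κ)
    (v : δ → ℝ) :
    ε ^ 2 / 2 * ∑ a, v a ^ 2 ≤ (Fintype.card κ : ℝ)⁻¹ * ∑ k, (Z *ᵥ v) k ^ 2 := by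
  set s := ∑ a, v a ^ 2
  have hs : 0 ≤ s := Finset.sum_nonneg fun a _ => sq_nonneg _
  rcases hs.eq_or_lt with hzero | hpos
  · rw [← hzero, mul_zero]
    positivity
  · have hunit : ∑ a, ((√s)⁻¹ • v) a ^ 2 = 1 := by
      simp only [Pi.smul_apply, smul_eq_mul, mul_pow, ← Finset.mul_sum, inv_pow, Real.sq_sqrt hs]
      exact inv_mul_cancel₀ hpos.ne'
    have hmean := sq_div_two_le_mean_sq hε (hZ _ hunit)
    simp only [Matrix.mulVec_smul, Pi.smul_apply, smul_eq_mul, mul_pow, ← Finset.mul_sum, inv_pow,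
      Real.sq_sqrt hs] at hmean
    rwa [mul_left_comm, le_inv_mul_iff₀ hpos, mul_comm s] at hmean

/-- The rows of `Z` have squared norm at most `B`, and the quadratic form `v ↦ ‖Z v‖²`, averaged
over the rows, is at least `c ‖v‖²`. -/
structure WellConditioned (c B : ℝ) (Z : Matrix κ δ ℝ) : Prop where
  pos : 0 < c
  mul_sum_sq_le : ∀ v : δ → ℝ,
    c * ∑ a, v a ^ 2 ≤ (Fintype.card κ : ℝ)⁻¹ * ∑ k, (Z *ᵥ v) k ^ 2
  row_le : ∀ k, ∑ a, Z k a ^ 2 ≤ B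

namespace WellConditioned

variable {Z : Matrix κ δ ℝ}

lemma mono (h : WellConditioned c B Z) {c' B' : ℝ} (hc' : 0 < c') (hc : c' ≤ c) (hB : B ≤ B') :
    WellConditioned c' B' Z where
  pos := hc'
  mul_sum_sq_le v := by
    refine le_trans ?_ (h.mul_sum_sq_le v)
    gcongr
  row_le k := (h.row_le k).trans hB

lemma sq_apply_le (h : WellConditioned c B Z) (k : κ) (a : δ) : Z k a ^ 2 ≤ B :=
  (Finset.single_le_sum (fun a _ => sq_nonneg (Z k a)) (Finset.mem_univ a)).trans (h.row_le k)

lemma le_sMin {d : ℕ} {Z : Matrix κ (Fin d) ℝ} (h : WellConditioned c B Z) (hd : 0 < d) :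
    c ≤ sMin ((Fintype.card κ : ℝ)⁻¹ • (Zᵀ * Z)) :=
  le_sMin_smul_gram hd h.mul_sum_sq_le

lemma nonempty [Nonempty δ] (h : WellConditioned c B Z) : Nonempty κ := by
  by_contra! hempty
  have hone := h.mul_sum_sq_le 1
  have : 0 < c * Fintype.card δ := mul_pos h.pos (by exact_mod_cast Fintype.card_pos)
  rw [Finset.univ_eq_empty (α := κ), Finset.sum_empty, mul_zero] at hone
  exact hone.not_gt (by simpa using this)

lemma sMax_le {d : ℕ} {Z : Matrix κ (Fin d) ℝ} (h : WellConditioned c B Z) (hd : 0 < d) :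
    sMax ((Fintype.card κ : ℝ)⁻¹ • (Zᵀ * Z)) ≤ B := by
  have : Nonempty (Fin d) := ⟨⟨0, hd⟩⟩
  have := h.nonempty
  exact sMax_smul_gram_le hd (by positivity) (mean_sq_mulVec_le h.row_le)

lemma of_sub [Nonempty κ] (h : WellConditioned c B Z) {Y : Matrix κ δ ℝ}
    (hY : ∀ k, ∑ a, (Y - Z) k a ^ 2 ≤ c / 4) : WellConditioned (c / 4) (2 * B + c / 2) Y where
  pos := by linarith [h.pos]
  mul_sum_sq_le v := by
    have hsq : (Fintype.card κ : ℝ)⁻¹ * ∑ k, (Z *ᵥ v) k ^ 2 ≤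
        (Fintype.card κ : ℝ)⁻¹ * ∑ k, (2 * (Y *ᵥ v) k ^ 2 + 2 * ((Y - Z) *ᵥ v) k ^ 2) := by
      gcongr with k
      rw [Matrix.sub_mulVec, Pi.sub_apply]
      nlinarith [sq_nonneg ((Z *ᵥ v) k - 2 * (Y *ᵥ v) k)]
    rw [Finset.sum_add_distrib, ← Finset.mul_sum, ← Finset.mul_sum] at hsq
    linarith [h.mul_sum_sq_le v, mean_sq_mulVec_le hY v]
  row_le k :=
    calc ∑ a, Y k a ^ 2 ≤ ∑ a, (2 * Z k a ^ 2 + 2 * (Y - Z) k a ^ 2) := by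
          gcongr with a
          rw [Matrix.sub_apply]
          nlinarith [sq_nonneg (Y k a - 2 * Z k a)]
      _ ≤ 2 * B + c / 2 := by
          rw [Finset.sum_add_distrib, ← Finset.mul_sum, ← Finset.mul_sum]
          linarith [h.row_le k, hY k]

variable [DecidableEq δ]

lemma mul_diagonal (h : WellConditioned c B Z) {w : δ → ℝ} {w₀ W : ℝ} (hw₀ : 0 < w₀)
    (hw : ∀ a, w₀ ≤ w a ∧ w a ≤ W) :
    WellConditioned (c * w₀ ^ 2) (B * W ^ 2) (Z * Matrix.diagonal w) where
  pos := mul_pos h.pos (pow_pos hw₀ 2)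
  mul_sum_sq_le v := by
    rw [← Matrix.mulVec_mulVec]
    refine le_trans ?_ (h.mul_sum_sq_le _)
    simp only [Matrix.mulVec_diagonal, mul_pow, mul_assoc, Finset.mul_sum]
    have := h.pos.le
    gcongr with a
    exact (hw a).1
  row_le k := by
    simp only [Matrix.mul_diagonal, mul_pow]
    calc ∑ a, Z k a ^ 2 * w a ^ 2 ≤ ∑ a, Z k a ^ 2 * W ^ 2 := by
          gcongr with a
          · exact hw₀.le.trans (hw a).1
          · exact (hw a).2
      _ ≤ B * W ^ 2 := by
          rw [← Finset.sum_mul]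
          gcongr
          exact h.row_le k

lemma isUnit_det_gram (h : WellConditioned c B Z) : IsUnit (Zᵀ * Z).det := by
  rw [isUnit_iff_ne_zero]
  intro hdet
  obtain ⟨v, hv, hker⟩ := Matrix.exists_mulVec_eq_zero_iff.2 hdet
  have hZv : Z *ᵥ v = 0 := by
    rw [← dotProduct_self_eq_zero, Matrix.dotProduct_mulVec, ← Matrix.mulVec_transpose,
      Matrix.mulVec_mulVec, hker, zero_dotProduct]
  have hsum : c * ∑ a, v a ^ 2 ≤ 0 := by simpa [hZv] using h.mul_sum_sq_le v
  refine hv (dotProduct_self_eq_zero.1 (le_antisymm ?_ ?_))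
  · simpa [dotProduct, sq] using nonpos_of_mul_nonpos_right hsum h.pos
  · exact Finset.sum_nonneg fun a _ => mul_self_nonneg _

end WellConditioned

variable [DecidableEq δ]

lemma isUnit_det_diagonal {υ : δ → ℝ} (hυ : ∀ a, υ a ≠ 0) : IsUnit (Matrix.diagonal υ).det := by
  rw [Matrix.det_diagonal, isUnit_iff_ne_zero, Finset.prod_ne_zero_iff]
  exact fun a _ => hυ a

lemma inv_diagonal_of_ne_zero {υ : δ → ℝ} (hυ : ∀ a, υ a ≠ 0) :
    (Matrix.diagonal υ)⁻¹ = Matrix.diagonal fun a => (υ a)⁻¹ :=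
  Matrix.inv_eq_right_inv <| by
    simp only [Matrix.diagonal_mul_diagonal, mul_inv_cancel₀ (hυ _), Matrix.diagonal_one]

/-- The coefficients of the least-squares regressions of the rows of `R` on the columns of `Z`
(meaningful if `Zᵀ Z` is invertible). -/
noncomputable def leastSquares (R : Matrix ι κ ℝ) (Z : Matrix κ δ ℝ) : Matrix ι δ ℝ :=
  R * Z * (Zᵀ * Z)⁻¹

lemma leastSquares_sub (R S : Matrix ι κ ℝ) (Z : Matrix κ δ ℝ) :
    leastSquares (R - S) Z = leastSquares R Z - leastSquares S Z := by
  simp only [leastSquares, Matrix.sub_mul]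

lemma leastSquares_mul_transpose {Z : Matrix κ δ ℝ} (hZ : IsUnit (Zᵀ * Z).det)
    (D : Matrix ι δ ℝ) : leastSquares (D * Zᵀ) Z = D := by
  rw [leastSquares, Matrix.mul_assoc D, Matrix.mul_nonsing_inv_cancel_right _ _ hZ]

lemma leastSquares_mul_right {Q : Matrix δ δ ℝ} (hQ : IsUnit Q.det) (R : Matrix ι κ ℝ)
    (Z : Matrix κ δ ℝ) : leastSquares R (Z * Q) = leastSquares R Z * Qᵀ⁻¹ := by
  have hgram : (Z * Q)ᵀ * (Z * Q) = Qᵀ * (Zᵀ * Z) * Q := by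
    simp only [Matrix.transpose_mul, Matrix.mul_assoc]
  rw [leastSquares, leastSquares, hgram, Matrix.mul_inv_rev, Matrix.mul_inv_rev,
    ← Matrix.mul_assoc R, ← Matrix.mul_assoc, Matrix.mul_nonsing_inv_cancel_right _ _ hQ,
    ← Matrix.mul_assoc]

lemma sum_sq_mulVec_leastSquares_le {Z : Matrix κ δ ℝ} (hZ : IsUnit (Zᵀ * Z).det)
    (R : Matrix ι κ ℝ) (l : ι) : ∑ k, (Z *ᵥ leastSquares R Z l) k ^ 2 ≤ ∑ k, R l k ^ 2 := by
  set β := leastSquares R Z l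
  have hβ : β ᵥ* (Zᵀ * Z) = R l ᵥ* Z :=
    congrFun (Matrix.nonsing_inv_mul_cancel_right _ (R * Z) hZ) l
  have hnormal : ∑ k, (Z *ᵥ β) k ^ 2 = ∑ k, R l k * (Z *ᵥ β) k := by
    change _ = R l ⬝ᵥ (Z *ᵥ β)
    rw [Matrix.dotProduct_mulVec, ← hβ, ← Matrix.dotProduct_mulVec, ← Matrix.mulVec_mulVec,
      Matrix.dotProduct_mulVec, Matrix.vecMul_transpose]
    simp only [dotProduct, sq]
  have hyoung : ∑ k, R l k * (Z *ᵥ β) k ≤ ∑ k, (R l k ^ 2 + (Z *ᵥ β) k ^ 2) / 2 :=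
    Finset.sum_le_sum fun k _ => by linarith [two_mul_le_add_sq (R l k) ((Z *ᵥ β) k)]
  rw [← Finset.sum_div, Finset.sum_add_distrib] at hyoung
  linarith

lemma sum_sq_leastSquares_le {Z : Matrix κ δ ℝ} {R : Matrix ι κ ℝ}
    (hZ : WellConditioned c B Z) {l : ι} (hR : ∀ k, |R l k| ≤ b) :
    ∑ a, leastSquares R Z l a ^ 2 ≤ b ^ 2 / c := by
  rw [le_div_iff₀' hZ.pos]
  calc c * ∑ a, leastSquares R Z l a ^ 2
      ≤ (Fintype.card κ : ℝ)⁻¹ * ∑ k, (Z *ᵥ leastSquares R Z l) k ^ 2 := hZ.mul_sum_sq_le _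
    _ ≤ (Fintype.card κ : ℝ)⁻¹ * (Fintype.card κ * b ^ 2) := by
        gcongr
        exact (sum_sq_mulVec_leastSquares_le hZ.isUnit_det_gram R l).trans
          (sum_sq_le_card_mul_sq hR)
    _ ≤ b ^ 2 := by
        rw [← mul_assoc]
        exact mul_le_of_le_one_left (sq_nonneg b) inv_mul_le_one

lemma abs_sub_leastSquares_mul_transpose_le {Z : Matrix κ δ ℝ} {R : Matrix ι κ ℝ}
    (hZ : WellConditioned c B Z) {l : ι} (hR : ∀ k, |R l k| ≤ b) (k : κ) :
    |(R - leastSquares R Z * Zᵀ) l k| ≤ (1 + √(B / c)) * b := by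
  have hb : 0 ≤ b := (abs_nonneg _).trans (hR k)
  have hc := hZ.pos
  have : 0 ≤ B := (Finset.sum_nonneg fun a _ => sq_nonneg (Z k a)).trans (hZ.row_le k)
  have hfit : |(leastSquares R Z * Zᵀ) l k| ≤ √(B / c) * b := by
    refine abs_le_of_sq_le_sq ?_ (by positivity)
    calc (leastSquares R Z * Zᵀ) l k ^ 2
      _ ≤ (∑ a, leastSquares R Z l a ^ 2) * ∑ a, Z k a ^ 2 := Finset.sum_mul_sq_le_sq_mul_sq _ _ _
      _ ≤ b ^ 2 / c * B := by
          gcongr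
          exacts [sum_sq_leastSquares_le hZ hR, hZ.row_le k]
      _ = (√(B / c) * b) ^ 2 := by
          rw [mul_pow, Real.sq_sqrt (by positivity)]
          ring
  calc |(R - leastSquares R Z * Zᵀ) l k| ≤ |R l k| + |(leastSquares R Z * Zᵀ) l k| := abs_sub _ _
    _ ≤ b + √(B / c) * b := add_le_add (hR k) hfit
    _ = (1 + √(B / c)) * b := by ring

variable {Z : Matrix κ δ ℝ} {Q : Matrix δ δ ℝ} {H : Matrix ι κ ℝ} {D : Matrix ι δ ℝ} {l : ι}

lemma abs_sub_leastSquares_mul_mul_transpose_le (hZ : WellConditioned c B Z) (hQ : IsUnit Q.det)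
    (hR : ∀ k, |(H - D * (Z * Q)ᵀ) l k| ≤ b) (k : κ) :
    |(H - leastSquares H (Z * Q) * (Z * Q)ᵀ) l k| ≤ (1 + √(B / c)) * b := by
  have hres : H - leastSquares H (Z * Q) * (Z * Q)ᵀ =
      (H - D * (Z * Q)ᵀ) - leastSquares (H - D * (Z * Q)ᵀ) Z * Zᵀ := by
    rw [leastSquares_sub, leastSquares_mul_right hQ, Matrix.transpose_mul, ← Matrix.mul_assoc,
      Matrix.nonsing_inv_mul_cancel_right _ _ (by rwa [Matrix.det_transpose]), ← Matrix.mul_assoc,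
      leastSquares_mul_transpose hZ.isUnit_det_gram, Matrix.sub_mul]
    abel
  rw [hres]
  exact abs_sub_leastSquares_mul_transpose_le hZ hR k

lemma leastSquares_mul_sub (hZ : WellConditioned c B Z) (hQ : IsUnit Q.det) (H : Matrix ι κ ℝ)
    (D : Matrix ι δ ℝ) :
    leastSquares H (Z * Q) - D = leastSquares (H - D * (Z * Q)ᵀ) Z * Qᵀ⁻¹ := by
  rw [leastSquares_sub, Matrix.sub_mul, leastSquares_mul_right hQ, Matrix.transpose_mul,
    ← Matrix.mul_assoc, leastSquares_mul_transpose hZ.isUnit_det_gram,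
    Matrix.mul_nonsing_inv_cancel_right _ _ (by rwa [Matrix.det_transpose])]

lemma sum_sq_leastSquares_mul_diagonal_sub_le (hZ : WellConditioned c B Z) {υ : δ → ℝ} {υ₀ : ℝ}
    (hυ₀ : 0 < υ₀) (hυ : ∀ a, υ₀ ≤ υ a)
    (hR : ∀ k, |(H - D * (Z * Matrix.diagonal υ)ᵀ) l k| ≤ b) :
    ∑ a, (leastSquares H (Z * Matrix.diagonal υ) - D) l a ^ 2 ≤ b ^ 2 / c / υ₀ ^ 2 := by
  have hpos (a : δ) : 0 < υ a := hυ₀.trans_le (hυ a)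
  have hne (a : δ) : υ a ≠ 0 := (hpos a).ne'
  rw [leastSquares_mul_sub hZ (isUnit_det_diagonal hne), Matrix.diagonal_transpose,
    inv_diagonal_of_ne_zero hne, le_div_iff₀ (by positivity), Finset.sum_mul]
  refine le_trans (Finset.sum_le_sum fun a _ => ?_) (sum_sq_leastSquares_le hZ hR)
  rw [Matrix.mul_diagonal, mul_pow, mul_assoc]
  refine mul_le_of_le_one_right (sq_nonneg _) ?_
  rw [inv_pow, inv_mul_le_one₀ (pow_pos (hpos a) 2)]
  gcongr
  exact hυ a

lemma wellConditioned_leastSquares [Fintype ι] [Nonempty δ] {υ : δ → ℝ} {υ₀ c' B' : ℝ}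
    (hZ : WellConditioned c B Z) (hυ₀ : 0 < υ₀) (hυ : ∀ a, υ₀ ≤ υ a)
    (hD : WellConditioned c' B' D) (hR : ∀ l k, |(H - D * (Z * Matrix.diagonal υ)ᵀ) l k| ≤ b)
    (hb : b ^ 2 / c / υ₀ ^ 2 ≤ c' / 4) :
    WellConditioned (c' / 4) (2 * B' + c' / 2) (leastSquares H (Z * Matrix.diagonal υ)) :=
  have := hD.nonempty
  hD.of_sub fun l => (sum_sq_leastSquares_mul_diagonal_sub_le hZ hυ₀ hυ (hR l)).trans hb

end LeastSquares

lemma scaledGram_eq_smul_gram {K d : ℕ} (υ : Fin d → ℝ) (L : Matrix (Fin K) (Fin d) ℝ) :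
    FactorArray.scaledGram υ L =
      (K : ℝ)⁻¹ • ((L * (Matrix.diagonal υ)⁻¹)ᵀ * (L * (Matrix.diagonal υ)⁻¹)) := by
  rw [FactorArray.scaledGram, Matrix.transpose_mul, Matrix.transpose_nonsing_inv,
    Matrix.diagonal_transpose, Matrix.mul_assoc (_ * Lᵀ)]

lemma matMaxNorm_nonneg {ι κ : Type*} (L : Matrix ι κ ℝ) : 0 ≤ matMaxNorm L :=
  Real.iSup_nonneg fun _ => abs_nonneg _

lemma matMaxNorm_le {ι κ : Type*} {L : Matrix ι κ ℝ} {C : ℝ} (hC : 0 ≤ C)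
    (hL : ∀ l k, |L l k| ≤ C) : matMaxNorm L ≤ C :=
  Real.iSup_le (fun lk => hL lk.1 lk.2) hC

/-! ### Nearest neighbours -/

lemma monotoneOn_abs_lt_mul (x b : ℝ) : MonotoneOn (fun E => |x| < E * b) (Set.Ioi 0) := by
  intro E hE E' _ hEE' h
  have hb : 0 < b := (mul_pos_iff_of_pos_left hE).1 ((abs_nonneg x).trans_lt h)
  exact h.trans_le (mul_le_mul_of_nonneg_right hEE' hb.le)

lemma le_rpow_inv_mul_of_rpow_le {x C h ς : ℝ} (hx : 0 ≤ x) (hC : 0 ≤ C) (hh : 0 ≤ h) (hς : 0 < ς)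
    (hle : x ^ ς ≤ C * h ^ ς) : x ≤ C ^ ς⁻¹ * h := by
  calc x ≤ (C * h ^ ς) ^ ς⁻¹ := (Real.le_rpow_inv_iff_of_pos hx (by positivity) hς).2 hle
    _ = C ^ ς⁻¹ * h := by rw [Real.mul_rpow hC (by positivity), Real.rpow_rpow_inv hh hς.ne']

namespace FactorArray

variable {Ω : ℕ → Type*} [∀ n, MeasurableSpace (Ω n)] {r : ℕ} {M : FactorArray Ω r}
  {μ : ∀ n, Measure (Ω n)} {A : Set (EuclideanSpace ℝ (Fin r))} {m : ℕ} {K : ℕ → ℕ}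
  {ρ : ∀ n, M.MatchData n → Fin n → Fin n → ℝ}
  {nn : ∀ n, M.MatchData n → Fin n → Fin (K n) → Fin n} {ρ₀ ς : ℝ} {a h : ℕ → ℝ}

lemma IsNearestNeighbors.one_le (hnn : M.IsNearestNeighbors K ρ nn) {n : ℕ} (hn : 0 < n) :
    1 ≤ K n := by
  obtain ⟨k, -⟩ := hnn.self_mem n (fun _ _ => 0) ⟨0, hn⟩
  exact k.pos

lemma IsNearestNeighbors.le (hnn : M.IsNearestNeighbors K ρ nn) {n : ℕ} (hn : 0 < n) :
    K n ≤ n := by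
  simpa using Fintype.card_le_of_injective _ (hnn.injective n (fun _ _ => 0) ⟨0, hn⟩)

/-- The bounds of the indirect-matching condition, for one outcome and with the constant `E`: off
the diagonal, noise shifts the distance by `ρ₀` up to an error `E * a n`, and the noise-free
distance is of the order of `‖α_i - α_j‖ ^ ς`. -/
structure MatchingBounds (M : FactorArray Ω r) (ρ : ∀ n, M.MatchData n → Fin n → Fin n → ℝ)
    (ρ₀ ς : ℝ) (a : ℕ → ℝ) (E : ℝ) (n : ℕ) (ω : Ω n) : Prop where
  denoise : ∀ i j, i ≠ j →
    |ρ n (M.Xdag n ω) i j - ρ n (M.Hdag n ω) i j - ρ₀| ≤ E * a n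
  upper : ∀ i j, i ≠ j → ρ n (M.Hdag n ω) i j ≤ E * ‖M.α n i ω - M.α n j ω‖ ^ ς
  lower : ∀ i j, i ≠ j → ‖M.α n i ω - M.α n j ω‖ ^ ς ≤ E * ρ n (M.Hdag n ω) i j

lemma MatchingBounds.of_iSup_lt {E : ℝ} (hE : 0 < E) {n : ℕ} {ω : Ω n}
    (hα : ∀ i j, i ≠ j → M.α n i ω ≠ M.α n j ω)
    (hdenoise : abs (⨆ ij : {ij : Fin n × Fin n // ij.1 ≠ ij.2},
      |ρ n (M.Xdag n ω) ij.1.1 ij.1.2 - ρ n (M.Hdag n ω) ij.1.1 ij.1.2 - ρ₀|) < E * a n)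
    (hupper : |⨆ ij : {ij : Fin n × Fin n // M.α n ij.1 ω ≠ M.α n ij.2 ω},
      ρ n (M.Hdag n ω) ij.1.1 ij.1.2 / ‖M.α n ij.1.1 ω - M.α n ij.1.2 ω‖ ^ ς| < E * 1)
    (hlower : |(1 : ℝ)| < E * ⨅ ij : {ij : Fin n × Fin n // M.α n ij.1 ω ≠ M.α n ij.2 ω},
      ρ n (M.Hdag n ω) ij.1.1 ij.1.2 / ‖M.α n ij.1.1 ω - M.α n ij.1.2 ω‖ ^ ς) :
    M.MatchingBounds ρ ρ₀ ς a E n ω := by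
  have hpos {i j : Fin n} (hij : i ≠ j) : 0 < ‖M.α n i ω - M.α n j ω‖ ^ ς :=
    Real.rpow_pos_of_pos (norm_pos_iff.2 (sub_ne_zero.2 (hα i j hij))) _
  constructor <;> intro i j hij
  · exact (le_ciSup (Set.finite_range _).bddAbove
      (⟨(i, j), hij⟩ : {ij : Fin n × Fin n // ij.1 ≠ ij.2})).trans
        ((le_abs_self _).trans hdenoise.le)
  · rw [← div_le_iff₀ (hpos hij), ← mul_one E]
    exact (le_ciSup (Set.finite_range _).bddAbove
      (⟨(i, j), hα i j hij⟩ : {ij : Fin n × Fin n // M.α n ij.1 ω ≠ M.α n ij.2 ω})).trans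
        ((le_abs_self _).trans hupper.le)
  · rw [← one_le_div (hpos hij), mul_div_assoc, ← abs_one]
    exact hlower.le.trans (mul_le_mul_of_nonneg_left (ciInf_le (Set.finite_range _).bddBelow
      (⟨(i, j), hα i j hij⟩ : {ij : Fin n × Fin n // M.α n ij.1 ω ≠ M.α n ij.2 ω})) hE.le)

lemma IndirectMatching.tightEvents_matchingBounds (hmatch : M.IndirectMatching μ ρ ρ₀ ς ς a)
    (hα : ∀ n, ∀ᵐ ω ∂μ n, ∀ i j, i ≠ j → M.α n i ω ≠ M.α n j ω) :
    TightEvents μ (M.MatchingBounds ρ ρ₀ ς a) := by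
  have hbounds := (hmatch.denoise.tightEvents.and hmatch.upper.tightEvents
    (fun _ _ => monotoneOn_abs_lt_mul _ _) (fun _ _ => monotoneOn_abs_lt_mul _ _)).and
    hmatch.lower.tightEvents
    (fun _ _ _ hE _ hE' hle hbd =>
      ⟨monotoneOn_abs_lt_mul _ _ hE hE' hle hbd.1, monotoneOn_abs_lt_mul _ _ hE hE' hle hbd.2⟩)
    (fun _ _ => monotoneOn_abs_lt_mul _ _)
  refine hbounds.of_wpa1_imp fun E hE => ⟨E, hE, .of_eventually_ae (.of_forall fun n => ?_)⟩
  filter_upwards [hα n] with ω hω ⟨⟨hdenoise, hupper⟩, hlower⟩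
  exact .of_iSup_lt hE hω hdenoise hupper hlower

lemma MatchingBounds.norm_nbr_sub_le (hnn : M.IsNearestNeighbors K ρ nn) (hς : 0 < ς)
    {E D s : ℝ} (hE : 0 < E) (hD : 0 ≤ D) (hs : 0 ≤ s) {n : ℕ} {ω : Ω n}
    (hω : M.MatchingBounds ρ ρ₀ ς a E n ω) (ha : a n ≤ s ^ ς) {i : Fin n}
    (hcount : K n < countIn (M.α n) (Metric.closedBall (M.α n i ω) (D * s)) ω) (k : Fin (K n)) :
    ‖M.α n (M.nbr nn n i k ω) ω - M.α n i ω‖ ≤ (E * (E * D ^ ς + 2 * E)) ^ ς⁻¹ * s := by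
  obtain hki | hki := eq_or_ne (M.nbr nn n i k ω) i
  · rw [hki, sub_self, norm_zero]
    positivity
  have hcard : (Set.range (nn n (M.Xdag n ω) i)).ncard ≤ K n := by
    simpa using Set.ncard_image_le (f := nn n (M.Xdag n ω) i) Set.finite_univ
  obtain ⟨j, hj, hjball⟩ := exists_notMem_of_ncard_lt_countIn (hcard.trans_lt hcount)
  have hij : i ≠ j := by
    rintro rfl
    exact hj (hnn.self_mem n _ i)
  have hnearest : ρ n (M.Xdag n ω) i (M.nbr nn n i k ω) ≤ ρ n (M.Xdag n ω) i j :=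
    hnn.nearest n _ i k j hki hj
  have hnorm : ‖M.α n i ω - M.α n j ω‖ ≤ D * s := by
    rwa [norm_sub_rev, ← dist_eq_norm]
  have hH : ρ n (M.Hdag n ω) i (M.nbr nn n i k ω) ≤ ρ n (M.Hdag n ω) i j + 2 * (E * a n) := by
    linarith [abs_le.1 (hω.denoise i j hij), abs_le.1 (hω.denoise i _ hki.symm)]
  refine le_rpow_inv_mul_of_rpow_le (norm_nonneg _) (by positivity) hs hς ?_
  rw [norm_sub_rev]
  calc ‖M.α n i ω - M.α n (M.nbr nn n i k ω) ω‖ ^ ς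
      ≤ E * ρ n (M.Hdag n ω) i (M.nbr nn n i k ω) := hω.lower i _ hki.symm
    _ ≤ E * (E * ‖M.α n i ω - M.α n j ω‖ ^ ς + 2 * (E * a n)) := by
      gcongr
      exact hH.trans (by gcongr; exact hω.upper i j hij)
    _ ≤ E * (E * (D * s) ^ ς + 2 * (E * s ^ ς)) := by gcongr
    _ = E * (E * D ^ ς + 2 * E) * s ^ ς := by rw [Real.mul_rpow hD hs]; ring

lemma IsNearestNeighbors.tightEvents_norm_nbr_sub_le [∀ n, IsProbabilityMeasure (μ n)]
    (hr : 1 ≤ r) (hreg : M.LatentRegularity μ A m) (hnn : M.IsNearestNeighbors K ρ nn)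
    (hmatch : M.IndirectMatching μ ρ ρ₀ ς ς a)
    {ν : Measure (EuclideanSpace ℝ (Fin r))} [IsProbabilityMeasure ν]
    (hsamp : LocalSampling μ M.α A ν K h) (ha : ∀ᶠ n in atTop, a n ≤ h n ^ ς) :
    TightEvents μ fun E n ω => ∀ i k, ‖M.α n (M.nbr nn n i k ω) ω - M.α n i ω‖ ≤ E * h n := by
  obtain ⟨D, hD, hcount⟩ := hsamp.wpa1_lt_countIn hr
  have hς := hmatch.lo_pos
  refine (hmatch.tightEvents_matchingBounds (hreg.ae_ne hr)).of_wpa1_imp fun E hE =>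
    ⟨(E * (E * D ^ ς + 2 * E)) ^ ς⁻¹, by positivity, hcount.mono ?_⟩
  filter_upwards [ha, eventually_gt_atTop 0] with n han hn
  filter_upwards [hreg.ae_mem n] with ω hα hball hω i
  exact hω.norm_nbr_sub_le hnn hς hE hD.le (hsamp.pos n hn).le han (hball _ (hα i))

end FactorArray

/-! ### Scaled monomial loadings -/

section MonomialLoadings

variable {r N : ℕ}

lemma GradedEnum.deg_le (e : GradedEnum r N) (b : Fin ((N + r).choose r)) : e.deg b ≤ N :=
  (e.toEquiv b).2

lemma monomialVec_smul (e : GradedEnum r N) (t : ℝ) (y : EuclideanSpace ℝ (Fin r))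
    (b : Fin ((N + r).choose r)) : monomialVec e (t • y) b = t ^ e.deg b * monomialVec e y b := by
  simp only [monomialVec, GradedEnum.deg, PiLp.smul_apply, smul_eq_mul, mul_pow,
    Finset.prod_mul_distrib, Finset.prod_pow_eq_pow_sum]

lemma abs_monomialVec_le_max_pow (e : GradedEnum r N) {C : ℝ} {y : EuclideanSpace ℝ (Fin r)}
    (hy : ‖y‖ ≤ C) (b : Fin ((N + r).choose r)) : |monomialVec e y b| ≤ max 1 C ^ N :=
  calc |monomialVec e y b| ≤ ‖y‖ ^ e.deg b := abs_monomialVec_le e y b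
    _ ≤ max 1 C ^ e.deg b := by gcongr; exact hy.trans (le_max_right _ _)
    _ ≤ max 1 C ^ N := pow_le_pow_right₀ (le_max_left _ _) (e.deg_le b)

lemma wellConditioned_monomialVec {κ : Type*} [Fintype κ] [Nonempty κ] (e : GradedEnum r N)
    {ε C : ℝ} (hε : 0 < ε) {z : κ → EuclideanSpace ℝ (Fin r)} (hz : ∀ k, ‖z k‖ ≤ C)
    (hsub : ∀ v, ∑ b, v b ^ 2 = 1 →
      2 * {k | |monomialVec e (z k) ⬝ᵥ v| ≤ ε}.ncard ≤ Fintype.card κ) :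
    WellConditioned (ε ^ 2 / 2) ((N + r).choose r * (max 1 C ^ N) ^ 2)
      (Matrix.of fun k => monomialVec e (z k)) where
  pos := by positivity
  mul_sum_sq_le := mul_sum_sq_le_mean_sq_mulVec hε.le hsub
  row_le k := by
    simpa using sum_sq_le_card_mul_sq fun b => abs_monomialVec_le_max_pow e (hz k) b

end MonomialLoadings

namespace FactorArray

variable {Ω : ℕ → Type*} [∀ n, MeasurableSpace (Ω n)] {r : ℕ} {M : FactorArray Ω r}
  {A : Set (EuclideanSpace ℝ (Fin r))} {m : ℕ} {K : ℕ → ℕ}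
  {nn : ∀ n, M.MatchData n → Fin n → Fin (K n) → Fin n}

lemma monomialLoadings_mul_inv_diagonal {h : ℝ} (hh : h ≠ 0) (e : GradedEnum r (m - 1)) (n : ℕ)
    (i : Fin n) (ω : Ω n) :
    M.monomialLoadings nn e n i ω * (Matrix.diagonal fun b => h ^ e.deg b)⁻¹ =
      Matrix.of fun k =>
        monomialVec e (h⁻¹ • (M.α n (M.nbr nn n i k ω) ω - M.α n i ω)) := by
  ext k b
  rw [inv_diagonal_of_ne_zero fun b => pow_ne_zero _ hh, Matrix.mul_diagonal,
    monomialLoadings_apply, Matrix.of_apply, monomialVec_smul, inv_pow, mul_comm]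

lemma wellConditioned_monomialLoadings (hinj : ∀ n V i, Function.Injective (nn n V i))
    (e : GradedEnum r (m - 1)) {h ε C : ℝ} (hh : 0 < h) (hε : 0 < ε) {n : ℕ} (hK : 0 < K n)
    {i : Fin n} {ω : Ω n}
    (hnear : ∀ k, ‖M.α n (M.nbr nn n i k ω) ω - M.α n i ω‖ ≤ C * h)
    (hsub : ∀ v, ∑ b, v b ^ 2 = 1 →
      2 * countIn (M.α n) {y | ‖h⁻¹ • (y - M.α n i ω)‖ ≤ C ∧
        |monomialVec e (h⁻¹ • (y - M.α n i ω)) ⬝ᵥ v| ≤ ε} ω < K n) :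
    WellConditioned (ε ^ 2 / 2) ((m - 1 + r).choose r * (max 1 C ^ (m - 1)) ^ 2)
      (M.monomialLoadings nn e n i ω * (Matrix.diagonal fun b => h ^ e.deg b)⁻¹) := by
  have : Nonempty (Fin (K n)) := ⟨⟨0, hK⟩⟩
  have hscaled (k : Fin (K n)) :
      ‖h⁻¹ • (M.α n (M.nbr nn n i k ω) ω - M.α n i ω)‖ ≤ C := by
    rw [norm_smul, norm_inv, Real.norm_of_nonneg hh.le, inv_mul_le_iff₀ hh, mul_comm]
    exact hnear k
  rw [monomialLoadings_mul_inv_diagonal hh.ne']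
  refine wellConditioned_monomialVec e hε hscaled fun v hv => ?_
  rw [Fintype.card_fin]
  refine (Nat.mul_le_mul_left 2 ?_).trans (hsub v hv).le
  refine le_trans (Set.ncard_le_ncard fun k hk => ?_)
    (ncard_comp_mem_le_countIn (hinj n (M.Xdag n ω) i))
  exact ⟨hscaled k, hk⟩

end FactorArray

/-! ### Local fits -/

namespace FactorArray

variable {Ω : ℕ → Type*} [∀ n, MeasurableSpace (Ω n)] {r : ℕ} {M : FactorArray Ω r}
  {μ : ∀ n, Measure (Ω n)} {A : Set (EuclideanSpace ℝ (Fin r))} {m : ℕ} {K : ℕ → ℕ}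
  {nn : ∀ n, M.MatchData n → Fin n → Fin (K n) → Fin n} {e : GradedEnum r (m - 1)}

/-- The matrix with rows `𝒟η_l(α_i)'`, `l ∈ R‡`: up to positive factors of its columns, this is
the limit of `F_{⟨i⟩}`. -/
noncomputable def derivMatrix (M : FactorArray Ω r) (A : Set (EuclideanSpace ℝ (Fin r)))
    (e : GradedEnum r (m - 1)) (n : ℕ) (i : Fin n) (ω : Ω n) :
    Matrix {l // l ∈ M.Rddag n} (Fin ((m - 1 + r).choose r)) ℝ :=
  Matrix.of fun l a => partialDeriv A (e.toEquiv a) (M.η n l ω) (M.α n i ω)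

lemma derivGram_eq_smul_gram (n : ℕ) (i : Fin n) (ω : Ω n) :
    M.derivGram A e n i ω =
      ((M.Rddag n).card : ℝ)⁻¹ • ((M.derivMatrix A e n i ω)ᵀ * M.derivMatrix A e n i ω) := by
  rw [derivGram]
  congr 1
  ext a b
  rw [Matrix.sum_apply, Matrix.mul_apply, ← Finset.sum_coe_sort (M.Rddag n)]
  rfl

lemma wellConditioned_derivMatrix {c B : ℝ} {n : ℕ} {i : Fin n} {ω : Ω n} (hc : 0 < c)
    (hgram : c ≤ sMin (M.derivGram A e n i ω)) (hB : ∀ l a, |M.derivMatrix A e n i ω l a| ≤ B) :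
    WellConditioned c ((m - 1 + r).choose r * B ^ 2) (M.derivMatrix A e n i ω) where
  pos := hc
  mul_sum_sq_le v := by
    rw [derivGram_eq_smul_gram] at hgram
    rw [Fintype.card_coe]
    refine le_trans ?_ (sMin_smul_gram_mul_le (by positivity) v)
    gcongr
  row_le l := by simpa using sum_sq_le_card_mul_sq (hB l)

/-- With constants controlled by `E`, the unit `i` satisfies the bounds which the local
approximation condition requires in probability, the conditional Gram matrix being invertible. -/
structure LocalFit (M : FactorArray Ω r) (μ : ∀ n, Measure (Ω n))
    (A : Set (EuclideanSpace ℝ (Fin r))) (nn : ∀ n, M.MatchData n → Fin n → Fin (K n) → Fin n)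
    (e : GradedEnum r (m - 1)) (h E : ℝ) (n : ℕ) (i : Fin n) (ω : Ω n) : Prop where
  one_le : 1 ≤ E
  invertible : IsUnit (condExpMat (μ n) (M.sigmaMatch A n)
    (fun ω' => (M.monomialLoadings nn e n i ω')ᵀ * M.monomialLoadings nn e n i ω') ω).det
  loadings : WellConditioned E⁻¹ E
    (M.monomialLoadings nn e n i ω * (Matrix.diagonal fun b => h ^ e.deg b)⁻¹)
  bias : ∀ l k, |M.Xiloc μ A nn (M.monomialLoadings nn e) n i ω l k| ≤ E * h ^ m
  factors : WellConditioned E⁻¹ E (M.Floc μ A nn (M.monomialLoadings nn e) n i ω)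

lemma Floc_eq_leastSquares {n : ℕ} {i : Fin n} {ω : Ω n}
    (hgram : condExpMat (μ n) (M.sigmaMatch A n)
      (fun ω' => (M.monomialLoadings nn e n i ω')ᵀ * M.monomialLoadings nn e n i ω') ω =
        (M.monomialLoadings nn e n i ω)ᵀ * M.monomialLoadings nn e n i ω)
    (hcross : condExpMat (μ n) (M.sigmaMatch A n)
      (fun ω' => M.Hloc nn n i ω' * M.monomialLoadings nn e n i ω') ω =
        M.Hloc nn n i ω * M.monomialLoadings nn e n i ω) :
    M.Floc μ A nn (M.monomialLoadings nn e) n i ω =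
      leastSquares (M.Hloc nn n i ω) (M.monomialLoadings nn e n i ω) := by
  rw [Floc, hgram, hcross, leastSquares]

lemma localFit_of_expansion {n : ℕ} {i : Fin n} {ω : Ω n}
    {D : Matrix {l // l ∈ M.Rddag n} (Fin ((m - 1 + r).choose r)) ℝ} {B B' c c' T h E : ℝ}
    (hgram : condExpMat (μ n) (M.sigmaMatch A n)
      (fun ω' => (M.monomialLoadings nn e n i ω')ᵀ * M.monomialLoadings nn e n i ω') ω =
        (M.monomialLoadings nn e n i ω)ᵀ * M.monomialLoadings nn e n i ω)
    (hcross : condExpMat (μ n) (M.sigmaMatch A n)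
      (fun ω' => M.Hloc nn n i ω' * M.monomialLoadings nn e n i ω') ω =
        M.Hloc nn n i ω * M.monomialLoadings nn e n i ω)
    (hm : 1 ≤ m) (hh : 0 < h) (hh_one : h ≤ 1) (hh_small : T ^ 2 / c * h ^ 2 ≤ c' / 4)
    (hZ : WellConditioned c B
      (M.monomialLoadings nn e n i ω * (Matrix.diagonal fun b => h ^ e.deg b)⁻¹))
    (hD : WellConditioned c' B' D)
    (hR : ∀ l k, |(M.Hloc nn n i ω - D * (M.monomialLoadings nn e n i ω)ᵀ) l k| ≤ T * h ^ m)
    (hE : ∀ x ∈ ({1, c⁻¹, B, (1 + √(B / c)) * T, (c' / 4)⁻¹, 2 * B' + c' / 2} : Finset ℝ),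
      x ≤ E) : M.LocalFit μ A nn e h E n i ω := by
  simp only [Finset.mem_insert, Finset.mem_singleton, forall_eq_or_imp, forall_eq] at hE
  obtain ⟨hE_one, hE_c, hE_B, hE_T, hE_c', hE_B'⟩ := hE
  have hE_pos : 0 < E := one_pos.trans_le hE_one
  have : Nonempty (Fin ((m - 1 + r).choose r)) :=
    Fin.pos_iff_nonempty.1 (Nat.choose_pos (Nat.le_add_left r (m - 1)))
  have hF := Floc_eq_leastSquares hgram hcross
  set Λ := M.monomialLoadings nn e n i ω
  set υ := fun b => h ^ e.deg b
  have hυ (b) : h ^ (m - 1) ≤ υ b := pow_le_pow_of_le_one hh.le hh_one (e.deg_le b)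
  have hυ_det := isUnit_det_diagonal (υ := υ) fun b => pow_ne_zero _ hh.ne'
  have hΛ : Λ * (Matrix.diagonal υ)⁻¹ * Matrix.diagonal υ = Λ :=
    Matrix.nonsing_inv_mul_cancel_right _ Λ hυ_det
  rw [← hΛ] at hR
  have hb : (T * h ^ m) ^ 2 / c / (h ^ (m - 1)) ^ 2 ≤ c' / 4 := by
    convert hh_small using 1
    rw [← mul_pow_sub_one (Nat.one_le_iff_ne_zero.1 hm) h]
    field_simp
  refine ⟨hE_one, ?_, hZ.mono (inv_pos.2 hE_pos) (inv_le_of_inv_le₀ hZ.pos hE_c) hE_B,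
    fun l k => ?_, ?_⟩
  · rw [hgram, ← hΛ]
    exact (hZ.mul_diagonal (pow_pos hh (m - 1)) fun b =>
      ⟨hυ b, pow_le_one₀ hh.le hh_one⟩).isUnit_det_gram
  · rw [Xiloc, hF]
    change |(M.Hloc nn n i ω - leastSquares (M.Hloc nn n i ω) Λ * Λᵀ) l k| ≤ _
    rw [← hΛ]
    refine (abs_sub_leastSquares_mul_mul_transpose_le hZ hυ_det (hR l) k).trans ?_
    rw [← mul_assoc]
    gcongr
  · rw [hF, ← hΛ]
    exact (wellConditioned_leastSquares hZ (pow_pos hh _) hυ hD hR hb).mono (inv_pos.2 hE_pos)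
      (inv_le_of_inv_le₀ (div_pos hD.pos four_pos) hE_c') hE_B'

end FactorArray

/-! ### Bandwidth and sampling -/

section Bandwidth

variable {K : ℕ → ℕ} {ς : ℝ} {r : ℕ}

lemma bandwidth_eq_rpow_inv (hς : ς ≠ 0) (n : ℕ) :
    bandwidth K ς ς r n = ((K n : ℝ) / n) ^ (r : ℝ)⁻¹ := by
  rw [bandwidth, div_mul_eq_div_div, div_self hς, one_div]

lemma bandwidth_pow (hς : ς ≠ 0) (hr : r ≠ 0) (n : ℕ) : bandwidth K ς ς r n ^ r = K n / n := by
  rw [bandwidth_eq_rpow_inv hς, Real.rpow_inv_natCast_pow (by positivity) hr]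

lemma tendsto_bandwidth (hς : ς ≠ 0) (hr : r ≠ 0)
    (hK : Tendsto (fun n => (K n : ℝ) / n) atTop (𝓝 0)) :
    Tendsto (bandwidth K ς ς r) atTop (𝓝 0) := by
  have hr' : (0 : ℝ) < (r : ℝ)⁻¹ := by positivity
  have hpow := hK.rpow_const (p := (r : ℝ)⁻¹) (Or.inr hr'.le)
  rw [Real.zero_rpow hr'.ne'] at hpow
  exact hpow.congr fun n => (bandwidth_eq_rpow_inv hς n).symm

end Bandwidth

namespace FactorArray

variable {Ω : ℕ → Type*} [∀ n, MeasurableSpace (Ω n)] {r : ℕ} {M : FactorArray Ω r}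
  {A : Set (EuclideanSpace ℝ (Fin r))} {μ : ∀ n, Measure (Ω n)} {m : ℕ} {K : ℕ → ℕ}
  {ρ : ∀ n, M.MatchData n → Fin n → Fin n → ℝ}
  {nn : ∀ n, M.MatchData n → Fin n → Fin (K n) → Fin n} {e : GradedEnum r (m - 1)} {ς : ℝ}

lemma IsNearestNeighbors.bandwidth_pos (hnn : M.IsNearestNeighbors K ρ nn) {n : ℕ} (hn : 0 < n) :
    0 < bandwidth K ς ς r n := by
  have := hnn.one_le hn
  exact Real.rpow_pos_of_pos (by positivity) _

lemma IsNearestNeighbors.bandwidth_le_one (hnn : M.IsNearestNeighbors K ρ nn) (hς : ς ≠ 0)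
    {n : ℕ} (hn : 0 < n) : bandwidth K ς ς r n ≤ 1 := by
  rw [bandwidth_eq_rpow_inv hς]
  refine Real.rpow_le_one (by positivity) ?_ (by positivity)
  rw [div_le_one (by exact_mod_cast hn)]
  exact_mod_cast hnn.le hn

lemma IndirectMatching.eventually_le_rpow {ρ₀ ςup : ℝ} {a h : ℕ → ℝ}
    (hmatch : M.IndirectMatching μ ρ ρ₀ ς ςup a) (hh : ∀ᶠ n in atTop, 0 < h n)
    (ha : (fun n => a n ^ (1 / ς)) =o[atTop] h) : ∀ᶠ n in atTop, a n ≤ h n ^ ς := by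
  filter_upwards [ha.bound one_pos, hmatch.a_pos, hh] with n hn han hhn
  rw [one_mul, Real.norm_of_nonneg (by positivity), Real.norm_of_nonneg hhn.le, one_div] at hn
  calc a n = (a n ^ ς⁻¹) ^ ς := (Real.rpow_inv_rpow han.le hmatch.lo_pos.ne').symm
    _ ≤ h n ^ ς := Real.rpow_le_rpow (by positivity) hn hmatch.lo_pos.le

lemma nonempty_Rddag_of_sMin_derivGram_pos {n : ℕ} {i : Fin n} {ω : Ω n}
    (hgram : 0 < sMin (M.derivGram A e n i ω)) : (M.Rddag n).Nonempty := by
  by_contra! hempty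
  have hd : 0 < (m - 1 + r).choose r := Nat.choose_pos (Nat.le_add_left r (m - 1))
  have : IsEmpty {l // l ∈ M.Rddag n} := Finset.isEmpty_coe_sort.2 hempty
  rw [derivGram_eq_smul_gram] at hgram
  have hle := sMin_smul_gram_mul_le (B := M.derivMatrix A e n i ω)
    (s := ((M.Rddag n).card : ℝ)⁻¹) (by positivity) 1
  rw [Finset.univ_eq_empty (α := {l // l ∈ M.Rddag n}), Finset.sum_empty, mul_zero] at hle
  refine hle.not_gt (mul_pos hgram ?_)
  simpa using hd

lemma eventually_p_pos [∀ n, IsProbabilityMeasure (μ n)] {c : ℝ} (hc : 0 < c)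
    (hgram : WPA1 μ fun n => {ω | ∀ i, c ≤ sMin (M.derivGram A e n i ω)}) :
    ∀ᶠ n in atTop, 0 < M.p n := by
  filter_upwards [hgram.eventually_nonempty, eventually_gt_atTop 0] with n ⟨ω, hω⟩ hn
  obtain ⟨l, -⟩ := nonempty_Rddag_of_sMin_derivGram_pos (hc.trans_le (hω ⟨0, hn⟩))
  exact l.pos

lemma nine_mul_log_le_of_inv_delta_le {n : ℕ} (hn : 1 < n) (hK : 0 < K n) (hp : 0 < M.p n)
    (hδ : (M.delta K n)⁻¹ ≤ 1 / 3) : 9 * Real.log n ≤ K n := by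
  have hn' : (1 : ℝ) < n := by exact_mod_cast hn
  have hlog : Real.log n ≤ Real.log (max n (M.p n) : ℕ) :=
    Real.log_le_log (by linarith) (by exact_mod_cast le_max_left _ _)
  have hmin : (0 : ℝ) < (min (K n) (M.p n) : ℕ) := by exact_mod_cast lt_min hK hp
  have hKmin : ((min (K n) (M.p n) : ℕ) : ℝ) ≤ K n := by exact_mod_cast min_le_left _ _
  have hlog_pos := (Real.log_pos hn').trans_le hlog
  rw [delta, inv_div, div_le_iff₀ (Real.sqrt_pos.2 hmin)] at hδ
  have hsq : (3 * √(Real.log (max n (M.p n) : ℕ))) ^ 2 ≤ √(min (K n) (M.p n) : ℕ) ^ 2 :=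
    pow_le_pow_left₀ (by positivity) (by linarith) 2
  rw [mul_pow, Real.sq_sqrt hlog_pos.le, Real.sq_sqrt hmin.le] at hsq
  linarith

lemma tendsto_mul_exp_of_inv_delta_div {h : ℕ → ℝ} (hh : ∀ n, 0 < n → 0 < h n ∧ h n ≤ 1)
    (hp : ∀ᶠ n in atTop, 0 < M.p n) (hK : ∀ n, 0 < n → 1 ≤ K n)
    (hδ : Tendsto (fun n => (M.delta K n)⁻¹ / h n ^ (m - 1)) atTop (𝓝 0)) :
    Tendsto (fun n : ℕ => n * Real.exp (-((K n : ℝ) / 4))) atTop (𝓝 0) := by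
  refine squeeze_zero' (.of_forall fun n => by positivity) ?_ tendsto_inv_atTop_nhds_zero_nat
  filter_upwards [hp, eventually_gt_atTop 1, hδ.eventually_lt_const (by norm_num : (0 : ℝ) < 1 / 3)]
    with n hpn hn hδn
  obtain ⟨hh_pos, hh_one⟩ := hh n (by omega)
  have hn' : (1 : ℝ) < n := by exact_mod_cast hn
  have hδ_nonneg : 0 ≤ (M.delta K n)⁻¹ :=
    inv_nonneg.2 (div_nonneg (Real.sqrt_nonneg _) (Real.sqrt_nonneg _))
  have hlog := nine_mul_log_le_of_inv_delta_le hn (hK n (by omega)) hpn <|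
    (le_div_self hδ_nonneg (pow_pos hh_pos _) (pow_le_one₀ hh_pos.le hh_one)).trans hδn.le
  have hlog_pos := Real.log_pos hn'
  calc (n : ℝ) * Real.exp (-((K n : ℝ) / 4)) ≤ n * Real.exp (-(2 * Real.log n)) := by
        gcongr
        linarith
    _ = (n : ℝ)⁻¹ := by
        rw [Real.exp_neg, two_mul, Real.exp_add, Real.exp_log (by linarith)]
        field_simp

namespace LatentRegularity

lemma exists_ae_abs_derivMatrix_le (hreg : M.LatentRegularity μ A m) (e : GradedEnum r (m - 1)) :
    ∃ B, ∀ n, ∀ᵐ ω ∂μ n, ∀ i l b, |M.derivMatrix A e n i ω l b| ≤ B := by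
  obtain ⟨B, hB⟩ := hreg.bounded
  refine ⟨B, fun n => ?_⟩
  filter_upwards [hreg.ae_mem n, ae_all_iff.2 (hB n)] with ω hα hη i l b
  exact hη l _ (hα i) _ ((e.deg_le b).trans (Nat.sub_le m 1))

variable [∀ n, IsProbabilityMeasure (μ n)] (hreg : M.LatentRegularity μ A m)
include hreg

lemma exists_ae_abs_Hloc_sub_le (hm : 1 ≤ m)
    (nn : ∀ n, M.MatchData n → Fin n → Fin (K n) → Fin n) (e : GradedEnum r (m - 1)) :
    ∃ T ≥ 0, ∀ n, ∀ᵐ ω ∂μ n, ∀ i l k, |(M.Hloc nn n i ω - M.derivMatrix A e n i ω *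
      Matrix.diagonal (taylorWeight e) * (M.monomialLoadings nn e n i ω)ᵀ) l k| ≤
        T * ‖M.α n (M.nbr nn n i k ω) ω - M.α n i ω‖ ^ m := by
  obtain ⟨B, hB⟩ := hreg.bounded
  have hint := hreg.interior_nonempty
  have hcl : A ⊆ closure (interior A) := by
    rw [hreg.convex.closure_interior_eq_closure_of_nonempty_interior hint]
    exact subset_closure
  refine ⟨r ^ m * |B|, by positivity, fun n => ?_⟩
  filter_upwards [hreg.ae_mem n, ae_all_iff.2 (hreg.smooth n), ae_all_iff.2 (hB n)]
    with ω hα hsmooth hη i l k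
  have htaylor := abs_sub_sum_taylorWeight_le hreg.convex (uniqueDiffOn_convex hreg.convex hint)
    hcl (m := m - 1) (B := |B|) (by rw [Nat.sub_add_cancel hm]; exact hsmooth l)
    (fun x hx q hq => (hη l x hx q (by omega)).trans (le_abs_self B)) e (hα i)
    (hα (M.nbr nn n i k ω))
  rw [Nat.sub_add_cancel hm] at htaylor
  convert htaylor using 2
  rw [Matrix.sub_apply, Matrix.mul_apply]
  simp only [Matrix.mul_diagonal, Matrix.transpose_apply, monomialLoadings_apply,
    mul_comm (taylorWeight e _)]
  rfl

lemma exists_localSampling (hr : r ≠ 0) (hnn : M.IsNearestNeighbors K ρ nn) (hς : ς ≠ 0)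
    (hKn : Tendsto (fun n => (K n : ℝ) / n) atTop (𝓝 0))
    (hexp : Tendsto (fun n : ℕ => (n : ℝ) * Real.exp (-((K n : ℝ) / 4))) atTop (𝓝 0)) :
    ∃ ν : Measure (EuclideanSpace ℝ (Fin r)), IsProbabilityMeasure ν ∧
      LocalSampling μ M.α A ν K (bandwidth K ς ς r) := by
  obtain ⟨f, c, C, -, hc, hf, hlaw⟩ := hreg.density
  have hA := hreg.compact.measurableSet
  have hν : IsProbabilityMeasure
      ((volume.restrict A).withDensity fun x => ENNReal.ofReal (f x)) := by
    rw [← hlaw 1 0]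
    exact Measure.isProbabilityMeasure_map (M.measurable_α 1 0).aemeasurable
  have hvol : (volume : Measure (EuclideanSpace ℝ (Fin r))) A ≠ 0 :=
    (Measure.measure_pos_of_nonempty_interior _ hreg.interior_nonempty).ne'
  have hball := exists_pow_le_measureReal_closedBall hreg.compact hreg.convex hvol hc
    (smul_restrict_le_withDensity_restrict hA fun x hx => (hf x hx).1)
  rw [finrank_euclideanSpace_fin] at hball
  obtain ⟨x, hx⟩ := hreg.nonempty
  exact ⟨_, hν,
    { measurable := M.measurable_α
      indep := hreg.indep
      law := hlaw
      le_volume := ⟨C, hc.trans_le ((hf x hx).1.trans (hf x hx).2),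
        withDensity_restrict_le_smul hA fun x hx => (hf x hx).2⟩
      closedBall_ge := hball
      one_le := fun n hn => hnn.one_le hn
      pos := fun n hn => hnn.bandwidth_pos hn
      pow_eq := fun n _ => bandwidth_pow hς hr n
      tendsto_h := tendsto_bandwidth hς hr hKn
      tendsto_exp := hexp }⟩

end LatentRegularity

end FactorArray

/-! ### Uniform local fits -/

lemma exists_taylorWeight_bounds {r N : ℕ} (e : GradedEnum r N) :
    ∃ w₀ > 0, ∃ W, ∀ a, w₀ ≤ taylorWeight e a ∧ taylorWeight e a ≤ W := by
  have : Nonempty (Fin ((N + r).choose r)) :=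
    Fin.pos_iff_nonempty.1 (Nat.choose_pos (Nat.le_add_left r N))
  obtain ⟨a₀, ha₀⟩ := Finite.exists_min (taylorWeight e)
  obtain ⟨a₁, ha₁⟩ := Finite.exists_max (taylorWeight e)
  exact ⟨_, taylorWeight_pos e a₀, _, fun a => ⟨ha₀ a, ha₁ a⟩⟩

namespace FactorArray

variable {Ω : ℕ → Type*} [∀ n, MeasurableSpace (Ω n)] {r : ℕ} {M : FactorArray Ω r}
  {A : Set (EuclideanSpace ℝ (Fin r))} {μ : ∀ n, Measure (Ω n)} {m : ℕ} {K : ℕ → ℕ}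
  {ρ : ∀ n, M.MatchData n → Fin n → Fin n → ℝ}
  {nn : ∀ n, M.MatchData n → Fin n → Fin (K n) → Fin n} {e : GradedEnum r (m - 1)}

namespace LocalFit

variable {h E : ℝ} {n : ℕ} {i : Fin n} {ω : Ω n} (hfit : M.LocalFit μ A nn e h E n i ω)
include hfit

lemma matMaxNorm_loadings_le :
    matMaxNorm (M.monomialLoadings nn e n i ω * (Matrix.diagonal fun b => h ^ e.deg b)⁻¹) ≤ E := by
  have hE : 0 ≤ E := zero_le_one.trans hfit.one_le
  refine matMaxNorm_le hE fun k b => abs_le_of_sq_le_sq ?_ hE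
  exact (hfit.loadings.sq_apply_le k b).trans (le_self_pow₀ hfit.one_le two_ne_zero)

lemma le_sMin_scaledGram :
    E⁻¹ ≤ sMin (scaledGram (fun b => h ^ e.deg b) (M.monomialLoadings nn e n i ω)) := by
  rw [scaledGram_eq_smul_gram]
  simpa only [Fintype.card_fin] using
    hfit.loadings.le_sMin (Nat.choose_pos (Nat.le_add_left r (m - 1)))

lemma sMax_scaledGram_le :
    sMax (scaledGram (fun b => h ^ e.deg b) (M.monomialLoadings nn e n i ω)) ≤ E := by
  rw [scaledGram_eq_smul_gram]
  simpa only [Fintype.card_fin] using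
    hfit.loadings.sMax_le (Nat.choose_pos (Nat.le_add_left r (m - 1)))

lemma matMaxNorm_Xiloc_le (hh : 0 ≤ h) :
    matMaxNorm (M.Xiloc μ A nn (M.monomialLoadings nn e) n i ω) ≤ E * h ^ m :=
  matMaxNorm_le (mul_nonneg (zero_le_one.trans hfit.one_le) (pow_nonneg hh m)) hfit.bias

lemma le_sMin_factors : E⁻¹ ≤ sMin (((M.Rddag n).card : ℝ)⁻¹ •
    ((M.Floc μ A nn (M.monomialLoadings nn e) n i ω)ᵀ *
      M.Floc μ A nn (M.monomialLoadings nn e) n i ω)) := by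
  simpa only [Fintype.card_coe] using
    hfit.factors.le_sMin (Nat.choose_pos (Nat.le_add_left r (m - 1)))

lemma sMax_factors_le : sMax (((M.Rddag n).card : ℝ)⁻¹ •
    ((M.Floc μ A nn (M.monomialLoadings nn e) n i ω)ᵀ *
      M.Floc μ A nn (M.monomialLoadings nn e) n i ω)) ≤ E := by
  simpa only [Fintype.card_coe] using
    hfit.factors.sMax_le (Nat.choose_pos (Nat.le_add_left r (m - 1)))

end LocalFit

variable [∀ n, IsProbabilityMeasure (μ n)]

lemma tightEvents_localFit_of_norm_nbr_sub_le (hreg : M.LatentRegularity μ A m)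
    (hnn : M.IsNearestNeighbors K ρ nn) (hm : 1 ≤ m) {c : ℝ} (hc : 0 < c)
    (hgram : WPA1 μ fun n => {ω | ∀ i, c ≤ sMin (M.derivGram A e n i ω)})
    {ν : Measure (EuclideanSpace ℝ (Fin r))} [IsProbabilityMeasure ν] {h : ℕ → ℝ}
    (hsamp : LocalSampling μ M.α A ν K h)
    (hnear : TightEvents μ fun E n ω =>
      ∀ i k, ‖M.α n (M.nbr nn n i k ω) ω - M.α n i ω‖ ≤ E * h n) :
    TightEvents μ fun E n ω => ∀ i, M.LocalFit μ A nn e (h n) E n i ω := by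
  obtain ⟨w₀, hw₀, W, hw⟩ := exists_taylorWeight_bounds e
  obtain ⟨B, hB⟩ := hreg.exists_ae_abs_derivMatrix_le e
  obtain ⟨T, hT, htaylor⟩ := hreg.exists_ae_abs_Hloc_sub_le hm nn e
  refine hnear.of_wpa1_imp fun C _ => ?_
  obtain ⟨ε, hε, hsub⟩ := hsamp.wpa1_countIn_sublevel_lt e C
  let d : ℝ := (m - 1 + r).choose r
  let Z := d * (max 1 C ^ (m - 1)) ^ 2
  let S := T * C ^ m
  obtain ⟨E, hE⟩ := Finset.exists_le {1, (ε ^ 2 / 2)⁻¹, Z, (1 + √(Z / (ε ^ 2 / 2))) * S,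
    (c * w₀ ^ 2 / 4)⁻¹, 2 * (d * B ^ 2 * W ^ 2) + c * w₀ ^ 2 / 2}
  refine ⟨E, one_pos.trans_le (hE 1 (Finset.mem_insert_self _ _)), (hsub.inter hgram).mono ?_⟩
  have hsmall : Tendsto (fun n => S ^ 2 / (ε ^ 2 / 2) * h n ^ 2) atTop (𝓝 0) := by
    simpa using (hsamp.tendsto_h.pow 2).const_mul (S ^ 2 / (ε ^ 2 / 2))
  filter_upwards [eventually_gt_atTop 0, hsamp.tendsto_h.eventually_le_const one_pos,
    hsmall.eventually_le_const (by positivity : 0 < c * w₀ ^ 2 / 4)] with n hn hh_one hh_small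
  have hh := hsamp.pos n hn
  filter_upwards [hreg.ae_mem n, hB n, htaylor n, hreg.ae_condExpMat_loadings_gram hnn.measurable
    e n, hreg.ae_condExpMat_Hloc_mul hnn.measurable e n]
    with ω hα hBω hTω hcond_gram hcond_cross ⟨hsubω, hgramω⟩ hnearω i
  refine localFit_of_expansion (hcond_gram i) (hcond_cross i) hm hh hh_one hh_small
    (wellConditioned_monomialLoadings hnn.injective e hh hε (hsamp.one_le n hn) (hnearω i)
      (hsubω _ (hα i)))
    ((wellConditioned_derivMatrix hc (hgramω i) (hBω i)).mul_diagonal hw₀ hw)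
    (fun l k => (hTω i l k).trans ?_) hE
  rw [mul_assoc, ← mul_pow]
  gcongr
  exact hnearω i k

lemma tightEvents_localFit (hr : 1 ≤ r) (hreg : M.LatentRegularity μ A m)
    (hnn : M.IsNearestNeighbors K ρ nn) {ρ₀ ς : ℝ} {a : ℕ → ℝ}
    (hmatch : M.IndirectMatching μ ρ ρ₀ ς ς a) (hm : 1 ≤ m) {c : ℝ} (hc : 0 < c)
    (hgram : WPA1 μ fun n => {ω | ∀ i, c ≤ sMin (M.derivGram A e n i ω)})
    (hKn : Tendsto (fun n => (K n : ℝ) / n) atTop (𝓝 0))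
    (hδ : Tendsto (fun n => (M.delta K n)⁻¹ / bandwidth K ς ς r n ^ (m - 1)) atTop (𝓝 0))
    (ha : (fun n => a n ^ (1 / ς)) =o[atTop] bandwidth K ς ς r) :
    TightEvents μ fun E n ω => ∀ i, M.LocalFit μ A nn e (bandwidth K ς ς r n) E n i ω := by
  have hς := hmatch.lo_pos.ne'
  have hexp := tendsto_mul_exp_of_inv_delta_div
    (fun n hn => ⟨hnn.bandwidth_pos hn, hnn.bandwidth_le_one hς hn⟩) (eventually_p_pos hc hgram)
    (fun n hn => hnn.one_le hn) hδ
  obtain ⟨ν, hν, hsamp⟩ :=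
    hreg.exists_localSampling (Nat.one_le_iff_ne_zero.1 hr) hnn hς hKn hexp
  exact tightEvents_localFit_of_norm_nbr_sub_le hreg hnn hm hc hgram hsamp <|
    hnn.tightEvents_norm_nbr_sub_le hr hreg hmatch hsamp <|
      hmatch.eventually_le_rpow ((eventually_gt_atTop 0).mono fun n hn => hnn.bandwidth_pos hn) ha

end FactorArray

section ScaleDecay

variable {r N : ℕ} {h : ℕ → ℝ}

lemma GradedEnum.pow_le_pow_deg (e : GradedEnum r N) {x : ℝ} (hx : 0 ≤ x) (hx_one : x ≤ 1)
    (b : Fin ((N + r).choose r)) : x ^ N ≤ x ^ e.deg b :=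
  pow_le_pow_of_le_one hx hx_one (e.deg_le b)

lemma eventually_le_pow_div_pow_of_lt (hpos : ∀ n, 0 < n → 0 < h n)
    (hlim : Tendsto h atTop (𝓝 0)) {s t : ℕ} (hst : s < t) (C : ℝ) :
    ∀ᶠ n in atTop, C ≤ h n ^ s / h n ^ t := by
  have hlim_pos : Tendsto h atTop (𝓝[>] 0) :=
    tendsto_nhdsWithin_iff.2 ⟨hlim, (eventually_gt_atTop 0).mono hpos⟩
  have hinv : Tendsto (fun n => (h n)⁻¹ ^ (t - s)) atTop atTop :=
    (tendsto_pow_atTop (Nat.sub_pos_of_lt hst).ne').comp hlim_pos.inv_tendsto_nhdsGT_zero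
  filter_upwards [hinv.eventually_ge_atTop C, eventually_gt_atTop 0] with n hn hn_pos
  rwa [inv_pow, pow_sub₀ _ (hpos n hn_pos).ne' hst.le, mul_inv, inv_inv, mul_comm] at hn

lemma GradedEnum.exists_ratio_bounded_or_unbounded (e : GradedEnum r N)
    (hpos : ∀ n, 0 < n → 0 < h n) (hle : ∀ n, 0 < n → h n ≤ 1) (hlim : Tendsto h atTop (𝓝 0))
    (j : ℕ) : ∃ S : Set ℕ,
    (∃ C : ℝ, ∀ᶠ n in atTop, ∀ (i : Fin n) (hj : j + 1 < (N + r).choose r), (i : ℕ) ∈ S →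
      h n ^ e.deg ⟨j, Nat.lt_of_succ_lt hj⟩ / h n ^ e.deg ⟨j + 1, hj⟩ ≤ C) ∧
    (∀ C : ℝ, ∀ᶠ n in atTop, ∀ (i : Fin n) (hj : j + 1 < (N + r).choose r), (i : ℕ) ∉ S →
      C ≤ h n ^ e.deg ⟨j, Nat.lt_of_succ_lt hj⟩ / h n ^ e.deg ⟨j + 1, hj⟩) := by
  by_cases hdeg : ∃ hj : j + 1 < (N + r).choose r,
      e.deg ⟨j, Nat.lt_of_succ_lt hj⟩ < e.deg ⟨j + 1, hj⟩
  · obtain ⟨hj, hlt⟩ := hdeg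
    refine ⟨∅, ⟨0, .of_forall fun _ _ _ hi => hi.elim⟩, fun C => ?_⟩
    filter_upwards [eventually_le_pow_div_pow_of_lt hpos hlim hlt C] with n hn _ _ _ using hn
  · push Not at hdeg
    refine ⟨Set.univ, ⟨1, .of_forall fun n i hj _ => ?_⟩, fun _ => .of_forall
      fun _ _ _ hi => (hi (Set.mem_univ _)).elim⟩
    rw [div_le_one (pow_pos (hpos n i.pos) _)]
    exact pow_le_pow_of_le_one (hpos n i.pos).le (hle n i.pos) (hdeg hj)

lemma GradedEnum.eventually_pow_le_mul_pow_deg (e : GradedEnum r N)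
    (hpos : ∀ n, 0 < n → 0 < h n) (hle : ∀ n, 0 < n → h n ≤ 1) (hlim : Tendsto h atTop (𝓝 0))
    {ε : ℝ} (hε : 0 < ε) :
    ∀ᶠ n in atTop, ∀ b, h n ^ (N + 1) ≤ ε * h n ^ e.deg b := by
  filter_upwards [hlim.eventually_le_const hε, eventually_gt_atTop 0] with n hn hn_pos b
  have hh := (hpos n hn_pos).le
  rw [pow_succ']
  exact mul_le_mul hn (e.pow_le_pow_deg hh (hle n hn_pos) b) (pow_nonneg hh _) hε.le

lemma GradedEnum.eventually_div_pow_deg_le (e : GradedEnum r N)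
    (hpos : ∀ n, 0 < n → 0 < h n) (hle : ∀ n, 0 < n → h n ≤ 1) {x : ℕ → ℝ} (hx : ∀ n, 0 ≤ x n)
    (hlim : Tendsto (fun n => x n / h n ^ N) atTop (𝓝 0)) {ε : ℝ} (hε : 0 < ε) :
    ∀ᶠ n in atTop, ∀ b, x n / h n ^ e.deg b ≤ ε := by
  filter_upwards [hlim.eventually_le_const hε, eventually_gt_atTop 0] with n hn hn_pos b
  have hh := hpos n hn_pos
  exact (div_le_div_of_nonneg_left (hx n) (pow_pos hh N)
    (e.pow_le_pow_deg hh.le (hle n hn_pos) b)).trans hn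

end ScaleDecay

namespace FactorArray

variable {Ω : ℕ → Type*} [∀ n, MeasurableSpace (Ω n)] {r : ℕ} {M : FactorArray Ω r}
  {A : Set (EuclideanSpace ℝ (Fin r))} {μ : ∀ n, Measure (Ω n)} {m : ℕ} {K : ℕ → ℕ}
  {nn : ∀ n, M.MatchData n → Fin n → Fin (K n) → Fin n}

lemma delta_nonneg (M : FactorArray Ω r) (K : ℕ → ℕ) (n : ℕ) : 0 ≤ M.delta K n :=
  div_nonneg (Real.sqrt_nonneg _) (Real.sqrt_nonneg _)

lemma LatentRegularity.localApproximation [∀ n, IsProbabilityMeasure (μ n)]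
    (hreg : M.LatentRegularity μ A m) (hnn : ∀ n i k, Measurable fun V => nn n V i k)
    (hm : 1 ≤ m) (e : GradedEnum r (m - 1)) {h : ℕ → ℝ} (hpos : ∀ n, 0 < n → 0 < h n)
    (hle : ∀ n, 0 < n → h n ≤ 1) (hlim : Tendsto h atTop (𝓝 0))
    (hδ : Tendsto (fun n => (M.delta K n)⁻¹ / h n ^ (m - 1)) atTop (𝓝 0))
    (hfit : TightEvents μ fun E n ω => ∀ i, M.LocalFit μ A nn e (h n) E n i ω) :
    M.LocalApproximation μ A nn h m (fun _ _ => (m - 1 + r).choose r)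
      (fun n i ω => M.monomialLoadings nn e n i ω) (fun n _ b => h n ^ e.deg b) := by
  have hι : ∀ᶠ n in atTop, Nonempty (Fin n) :=
    (eventually_gt_atTop 0).mono fun n hn => ⟨⟨0, hn⟩⟩
  have hone : ∀ᶠ _ : ℕ in atTop, (0 : ℝ) < 1 := .of_forall fun _ => one_pos
  have hh_pow : ∀ᶠ n in atTop, 0 < h n ^ m :=
    (eventually_gt_atTop 0).mono fun n hn => pow_pos (hpos n hn) m
  exact
    { integrable_HΛ n i l b := hreg.integrable_Hloc_mul hnn e n i l b
      integrable_ΛΛ n i a b := hreg.integrable_loadings_gram hnn e n i a b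
      invertible := hfit.wpa1 fun _ _ _ _ hω i => (hω i).invertible
      d_pos _ _ := Nat.choose_pos (Nat.le_add_left r (m - 1))
      scale_pos n i _ := pow_pos (hpos n i.pos) _
      scale_anti n i _ _ hjk := pow_le_pow_of_le_one (hpos n i.pos).le (hle n i.pos) (e.mono hjk)
      loadings_max := TightEvents.stochLE_iSup hone (fun _ _ _ => matMaxNorm_nonneg _) <|
        hfit.mono fun E _ _ _ hω i => (mul_one E).symm ▸ (hω i).matMaxNorm_loadings_le
      loadings_min := TightEvents.one_stochLE_iInf hι (fun _ _ _ => sMin_nonneg _) <|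
        hfit.mono fun _ _ _ _ hω i => (hω i).le_sMin_scaledGram
      loadings_sup := TightEvents.stochLE_iSup hone (fun _ _ _ => sMax_nonneg _) <|
        hfit.mono fun E _ _ _ hω i => (mul_one E).symm ▸ (hω i).sMax_scaledGram_le
      scale_ratio := e.exists_ratio_bounded_or_unbounded hpos hle hlim
      bias := TightEvents.stochLE_iSup hh_pow (fun _ _ _ => matMaxNorm_nonneg _) <|
        hfit.mono fun _ _ n _ hω i => (hω i).matMaxNorm_Xiloc_le (hpos n i.pos).le
      bias_small ε hε := (e.eventually_pow_le_mul_pow_deg hpos hle hlim hε).mono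
        fun _ hn _ j _ => by simpa only [Nat.sub_add_cancel hm] using hn j
      noise_small ε hε := (e.eventually_div_pow_deg_le hpos hle
        (fun n => inv_nonneg.2 (M.delta_nonneg K n)) hδ hε).mono fun _ hn _ j _ => hn j
      factors_min := TightEvents.one_stochLE_iInf hι (fun _ _ _ => sMin_nonneg _) <|
        hfit.mono fun _ _ _ _ hω i => (hω i).le_sMin_factors
      factors_sup := TightEvents.stochLE_iSup hone (fun _ _ _ => sMax_nonneg _) <|
        hfit.mono fun E _ _ _ hω i => (mul_one E).symm ▸ (hω i).sMax_factors_le }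

end FactorArray

theorem mainTheorem8_general {Ω : ℕ → Type*} [∀ n, MeasurableSpace (Ω n)]
    (μ : ∀ n, Measure (Ω n)) [∀ n, IsProbabilityMeasure (μ n)]
    {r : ℕ} (hr : 1 ≤ r) (M : FactorArray Ω r) (A : Set (EuclideanSpace ℝ (Fin r)))
    (m : ℕ) (hm : 1 ≤ m) (hreg : M.LatentRegularity μ A m)
    (K : ℕ → ℕ) (ρ : ∀ n, M.MatchData n → Fin n → Fin n → ℝ)
    (nn : ∀ n, M.MatchData n → Fin n → Fin (K n) → Fin n)
    (hnn : M.IsNearestNeighbors K ρ nn)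
    (ρ₀ ς : ℝ) (a : ℕ → ℝ) (hmatch : M.IndirectMatching μ ρ ρ₀ ς ς a)
    (e : GradedEnum r (m - 1))
    (hgram : ∃ c : ℝ, 0 < c ∧
      WPA1 μ fun n => {ω | ∀ i, c ≤ sMin (M.derivGram A e n i ω)})
    (hKn : Tendsto (fun n => (K n : ℝ) / (n : ℝ)) atTop (𝓝 0))
    (hδ : Tendsto (fun n => (M.delta K n)⁻¹ / bandwidth K ς ς r n ^ (m - 1)) atTop (𝓝 0))
    (ha : (fun n => a n ^ (1 / ς)) =o[atTop] bandwidth K ς ς r) :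
    M.LocalApproximation μ A nn (bandwidth K ς ς r) m
      (fun _ _ => (m - 1 + r).choose r)
      (fun n i ω => M.monomialLoadings nn e n i ω)
      (fun n _ b => bandwidth K ς ς r n ^ e.deg b) := by
  obtain ⟨c, hc, hgram⟩ := hgram
  have hς := hmatch.lo_pos.ne'
  exact hreg.localApproximation hnn.measurable hm e (fun n hn => hnn.bandwidth_pos hn)
    (fun n hn => hnn.bandwidth_le_one hς hn)
    (tendsto_bandwidth hς (Nat.one_le_iff_ne_zero.1 hr) hKn) hδ
    (FactorArray.tightEvents_localFit hr hreg hnn hmatch hm hc hgram hKn hδ ha)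

theorem mainTheorem8 {Ω : ℕ → Type*} [∀ n, MeasurableSpace (Ω n)]
    (μ : ∀ n, Measure (Ω n)) [∀ n, IsProbabilityMeasure (μ n)]
    {r : ℕ} (hr : 1 ≤ r) (M : FactorArray Ω r) (hsplit : M.BalancedSplit)
    (A : Set (EuclideanSpace ℝ (Fin r))) (mbar : ℕ) (hreg : M.Regularities μ A mbar)
    (K : ℕ → ℕ) (ρ : ∀ n, M.MatchData n → Fin n → Fin n → ℝ)
    (hρ : ∀ n i j, Measurable fun V => ρ n V i j)
    (nn : ∀ n, M.MatchData n → Fin n → Fin (K n) → Fin n)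
    (hnn : M.IsNearestNeighbors K ρ nn)
    (ρ₀ ςlo ςup : ℝ) (a : ℕ → ℝ) (hmatch : M.IndirectMatching μ ρ ρ₀ ςlo ςup a)
    (m : ℕ) (hm : 1 ≤ m) (hmbar : m ≤ mbar) (e : GradedEnum r (m - 1))
    (hgram : ∃ c : ℝ, 0 < c ∧
      WPA1 μ fun n => {ω | ∀ i, c ≤ sMin (M.derivGram A e n i ω)})
    (hKn : Tendsto (fun n => (K n : ℝ) / (n : ℝ)) atTop (𝓝 0))
    (hδ : Tendsto (fun n => (M.delta K n)⁻¹ / bandwidth K ςlo ςup r n ^ (m - 1)) atTop (𝓝 0))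
    (ha : (fun n => a n ^ (1 / ςlo)) =o[atTop] bandwidth K ςlo ςup r)
    (hς : ςup = ςlo) :
    M.LocalApproximation μ A nn (bandwidth K ςlo ςup r) m
      (fun _ _ => (m - 1 + r).choose r)
      (fun n i ω => M.monomialLoadings nn e n i ω)
      (fun n _ b => bandwidth K ςlo ςup r n ^ e.deg b) := by
  subst hς
  exact mainTheorem8_general μ hr M A m hm (hreg.latentRegularity hmbar) K ρ nn hnn ρ₀ ςup a hmatch
    e hgram hKn hδ ha
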